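/- **Setting.** Equip $\mathbb{R}^{q\times q}$ with the trace inner product and Frobenius norm, $\mathbb{R}^d$ with the Euclidean norm; $\|\cdot\|_2$ denotes spectral norms of linear maps, $\|\mathsf E\|_{\mathrm{eu}}$ the Euclidean (Hilbert–Schmidt) norm of an operator $\mathsf E$ on $\mathbb{R}^{q\times q}$, and $\sigma_k$ the $k$-th largest singular value. A linear map $\mathcal L:\mathbb{R}^{q\times q}\to\mathbb{R}^d$ has components $\mathcal L_i\in\mathbb{R}^{q\times q}$, $\mathcal L(X)_i=\langle \mathcal L_i,X\rangle$; it is *normalized* if $\sum_i\mathcal L_i\mathcal L_i'=\sum_i\mathcal L_i'\mathcal L_i=qI$. Its restricted isometry constant $\delta_k(\mathcal L)$ is the smallest $\delta$ with $(1-\delta)\|X\|_F^2\le\|\mathcal L(X)\|^2\le(1+\delta)\|X\|_F^2$ for all $X$ of rank at most $k$. A *rank-preserver* is a linear operator $\mathcal M$ on $\mathbb{R}^{q\times q}$ with $\mathrm{rank}\,\mathcal M(X)=\mathrm{rank}\,X$ for all $X$, and $$\xi_{\mathcal L^\star}(\mathcal L)=\inf\{\|\mathsf E\|_{\mathrm{eu}}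 : \mathcal L=\mathcal L^\star\circ(\mathsf I+\mathsf E)\circ\mathcal M \text{ for some operator } \mathsf E \text{ and some rank-preserver } \mathcal M\}.$$ For matrices $X^{(1)},\dots,X^{(n)}$ let $\Lambda$ and $\Delta$ be half the sum and half the difference of the largest and the smallest eigenvalue of the covariance operator $Z\mapsto\frac1n\sum_j\langle X^{(j)},Z\rangle X^{(j)}$, and let $\Omega$ be the operator norm (with respect to $\|\cdot\|_{\mathrm{eu}}$) of $$\mathsf F\mapsto \mathcal P_{\mathbb W^\perp}\Big(\tfrac1n\sum_j \mathcal P_{\mathcal T(X^{(j)})}\circ\mathsf F\circ\big(Z\mapsto\langle X^{(j)},Z\rangle X^{(j)}\big)\Big),$$ where $\mathcal T(X)=\{XA+BX : A,B\in\mathbb{R}^{q\times q}\}$, $\mathbb W$ is the space of the operators $Z\mapsto W_2Z+ZW_1$ with $W_1,W_2\in\mathbb{R}^{q\times q}$, and $\mathcal P$ denotes orthogonal projection. **Algorithm.** Given data $y^{(1)},\dots,y^{(n)}\in\mathbb{R}^d$, a target rank $r$ and an initial map $\mathcal L^{(0)}$, the iterate $\mathcal L^{(t+1)}$ is obtained from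 $\mathcal L=\mathcal L^{(t)}$ as follows. 1. For each $j$, $\hat X^{(j)}$ is a minimizer of $\|y^{(j)}-\mathcal L(X)\|$ over $\mathrm{rank}(X)\le r$. It may be computed by Singular Value Projection, i.e. as the limit of the iteration started at $X=0$ which replaces $X$ by the rank-$r$ truncation of a singular value decomposition of $X+\nu\mathcal L'(y^{(j)}-\mathcal L(X))$. For damping parameters $\nu\in[3/4,1]$ a limit of this iteration is accepted as $\hat X^{(j)}$ without supposing that it is a minimizer. 2. $\tilde{\mathcal L}$ is a linear map minimizing $\sum_j\|y^{(j)}-\tilde{\mathcal L}(\hat X^{(j)})\|^2$. 3. $\mathcal L^{(t+1)}$ is the limit of the Operator Sinkhorn iteration started at $\tilde{\mathcal L}$, which alternates $\mathcal L_i\leftarrow\sqrt q\,R^{-1/2}\mathcal L_i$ with $R=\sum_i\mathcal L_i\mathcal L_i'$, and $\mathcal L_i\leftarrow\sqrt q\,\mathcal L_iC^{-1/2}$ with $C=\sum_i\mathcal L_i'\mathcal L_i$. **Proposition.** Let $n\ge1$, $1\le r<q$, $s>0$. Let $y^{(j)}=\mathcal L^\star(X^{(j)\star})$ for $j=1,\dots,n$,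 where $\mathrm{rank}(X^{(j)\star})=r$ and $s\ge\sigma_1(X^{(j)\star})\ge\sigma_r(X^{(j)\star})\ge s/2$ for every $j$, and the parameters of $\{X^{(j)\star}\}_{j=1}^n$ satisfy $\Omega/\Lambda\le\frac{d}{40q^2}$ and $\Delta/\Lambda\le\frac{\sqrt d}{150q^3}$. Let $\mathcal L^\star:\mathbb{R}^{q\times q}\to\mathbb{R}^d$ be linear, normalized and surjective, with $\delta_{4r}(\mathcal L^\star)\le\frac1{20}$ and $\|\mathcal L^\star\|_2^2\le\frac{5q^2}{d}$. Call $\mathcal L^{(0)}$ *admissible* if it is normalized and $\xi_{\mathcal L^\star}(\mathcal L^{(0)})<\frac{1}{36000\,q^{7/2}r^2\|\mathcal L^\star\|_2^2}$. For every admissible $\mathcal L^{(0)}$ the algorithm produces exactly one sequence of iterates $\{\mathcal L^{(t)}\}$. This sequence is a Cauchy sequence, so it converges, and its limit $\hat{\mathcal L}$ specifies the same regularizer as $\mathcal L^\star$: the images of the nuclear norm unit ball $\{X:\|X\|_\star\le1\}$ under $\hat{\mathcal L}$ and under $\mathcal L^\star$ are equal. Generically $\hat{\mathcal L}\ne\mathcal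 L^\star$: the set of admissible $\mathcal L^{(0)}$ from which the iterates converge to $\mathcal L^\star$ itself is nowhere dense in the set of all admissible $\mathcal L^{(0)}$. -/

import Mathlib

noncomputable section

open Filter Topology

namespace SemidefReg

/-- The space of real `q × q` matrices with the trace inner product `⟪A, B⟫ = tr (Aᵀ B)`;
its norm is the Frobenius norm. -/
abbrev Mat (q : ℕ) : Type := EuclideanSpace ℝ (Fin q × Fin q)

/-- Linear maps from `q × q` matrices to `ℝ^d`, with the spectral (`2 → 2`) norm. -/
abbrev LMap (q d : ℕ) : Type := Mat q →L[ℝ] EuclideanSpace ℝ (Fin d)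

/-- Linear operators on the space of `q × q` matrices, with the spectral norm. -/
abbrev MatOp (q : ℕ) : Type := Mat q →L[ℝ] Mat q

/-- The array of entries of an element of `Mat q`. -/
def toMat {q : ℕ} (X : Mat q) : Matrix (Fin q) (Fin q) ℝ := Matrix.of fun a b => X (a, b)

def rank {q : ℕ} (X : Mat q) : ℕ := (toMat X).rank

/-- The `k`-th largest singular value, counted from `k = 1`. -/
def sigma {q : ℕ} (k : ℕ) (X : Mat q) : ℝ :=
  (Matrix.toEuclideanLin (toMat X)).singularValues (k - 1)

def nuclearNorm {q : ℕ} (X : Mat q) : ℝ := ∑ k ∈ Finset.Icc 1 q, sigma k X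

/-- The image of the nuclear norm unit ball under `L`, i.e. the unit ball of the regularizer
that `L` specifies. -/
def regularizerBall {q d : ℕ} (L : LMap q d) : Set (EuclideanSpace ℝ (Fin d)) :=
  L '' {X | nuclearNorm X ≤ 1}

/-! ### Linear maps given by component functionals -/

/-- The matrix `L_i` with `L(X)_i = ⟪L_i, X⟫`. -/
def component {q d : ℕ} (L : LMap q d) (i : Fin d) : Matrix (Fin q) (Fin q) ℝ :=
  Matrix.of fun a b => L (EuclideanSpace.single (a, b) (1 : ℝ)) i

/-- The linear map `X ↦ (⟪A_i, X⟫)_i`. -/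
def ofComponents {q d : ℕ} (A : Fin d → Matrix (Fin q) (Fin q) ℝ) : LMap q d :=
  LinearMap.toContinuousLinearMap
    { toFun := fun X => WithLp.toLp 2 fun i => ∑ a, ∑ b, A i a b * X (a, b)
      map_add' := by
        intro X Y
        ext i
        simp [mul_add, Finset.sum_add_distrib]
      map_smul' := by
        intro c X
        ext i
        simp only [PiLp.smul_apply, smul_eq_mul, RingHom.id_apply, Finset.mul_sum]
        exact Finset.sum_congr rfl fun a _ => Finset.sum_congr rfl fun b _ => by ring }

def IsNormalized {q d : ℕ} (L : LMap q d) : Prop :=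
  ∑ i, component L i * (component L i).transpose = (q : ℝ) • 1 ∧
    ∑ i, (component L i).transpose * component L i = (q : ℝ) • 1

/-- The restricted isometry constant of order `k`. -/
def ripConst {q d : ℕ} (k : ℕ) (L : LMap q d) : ℝ :=
  sInf {δ : ℝ | ∀ X : Mat q, rank X ≤ k →
    (1 - δ) * ‖X‖ ^ 2 ≤ ‖L X‖ ^ 2 ∧ ‖L X‖ ^ 2 ≤ (1 + δ) * ‖X‖ ^ 2}

/-! ### Rank-preservers and the distance measure -/

def IsRankPreserver {q : ℕ} (M : MatOp q) : Prop := ∀ X : Mat q, rank (M X) = rank X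

/-- The space of operators on `q × q` matrices with the Euclidean (Hilbert-Schmidt) inner product:
an operator is recorded as the array of its entries in the standard basis. -/
abbrev HSOp (q : ℕ) : Type := EuclideanSpace ℝ ((Fin q × Fin q) × (Fin q × Fin q))

def hsEquiv (q : ℕ) : MatOp q ≃ₗ[ℝ] HSOp q :=
  LinearMap.toContinuousLinearMap.symm ≪≫ₗ
    LinearMap.toMatrix (EuclideanSpace.basisFun (Fin q × Fin q) ℝ).toBasis
        (EuclideanSpace.basisFun (Fin q × Fin q) ℝ).toBasis ≪≫ₗ
      (Matrix.ofLinearEquiv ℝ).symm ≪≫ₗ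
        (LinearEquiv.curry ℝ ℝ (Fin q × Fin q) (Fin q × Fin q)).symm ≪≫ₗ
          (WithLp.linearEquiv 2 ℝ ((Fin q × Fin q) × (Fin q × Fin q) → ℝ)).symm

/-- The Euclidean norm of an operator on `q × q` matrices. -/
def euNorm {q : ℕ} (E : MatOp q) : ℝ := ‖hsEquiv q E‖

/-- The distance measure `ξ_{L⋆}(L)`. -/
def xi {q d : ℕ} (Lstar L : LMap q d) : ℝ :=
  sInf {e : ℝ | ∃ E M : MatOp q, IsRankPreserver M ∧
    L = Lstar.comp ((ContinuousLinearMap.id ℝ (Mat q) + E).comp M) ∧ e = euNorm E}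

/-! ### Isotropy parameters of a collection of matrices -/

/-- The operator `A ⊠ B : Z ↦ ⟪B, Z⟫ A`. -/
def boxOp {q : ℕ} (A B : Mat q) : MatOp q := (innerSL ℝ B).smulRight A

def covariance {q n : ℕ} (X : Fin n → Mat q) : MatOp q :=
  (n : ℝ)⁻¹ • ∑ j, boxOp (X j) (X j)

def lambdaMax {q : ℕ} (T : MatOp q) : ℝ :=
  sSup {μ : ℝ | Module.End.HasEigenvalue (T : Module.End ℝ (Mat q)) μ}

def lambdaMin {q : ℕ} (T : MatOp q) : ℝ :=
  sInf {μ : ℝ | Module.End.HasEigenvalue (T : Module.End ℝ (Mat q)) μ}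

def covLambda {q n : ℕ} (X : Fin n → Mat q) : ℝ :=
  (lambdaMax (covariance X) + lambdaMin (covariance X)) / 2

def covDelta {q n : ℕ} (X : Fin n → Mat q) : ℝ :=
  (lambdaMax (covariance X) - lambdaMin (covariance X)) / 2

/-- The tangent space `{X A + B X}` at `X` of the variety of matrices of rank at most `rank X`. -/
def tangentSpace {q : ℕ} (X : Mat q) : Submodule ℝ (Mat q) where
  carrier := {Z | ∃ A B : Matrix (Fin q) (Fin q) ℝ, toMat Z = toMat X * A + B * toMat X}
  add_mem' := by
    rintro Y Z ⟨A, B, h⟩ ⟨A', B', h'⟩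
    refine ⟨A + A', B + B', ?_⟩
    have : toMat (Y + Z) = toMat Y + toMat Z := rfl
    rw [this, h, h', mul_add, add_mul]
    abel
  zero_mem' := by
    refine ⟨0, 0, ?_⟩
    simp only [mul_zero, zero_mul, add_zero]
    rfl
  smul_mem' := by
    rintro c Y ⟨A, B, h⟩
    refine ⟨c • A, c • B, ?_⟩
    have : toMat (c • Y) = c • toMat Y := rfl
    rw [this, h, smul_add, Matrix.mul_smul, Matrix.smul_mul]

/-- The space `𝕎` spanned by the operators `Z ↦ W₂ Z + Z W₁`: the tangent space at the identity of
the set of rank-preservers. -/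
def rankPreserverTangent (q : ℕ) :
    Submodule ℝ (HSOp q) :=
  Submodule.span ℝ {F | ∃ W₁ W₂ : Matrix (Fin q) (Fin q) ℝ, ∀ Z : Mat q,
    toMat ((hsEquiv q).symm F Z) = W₂ * toMat Z + toMat Z * W₁}

/-- The operator `(1/n) ∑ⱼ (Xⱼ ⊠ Xⱼ) ⊗ P_{T(Xⱼ)}` on the space of operators; it acts as
`F ↦ (1/n) ∑ⱼ P_{T(Xⱼ)} ∘ F ∘ (Xⱼ ⊠ Xⱼ)`. -/
def tangentCovariance {q n : ℕ} (X : Fin n → Mat q) : MatOp q →ₗ[ℝ] MatOp q where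
  toFun F := (n : ℝ)⁻¹ •
    ∑ j, (tangentSpace (X j)).starProjection.comp (F.comp (boxOp (X j) (X j)))
  map_add' F G := by
    simp [ContinuousLinearMap.add_comp, ContinuousLinearMap.comp_add, Finset.sum_add_distrib]
  map_smul' c F := by
    simp [ContinuousLinearMap.smul_comp, ← Finset.smul_sum,
      smul_comm c]

/-- The operator `tangentCovariance X` in the Euclidean coordinates on operators. -/
def tangentCovarianceHS {q n : ℕ} (X : Fin n → Mat q) : HSOp q →L[ℝ] HSOp q :=
  LinearMap.toContinuousLinearMap
    ((hsEquiv q).toLinearMap ∘ₗ tangentCovariance X ∘ₗ (hsEquiv q).symm.toLinearMap)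

/-- The parameter `Ω`: the spectral norm of `P_{𝕎^⊥} ∘ (1/n) ∑ⱼ (Xⱼ ⊠ Xⱼ) ⊗ P_{T(Xⱼ)}`
with respect to the Euclidean norm on operators. -/
def covOmega {q n : ℕ} (X : Fin n → Mat q) : ℝ :=
  ‖((rankPreserverTangent q)ᗮ.starProjection : HSOp q →L[ℝ] HSOp q).comp (tangentCovarianceHS X)‖

/-! ### The algorithm -/

/-- `X` is a solution of `min ‖y - L(X)‖` subject to `rank X ≤ r`. -/
def IsRankConstrainedMin {q d : ℕ} (L : LMap q d) (y : EuclideanSpace ℝ (Fin d)) (r : ℕ)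
    (X : Mat q) : Prop :=
  rank X ≤ r ∧ ∀ Z : Mat q, rank Z ≤ r → ‖y - L X‖ ≤ ‖y - L Z‖

/-- `Z` is obtained from `Y` by keeping the top `r` terms of a singular value decomposition. -/
def IsTruncatedSVD {q : ℕ} (r : ℕ) (Y Z : Mat q) : Prop :=
  ∃ U ∈ Matrix.orthogonalGroup (Fin q) ℝ, ∃ V ∈ Matrix.orthogonalGroup (Fin q) ℝ,
    ∃ τ : Fin q → ℝ, Antitone τ ∧ (∀ i, 0 ≤ τ i) ∧
      toMat Y = U * Matrix.diagonal τ * V.transpose ∧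
      toMat Z = U * Matrix.diagonal (fun i : Fin q => if (i : ℕ) < r then τ i else 0) * V.transpose

/-- `X` is the limit of Singular Value Projection with damping parameter `ν`, started at `0`. -/
def IsSVPOutput {q d : ℕ} (L : LMap q d) (y : EuclideanSpace ℝ (Fin d)) (r : ℕ) (ν : ℝ)
    (X : Mat q) : Prop :=
  ∃ Z : ℕ → Mat q, Z 0 = 0 ∧
    (∀ k, IsTruncatedSVD r (Z k + ν • ContinuousLinearMap.adjoint L (y - L (Z k))) (Z (k + 1))) ∧
    Tendsto Z atTop (𝓝 X)

/-- The update of a low-rank matrix with `L` fixed: an exact solution of the rank-constrained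
problem, however it was computed, or the output of Singular Value Projection with a damping
parameter in `[3/4, 1]`, whether or not it is known to solve that problem. -/
def IsLowRankUpdate {q d : ℕ} (L : LMap q d) (y : EuclideanSpace ℝ (Fin d)) (r : ℕ)
    (X : Mat q) : Prop :=
  IsRankConstrainedMin L y r X ∨ ∃ ν ∈ Set.Icc (3 / 4 : ℝ) 1, IsSVPOutput L y r ν X

/-- `L` is a least-squares solution of `y j ≈ L (X j)`. -/
def IsLeastSquares {q d n : ℕ} (y : Fin n → EuclideanSpace ℝ (Fin d)) (X : Fin n → Mat q)
    (L : LMap q d) : Prop :=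
  ∀ L' : LMap q d, ∑ j, ‖y j - L (X j)‖ ^ 2 ≤ ∑ j, ‖y j - L' (X j)‖ ^ 2

/-- The matrix `R^{-1/2}` for a symmetric positive-definite `R`. -/
def invSqrt {q : ℕ} (R : Matrix (Fin q) (Fin q) ℝ) : Matrix (Fin q) (Fin q) ℝ :=
  cfc (fun x : ℝ => (√x)⁻¹) R

def sinkhornRow {q d : ℕ} (A : Fin d → Matrix (Fin q) (Fin q) ℝ) :
    Fin d → Matrix (Fin q) (Fin q) ℝ :=
  fun i => √(q : ℝ) • (invSqrt (∑ k, A k * (A k).transpose) * A i)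

def sinkhornCol {q d : ℕ} (A : Fin d → Matrix (Fin q) (Fin q) ℝ) :
    Fin d → Matrix (Fin q) (Fin q) ℝ :=
  fun i => √(q : ℝ) • (A i * invSqrt (∑ k, (A k).transpose * A k))

/-- `L'` is the limit of the Operator Sinkhorn iteration started at `L`. -/
def IsSinkhornOutput {q d : ℕ} (L L' : LMap q d) : Prop :=
  Tendsto (fun k : ℕ => ofComponents ((fun A => sinkhornCol (sinkhornRow A))^[k] (component L)))
    atTop (𝓝 L')

/-- One pass of the alternating update algorithm: low-rank updates, least squares, and
normalization. -/
def IsUpdate {q d n : ℕ} (y : Fin n → EuclideanSpace ℝ (Fin d)) (r : ℕ) (L L' : LMap q d) : Prop :=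
  ∃ (X : Fin n → Mat q) (Lt : LMap q d),
    (∀ j, IsLowRankUpdate L (y j) r (X j)) ∧ IsLeastSquares y X Lt ∧ IsSinkhornOutput Lt L'

/-- `L 0, L 1, …` is a sequence of iterates of the algorithm with initial guess `L₀`. -/
def IsRun {q d n : ℕ} (y : Fin n → EuclideanSpace ℝ (Fin d)) (r : ℕ) (L₀ : LMap q d)
    (L : ℕ → LMap q d) : Prop :=
  L 0 = L₀ ∧ ∀ t, IsUpdate y r (L t) (L (t + 1))

/-- Normalized initial guesses that are close enough to `L⋆` in the distance measure. -/
def IsAdmissibleGuess {q d : ℕ} (Lstar : LMap q d) (r : ℕ) (L₀ : LMap q d) : Prop :=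
  IsNormalized L₀ ∧
    xi Lstar L₀ < 1 / (36000 * (q : ℝ) ^ (7 / 2 : ℝ) * (r : ℝ) ^ 2 * ‖Lstar‖ ^ 2)

end SemidefReg

end

noncomputable section

open Filter Topology
open scoped Matrix.Norms.L2Operator InnerProductSpace

namespace SemidefReg

variable {q d n : ℕ}

/-! ### Matrices as vectors -/


/-! A map near L⋆ in the distance `xi` is written L = (L⋆ + C) ∘ M, with M a rank-preserver and C of
small Hilbert–Schmidt norm e. The core of the proof is that one pass of the algorithm yields such a
representation again, with e replaced by e/2 and with a different M. The operator M needs no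
separate control. A linear rank-preserver has the form Z ↦ UZV or Z ↦ UZᵀV
(`IsRankPreserver.exists_sandwich`), and when L and L⋆ are both normalized, U and V are orthogonal
up to O(e) and up to a scalar that cancels (`IsRankPreserver.isNearOrthogonal`). Hence M transports
the subproblems for L to those for L⋆ + C with almost unchanged norms.

Low-rank update. Minimizers and Singular Value Projection limits share a global first-order
condition, `IsStat`. With the restricted isometry property it has a unique solution Xt = M X̂, at
distance O(‖C X‖) from the true X (`IsStat.unique`, `IsStat.norm_sub_le`). Split C = Cp + L⋆ ∘ T
with T Z = AZ + ZB and Cp orthogonal to all maps of the form L⋆ ∘ T. The operator T is an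
infinitesimal rank-preserver. Up to second order Xt - X = -T X + t, where t is tangent at X and is
controlled by the tangential projection of L⋆ᵀ Cp X (`IsStat.decomposition`).

Least squares. The unique solution is (L⋆ + L⋆ D) ∘ M, where D times the covariance of the Xt equals
minus the average of (Xt - X) ⊠ Xt. The covariance is nearly Λ times the identity. Pair L⋆ D with a
map G orthogonal to all L⋆ ∘ T: the contribution of T X nearly vanishes, and that of t is bounded by
Cauchy–Schwarz and two averages governed by Ω. Since Ω ‖L⋆‖² ≤ Λ/8, the normal part of L⋆ D has norm
at most e/4 (`IsEnsemble.hsInner_update_le`). The tangential part is only O(e), but to second order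
L⋆ + L⋆ ∘ T is L⋆ composed with Z ↦ (1+A)Z(1+B), so it is moved into the rank-preserver
(`exists_absorbed_update`).

Normalization. For a family aᵢ that is nearly isometric on rank-one matrices, X ↦ q⁻¹ ∑ aᵢ X aᵢᵀ is
close to X ↦ (tr X / q) 1 on symmetric matrices. It therefore contracts traceless ones, and Operator
Sinkhorn converges geometrically (`sinkhorn_converges`). Its effect is composition with one more
two-sided multiplication, which leaves C alone.

Thus errors halve, the steps are summable, and the iterates are Cauchy. In the limit C vanishes and
M accumulates at an orthogonal operator, so the limit is L⋆ ∘ M with M preserving singular values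
(`IsTrace.exists_limit`).

For the last claim, the limit F(L₀) depends continuously on L₀ and satisfies F(L₀ ∘ U) = F(L₀) ∘ U
for left multiplication by an orthogonal U, which preserves admissibility. The set F⁻¹(L⋆) is
closed. At an interior point, a small rotation U would give L⋆ ∘ U = L⋆, contradicting injectivity
of L⋆ on rank-one matrices. -/

/-- The inverse of `toMat`. -/
def ofMat (A : Matrix (Fin q) (Fin q) ℝ) : Mat q := WithLp.toLp 2 fun p => A p.1 p.2

@[simp] lemma toMat_ofMat (A : Matrix (Fin q) (Fin q) ℝ) : toMat (ofMat A) = A := rfl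
@[simp] lemma ofMat_toMat (X : Mat q) : ofMat (toMat X) = X := rfl
@[simp] lemma toMat_add (X Y : Mat q) : toMat (X + Y) = toMat X + toMat Y := rfl
@[simp] lemma toMat_sub (X Y : Mat q) : toMat (X - Y) = toMat X - toMat Y := rfl
@[simp] lemma toMat_smul (c : ℝ) (X : Mat q) : toMat (c • X) = c • toMat X := rfl
@[simp] lemma toMat_zero : toMat (0 : Mat q) = 0 := rfl
lemma toMat_apply (X : Mat q) (a b : Fin q) : toMat X a b = X (a, b) := rfl
lemma toMat_injective : Function.Injective (toMat (q := q)) := fun X Y h => by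
  rw [← ofMat_toMat X, h, ofMat_toMat]

@[simp] lemma toMat_eq_zero {X : Mat q} : toMat X = 0 ↔ X = 0 :=
  ⟨fun h => toMat_injective (by simpa using h), fun h => by simp [h]⟩

lemma continuous_ofMat : Continuous (ofMat (q := q)) := by
  unfold ofMat
  refine (PiLp.continuous_toLp 2 _).comp ?_
  fun_prop

lemma norm_sq_eq_sum (X : Mat q) : ‖X‖ ^ 2 = ∑ b, ∑ a, toMat X a b ^ 2 := by
  rw [EuclideanSpace.norm_sq_eq, Fintype.sum_prod_type, Finset.sum_comm]
  simp [toMat_apply]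

/-- Left multiplication. -/
def lmul (A : Matrix (Fin q) (Fin q) ℝ) : MatOp q :=
  LinearMap.toContinuousLinearMap
    { toFun := fun X => ofMat (A * toMat X)
      map_add' := fun X Y => toMat_injective (by simp [mul_add])
      map_smul' := fun c X => toMat_injective (by simp) }

/-- Right multiplication. -/
def rmul (B : Matrix (Fin q) (Fin q) ℝ) : MatOp q :=
  LinearMap.toContinuousLinearMap
    { toFun := fun X => ofMat (toMat X * B)
      map_add' := fun X Y => toMat_injective (by simp [add_mul])
      map_smul' := fun c X => toMat_injective (by simp) }

/-- The operator `X ↦ A X B`. -/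
def sandwich (A B : Matrix (Fin q) (Fin q) ℝ) : MatOp q := (lmul A).comp (rmul B)

/-- Transposition. -/
def transposeOp (q : ℕ) : MatOp q :=
  LinearMap.toContinuousLinearMap
    { toFun := fun X => ofMat (toMat X).transpose
      map_add' := fun X Y => toMat_injective (by simp)
      map_smul' := fun c X => toMat_injective (by simp) }

@[simp] lemma toMat_lmul (A : Matrix (Fin q) (Fin q) ℝ) (X : Mat q) :
    toMat (lmul A X) = A * toMat X := rfl
@[simp] lemma toMat_rmul (A : Matrix (Fin q) (Fin q) ℝ) (X : Mat q) :
    toMat (rmul A X) = toMat X * A := rfl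
@[simp] lemma toMat_sandwich (A B : Matrix (Fin q) (Fin q) ℝ) (X : Mat q) :
    toMat (sandwich A B X) = A * toMat X * B := by
  simp [sandwich, mul_assoc]
@[simp] lemma toMat_transposeOp (X : Mat q) :
    toMat (transposeOp q X) = (toMat X).transpose := rfl

lemma norm_transposeOp (X : Mat q) : ‖transposeOp q X‖ = ‖X‖ := by
  rw [← sq_eq_sq₀ (norm_nonneg _) (norm_nonneg _), norm_sq_eq_sum, norm_sq_eq_sum,
    Finset.sum_comm]
  simp

lemma norm_transpose (A : Matrix (Fin q) (Fin q) ℝ) : ‖A.transpose‖ = ‖A‖ := by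
  rw [← Matrix.conjTranspose_eq_transpose_of_trivial, Matrix.l2_opNorm_conjTranspose]

/-- `A` acts on each column separately. The norm on `Matrix` is the spectral one, the norm on `Mat
q` the Frobenius one. -/
lemma norm_lmul_apply_le (A : Matrix (Fin q) (Fin q) ℝ) (X : Mat q) :
    ‖lmul A X‖ ≤ ‖A‖ * ‖X‖ := by
  refine le_of_sq_le_sq ?_ (by positivity)
  rw [mul_pow, norm_sq_eq_sum, norm_sq_eq_sum, Finset.mul_sum]
  refine Finset.sum_le_sum fun b _ => ?_
  have h := Matrix.l2_opNorm_mulVec A (WithLp.toLp 2 fun a => toMat X a b)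
  have h2 := pow_le_pow_left₀ (norm_nonneg _) h 2
  rw [mul_pow, EuclideanSpace.norm_sq_eq, EuclideanSpace.norm_sq_eq] at h2
  simpa [Matrix.mul_apply, Matrix.mulVec, dotProduct] using h2

lemma rmul_eq (B : Matrix (Fin q) (Fin q) ℝ) (X : Mat q) :
    rmul B X = transposeOp q (lmul B.transpose (transposeOp q X)) :=
  toMat_injective (by simp)

lemma norm_rmul_apply_le (B : Matrix (Fin q) (Fin q) ℝ) (X : Mat q) :
    ‖rmul B X‖ ≤ ‖B‖ * ‖X‖ := by
  rw [rmul_eq, norm_transposeOp]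
  refine (norm_lmul_apply_le _ _).trans_eq ?_
  rw [norm_transpose, norm_transposeOp]

lemma norm_lmul_le (A : Matrix (Fin q) (Fin q) ℝ) : ‖lmul A‖ ≤ ‖A‖ :=
  ContinuousLinearMap.opNorm_le_bound _ (norm_nonneg _) (norm_lmul_apply_le A)

lemma norm_rmul_le (A : Matrix (Fin q) (Fin q) ℝ) : ‖rmul A‖ ≤ ‖A‖ :=
  ContinuousLinearMap.opNorm_le_bound _ (norm_nonneg _) (norm_rmul_apply_le A)

lemma norm_sandwich_le (A B : Matrix (Fin q) (Fin q) ℝ) : ‖sandwich A B‖ ≤ ‖A‖ * ‖B‖ :=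
  (ContinuousLinearMap.opNorm_comp_le _ _).trans
    (mul_le_mul (norm_lmul_le A) (norm_rmul_le B) (norm_nonneg _) (norm_nonneg _))

/-- Spectral against Frobenius norm, by Cauchy–Schwarz in each row. -/
lemma norm_toMat_le (X : Mat q) : ‖toMat X‖ ≤ ‖X‖ := by
  rw [Matrix.l2_opNorm_def]
  refine ContinuousLinearMap.opNorm_le_bound _ (norm_nonneg _) fun x => ?_
  refine le_of_sq_le_sq ?_ (by positivity)
  rw [mul_pow, norm_sq_eq_sum, EuclideanSpace.norm_sq_eq, EuclideanSpace.norm_sq_eq,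
    Finset.sum_comm, Finset.sum_mul]
  refine Finset.sum_le_sum fun a _ => ?_
  have := Finset.sum_mul_sq_le_sq_mul_sq Finset.univ (fun b => toMat X a b) (fun b => x b)
  simpa [Matrix.mulVec, dotProduct] using this

lemma transposeOp_transposeOp (X : Mat q) : transposeOp q (transposeOp q X) = X :=
  toMat_injective (by simp)

/-! ### Rank -/

lemma rank_lmul_le (A : Matrix (Fin q) (Fin q) ℝ) (X : Mat q) : rank (lmul A X) ≤ rank X := by
  rw [rank, rank, toMat_lmul]; exact Matrix.rank_mul_le_right _ _

lemma rank_rmul_le (A : Matrix (Fin q) (Fin q) ℝ) (X : Mat q) : rank (rmul A X) ≤ rank X := by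
  rw [rank, rank, toMat_rmul]; exact Matrix.rank_mul_le_left _ _

lemma rank_add_le (X Y : Mat q) : rank (X + Y) ≤ rank X + rank Y := by
  rw [rank, rank, rank, toMat_add, Matrix.rank, Matrix.mulVecLin_add]
  refine (Submodule.finrank_mono (t := (toMat X).mulVecLin.range ⊔ (toMat Y).mulVecLin.range)
    ?_).trans (Submodule.finrank_add_le_finrank_add_finrank _ _)
  rintro _ ⟨x, rfl⟩
  exact Submodule.add_mem_sup ⟨x, rfl⟩ ⟨x, rfl⟩

lemma rank_smul_le (c : ℝ) (X : Mat q) : rank (c • X) ≤ rank X := by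
  have : c • X = lmul (c • 1) X := toMat_injective (by simp)
  rw [this]; exact rank_lmul_le _ _

lemma rank_neg (X : Mat q) : rank (-X) = rank X := by
  refine le_antisymm ?_ ?_
  · simpa using rank_smul_le (-1) X
  · simpa using rank_smul_le (-1) (-X)

lemma rank_sub_le (X Y : Mat q) : rank (X - Y) ≤ rank X + rank Y := by
  rw [sub_eq_add_neg]; exact (rank_add_le _ _).trans_eq (by rw [rank_neg])

lemma rank_zero : rank (0 : Mat q) = 0 := by simp [rank]

lemma rank_transposeOp (X : Mat q) : rank (transposeOp q X) = rank X := by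
  simp [rank, Matrix.rank_transpose]

lemma rank_single_le (p : Fin q × Fin q) : rank (EuclideanSpace.single p (1 : ℝ)) ≤ 1 := by
  have : toMat (EuclideanSpace.single p (1 : ℝ)) =
      Matrix.vecMulVec (Pi.single p.1 1) (Pi.single p.2 1) := by
    ext a b
    rw [toMat_apply]
    by_cases h : a = p.1 <;> by_cases h' : b = p.2 <;>
      simp [Matrix.vecMulVec_apply, h, h', Prod.ext_iff]
  rw [rank, this]
  exact Matrix.rank_vecMulVec_le _ _

/-! ### Hilbert-Schmidt inner product -/

section HS
variable {V V' : Type*} [NormedAddCommGroup V] [InnerProductSpace ℝ V]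
  [NormedAddCommGroup V'] [InnerProductSpace ℝ V']

/-- A linear map on matrices as the array of the images of the standard basis. Its norm is the
Hilbert-Schmidt norm. -/
def cols (V : Type*) [NormedAddCommGroup V] [InnerProductSpace ℝ V] :
    (Mat q →L[ℝ] V) →ₗ[ℝ] PiLp 2 (fun _ : Fin q × Fin q => V) where
  toFun A := WithLp.toLp 2 fun p => A (EuclideanSpace.single p 1)
  map_add' A B := by ext p; simp
  map_smul' c A := by ext p; simp

/-- The Hilbert-Schmidt norm. -/
def hsNorm (A : Mat q →L[ℝ] V) : ℝ := ‖cols V A‖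

/-- The Hilbert-Schmidt inner product. -/
def hsInner (A B : Mat q →L[ℝ] V) : ℝ := ⟪cols V A, cols V B⟫_ℝ

lemma hsInner_eq_sum (A B : Mat q →L[ℝ] V) :
    hsInner A B = ∑ p, ⟪A (EuclideanSpace.single p 1), B (EuclideanSpace.single p 1)⟫_ℝ := by
  simp [hsInner, cols, PiLp.inner_apply]

lemma hsNorm_sq (A : Mat q →L[ℝ] V) :
    hsNorm A ^ 2 = ∑ p, ‖A (EuclideanSpace.single p 1)‖ ^ 2 := by
  rw [hsNorm, PiLp.norm_sq_eq_of_L2]; rfl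

lemma hsNorm_nonneg (A : Mat q →L[ℝ] V) : 0 ≤ hsNorm A := norm_nonneg _

lemma hsInner_self (A : Mat q →L[ℝ] V) : hsInner A A = hsNorm A ^ 2 :=
  real_inner_self_eq_norm_sq _

lemma hsInner_add_right (A B C : Mat q →L[ℝ] V) :
    hsInner A (B + C) = hsInner A B + hsInner A C := by simp [hsInner, inner_add_right]
lemma hsInner_sub_right (A B C : Mat q →L[ℝ] V) :
    hsInner A (B - C) = hsInner A B - hsInner A C := by simp [hsInner, inner_sub_right]
lemma hsInner_neg_right (A B : Mat q →L[ℝ] V) :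
    hsInner A (-B) = -hsInner A B := by simp [hsInner, inner_neg_right]
lemma hsInner_smul_right (c : ℝ) (A B : Mat q →L[ℝ] V) :
    hsInner A (c • B) = c * hsInner A B := by simp [hsInner, inner_smul_right]
lemma hsInner_sum_right {ι : Type*} (s : Finset ι) (A : Mat q →L[ℝ] V) (B : ι → Mat q →L[ℝ] V) :
    hsInner A (∑ i ∈ s, B i) = ∑ i ∈ s, hsInner A (B i) := by
  simp [hsInner, inner_sum]

lemma abs_hsInner_le (A B : Mat q →L[ℝ] V) : |hsInner A B| ≤ hsNorm A * hsNorm B :=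
  abs_real_inner_le_norm _ _
lemma hsInner_le (A B : Mat q →L[ℝ] V) : hsInner A B ≤ hsNorm A * hsNorm B :=
  real_inner_le_norm _ _

lemma hsNorm_sub_le (A B : Mat q →L[ℝ] V) : hsNorm (A - B) ≤ hsNorm A + hsNorm B := by
  simpa [hsNorm] using norm_sub_le (cols V A) (cols V B)

lemma sum_single_eq (x : Mat q) : ∑ p, x p • EuclideanSpace.single p (1 : ℝ) = x := by
  ext p
  simp [Finset.sum_apply, Pi.single_apply]

lemma norm_apply_le_hsNorm (A : Mat q →L[ℝ] V) (x : Mat q) : ‖A x‖ ≤ hsNorm A * ‖x‖ := by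
  conv_lhs => rw [← sum_single_eq x, map_sum]
  refine (norm_sum_le _ _).trans ?_
  simp only [map_smul, norm_smul]
  refine le_of_sq_le_sq ?_ (mul_nonneg (hsNorm_nonneg _) (norm_nonneg _))
  have := Finset.sum_mul_sq_le_sq_mul_sq Finset.univ (fun p => ‖x p‖)
    (fun p => ‖A (EuclideanSpace.single p 1)‖)
  rw [mul_pow, hsNorm_sq, EuclideanSpace.norm_sq_eq, mul_comm]
  exact this

lemma norm_le_hsNorm (A : Mat q →L[ℝ] V) : ‖A‖ ≤ hsNorm A :=
  ContinuousLinearMap.opNorm_le_bound _ (hsNorm_nonneg _) (norm_apply_le_hsNorm A)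

lemma hsNorm_comp_le (B : V →L[ℝ] V') (A : Mat q →L[ℝ] V) :
    hsNorm (B.comp A) ≤ ‖B‖ * hsNorm A := by
  refine le_of_sq_le_sq ?_ (mul_nonneg (norm_nonneg _) (hsNorm_nonneg _))
  rw [mul_pow, hsNorm_sq, hsNorm_sq, Finset.mul_sum]
  refine Finset.sum_le_sum fun p _ => ?_
  rw [← mul_pow]
  exact pow_le_pow_left₀ (norm_nonneg _) (B.le_opNorm _) 2

lemma hsNorm_id : hsNorm (ContinuousLinearMap.id ℝ (Mat q)) = q := by
  rw [← sq_eq_sq₀ (hsNorm_nonneg _) (Nat.cast_nonneg _), hsNorm_sq]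
  simp [sq]

lemma hsNorm_le_of_op (A : Mat q →L[ℝ] V) : hsNorm A ≤ ‖A‖ * q := by
  simpa [hsNorm_id] using hsNorm_comp_le A (ContinuousLinearMap.id ℝ (Mat q))

/-- Rank-one operators represent evaluation in Hilbert–Schmidt duality. Averages over the data
thereby become pairings with the covariance operator. -/
lemma hsInner_smulRight (G : Mat q →L[ℝ] V) (u : V) (x : Mat q) :
    hsInner G ((innerSL ℝ x).smulRight u) = ⟪G x, u⟫_ℝ := by
  rw [hsInner_eq_sum]
  conv_rhs => rw [← sum_single_eq x, map_sum, sum_inner]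
  refine Finset.sum_congr rfl fun p _ => ?_
  rw [ContinuousLinearMap.smulRight_apply, innerSL_apply_apply, inner_smul_right, map_smul,
    inner_smul_left, EuclideanSpace.inner_single_right]
  simp

variable [FiniteDimensional ℝ V]

/-- The squared entries may be summed in either order. This turns composition on the right into
composition of adjoints on the left, which gives `hsNorm_comp_right_le`. -/
lemma hsNorm_sq_eq_adjoint (A : Mat q →L[ℝ] V) {ι : Type*} [Fintype ι]
    (b : OrthonormalBasis ι ℝ V) :
    hsNorm A ^ 2 = ∑ i, ‖(haveI := FiniteDimensional.complete ℝ V;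
      ContinuousLinearMap.adjoint A (b i))‖ ^ 2 := by
  have := FiniteDimensional.complete ℝ V
  rw [hsNorm_sq]
  have h1 : ∀ p, ‖A (EuclideanSpace.single p 1)‖ ^ 2 =
      ∑ i, (ContinuousLinearMap.adjoint A (b i)) p ^ 2 := by
    intro p
    rw [← b.sum_sq_norm_inner_right]
    refine Finset.sum_congr rfl fun i _ => ?_
    rw [← ContinuousLinearMap.adjoint_inner_left, EuclideanSpace.inner_single_right]
    simp
  simp only [h1]
  rw [Finset.sum_comm]
  refine Finset.sum_congr rfl fun i _ => ?_
  rw [EuclideanSpace.norm_sq_eq]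
  simp

lemma hsNorm_comp_right_le (A : Mat q →L[ℝ] V) (M : MatOp q) :
    hsNorm (A.comp M) ≤ hsNorm A * ‖M‖ := by
  have := FiniteDimensional.complete ℝ V
  refine le_of_sq_le_sq ?_ (mul_nonneg (hsNorm_nonneg _) (norm_nonneg _))
  rw [mul_pow, hsNorm_sq_eq_adjoint _ (stdOrthonormalBasis ℝ V),
    hsNorm_sq_eq_adjoint _ (stdOrthonormalBasis ℝ V), Finset.sum_mul]
  refine Finset.sum_le_sum fun p _ => ?_
  rw [← mul_pow, ContinuousLinearMap.adjoint_comp]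
  refine pow_le_pow_left₀ (norm_nonneg _) ?_ 2
  refine ((ContinuousLinearMap.adjoint M).le_opNorm _).trans_eq ?_
  rw [LinearIsometryEquiv.norm_map, mul_comm]
  rfl

end HS

/-! ### Generalized inverses -/


lemma isSelfAdjoint_transpose_mul_self (X : Matrix (Fin q) (Fin q) ℝ) :
    IsSelfAdjoint (X.transpose * X) := by
  rw [← Matrix.conjTranspose_eq_transpose_of_trivial]
  exact IsSelfAdjoint.star_mul_self X

lemma continuousOn_spectrum (A : Matrix (Fin q) (Fin q) ℝ) (f : ℝ → ℝ) :
    ContinuousOn f (spectrum ℝ A) := by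
  have : (spectrum ℝ A).Finite := Matrix.finite_real_spectrum
  exact this.continuousOn f

lemma cfc_mul_finite (A : Matrix (Fin q) (Fin q) ℝ) (f g : ℝ → ℝ) :
    cfc (fun x => f x * g x) A = cfc f A * cfc g A :=
  cfc_mul f g A (continuousOn_spectrum A f) (continuousOn_spectrum A g)

lemma star_eq_transpose (A : Matrix (Fin q) (Fin q) ℝ) : star A = A.transpose := by
  rw [Matrix.star_eq_conjTranspose, Matrix.conjTranspose_eq_transpose_of_trivial]

/-- A reflexive generalized inverse, with norm bounded by the inverse of the smallest nonzero
singular value. -/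
lemma exists_generalized_inverse (X : Matrix (Fin q) (Fin q) ℝ) :
    ∃ Y : Matrix (Fin q) (Fin q) ℝ, X * Y * X = X ∧ Y * X * Y = Y ∧
      ∀ c : ℝ, 0 < c → (∀ μ ∈ spectrum ℝ (X.transpose * X), μ ≠ 0 → c ^ 2 ≤ μ) →
        ‖Y‖ ≤ c⁻¹ := by
  set G := X.transpose * X with hG
  have hsa : IsSelfAdjoint G := isSelfAdjoint_transpose_mul_self X
  -- The convention `0⁻¹ = 0` makes `F` the Moore–Penrose inverse of `G`; the generalized inverse of
  -- `X` will be `F Xᵀ`.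
  set F := cfc (fun x : ℝ => x⁻¹) G with hF
  have hFsa : F.transpose = F := by
    rw [← star_eq_transpose]; exact cfc_predicate (R := ℝ) (p := IsSelfAdjoint) _ G
  have hGsa : G.transpose = G := by rw [← star_eq_transpose]; exact hsa
  have hid : cfc (fun x : ℝ => x) G = G := cfc_id' ℝ G
  have e1 : F * G * F = F := by
    conv_lhs => rw [← hid, hF, ← cfc_mul_finite, ← cfc_mul_finite]
    rw [hF]
    refine cfc_congr fun x _ => ?_
    by_cases hx : x = 0 <;> simp [hx]
  have e2 : G * F * G = G := by
    conv_lhs => rw [← hid, hF, ← cfc_mul_finite, ← cfc_mul_finite]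
    conv_rhs => rw [← hid]
    refine cfc_congr fun x _ => ?_
    by_cases hx : x = 0 <;> simp [hx]
  -- By the C⋆-identity it suffices that the difference times its adjoint vanishes, which is a
  -- computation in `F` and `G` alone.
  have e3 : X * F * G = X := by
    have : star (X * F * G - X) * (X * F * G - X) = 0 := by
      rw [star_eq_transpose]
      simp only [Matrix.transpose_sub, Matrix.transpose_mul, hFsa, hGsa]
      calc (G * (F * X.transpose) - X.transpose) * (X * F * G - X)
          = (G * F * G) * F * G - G * F * G - G * F * G + G := by
            rw [hG]; noncomm_ring
        _ = 0 := by rw [e2, e2]; abel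
    have h0 := CStarRing.star_mul_self_eq_zero_iff _ |>.mp this
    exact sub_eq_zero.mp h0
  refine ⟨F * X.transpose, ?_, ?_, fun c hc h => ?_⟩
  · rw [← mul_assoc, mul_assoc, ← hG, e3]
  · calc F * X.transpose * X * (F * X.transpose) = F * G * F * X.transpose := by
          rw [hG]; noncomm_ring
      _ = _ := by rw [e1]
  · have h1 : ‖F * X.transpose‖ * ‖F * X.transpose‖ = ‖F‖ := by
      rw [← CStarRing.norm_self_mul_star, star_eq_transpose, Matrix.transpose_mul, hFsa,
        Matrix.transpose_transpose]
      congr 1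
      calc F * X.transpose * (X * F) = F * G * F := by rw [hG]; noncomm_ring
        _ = F := e1
    have h2 : ‖F‖ ≤ (c ^ 2)⁻¹ := by
      refine norm_cfc_le (by positivity) fun x hx => ?_
      by_cases hx0 : x = 0
      · simp only [hx0, inv_zero, norm_zero]; positivity
      · have := h x hx hx0
        rw [norm_inv, Real.norm_eq_abs]
        exact inv_anti₀ (by positivity) (this.trans (le_abs_self x))
    refine le_of_sq_le_sq ?_ (by positivity)
    rw [sq, h1, inv_pow]; exact h2

/-- Perturbation of a generalized inverse. -/
lemma exists_perturbed_inverse {X Y D : Matrix (Fin q) (Fin q) ℝ} (h1 : X * Y * X = X)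
    (h2 : Y * X * Y = Y) (hsmall : ‖D‖ * ‖Y‖ ≤ 1 / 4) :
    X.rank ≤ (X + D).rank ∧ ((X + D).rank ≤ X.rank →
      ∃ Z : Matrix (Fin q) (Fin q) ℝ, (X + D) * Z * (X + D) = X + D ∧ ‖Z‖ ≤ 4 / 3 * ‖Y‖) := by
  have hn1 : ‖-(D * Y)‖ < 1 := by
    rw [norm_neg]; exact (norm_mul_le _ _).trans_lt (by linarith)
  have hn2 : ‖-(Y * D)‖ < 1 := by
    rw [norm_neg]; exact (norm_mul_le _ _).trans_lt (by linarith [mul_comm ‖D‖ ‖Y‖])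
  -- The candidate is `Y (1 + D Y)⁻¹ = (1 + Y D)⁻¹ Y`; both inverses exist by a Neumann series.
  obtain ⟨B, hB⟩ := isUnit_one_sub_of_norm_lt_one hn1
  obtain ⟨C, hC⟩ := isUnit_one_sub_of_norm_lt_one hn2
  rw [sub_neg_eq_add] at hB hC
  set b : Matrix (Fin q) (Fin q) ℝ := ↑B⁻¹ with hb
  set c : Matrix (Fin q) (Fin q) ℝ := ↑C⁻¹ with hc
  have hUb : (1 + D * Y) * b = 1 := by rw [← hB, hb]; exact B.mul_inv
  have hbU : b * (1 + D * Y) = 1 := by rw [← hB, hb]; exact B.inv_mul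
  have hcU : c * (1 + Y * D) = 1 := by rw [← hC, hc]; exact C.inv_mul
  have hYb : Y * b = c * Y := by
    calc Y * b = c * (1 + Y * D) * (Y * b) := by rw [hcU, one_mul]
      _ = c * Y * ((1 + D * Y) * b) := by noncomm_ring
      _ = c * Y := by rw [hUb, mul_one]
  have hXZ : (X + D) * (Y * b) = 1 - (1 - X * Y) * b := by
    calc (X + D) * (Y * b) = (1 + D * Y) * b - (1 - X * Y) * b := by noncomm_ring
      _ = _ := by rw [hUb]
  have hYXY : Y * (X * Y) = Y := by rw [← mul_assoc, h2]
  have hZXZ : Y * b * ((X + D) * (Y * b)) = Y * b := by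
    rw [hXZ, mul_sub, mul_one, hYb]
    have : c * Y * ((1 - X * Y) * b) = c * (Y - Y * (X * Y)) * b := by noncomm_ring
    rw [this, hYXY]; simp
  have hrk : X.rank ≤ ((X + D) * (Y * b)).rank := by
    calc X.rank = (X * Y * X).rank := by rw [h1]
      _ ≤ (X * Y).rank := Matrix.rank_mul_le_left _ _
      _ ≤ Y.rank := Matrix.rank_mul_le_right _ _
      _ = (Y * b * (1 + D * Y)).rank := by rw [mul_assoc, hbU, mul_one]
      _ ≤ (Y * b).rank := Matrix.rank_mul_le_left _ _
      _ = (Y * b * ((X + D) * (Y * b))).rank := by rw [hZXZ]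
      _ ≤ _ := Matrix.rank_mul_le_right _ _
  refine ⟨hrk.trans (Matrix.rank_mul_le_left _ _), fun hle => ⟨Y * b, ?_, ?_⟩⟩
  -- `(X + D) Y b` is idempotent by `hZXZ`. Equality of ranks forces its range to be that of `X +
  -- D`, so it fixes every column of `X + D`.
  · have hsub : ((X + D) * (Y * b)).mulVecLin.range ≤ (X + D).mulVecLin.range := by
      rw [Matrix.mulVecLin_mul]; exact LinearMap.range_comp_le_range _ _
    have heq := Submodule.eq_of_le_of_finrank_le hsub (hle.trans hrk)
    refine Matrix.ext_of_mulVec_single fun i => ?_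
    have hmem : (X + D).mulVec (Pi.single i 1) ∈ (X + D).mulVecLin.range := ⟨_, rfl⟩
    rw [← heq] at hmem
    obtain ⟨w, hw⟩ := hmem
    rw [← Matrix.mulVec_mulVec, ← hw, Matrix.mulVecLin_apply, Matrix.mulVec_mulVec]
    congr 1
    rw [mul_assoc, hZXZ]
  · have hbn : ‖b‖ ≤ 4 / 3 := by
      have h3 : b = 1 - D * Y * b := by rw [eq_sub_iff_add_eq, ← hUb]; noncomm_ring
      have h4 : ‖b‖ ≤ ‖(1 : Matrix (Fin q) (Fin q) ℝ)‖ + ‖D‖ * ‖Y‖ * ‖b‖ := by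
        conv_lhs => rw [h3]
        refine (norm_sub_le _ _).trans (add_le_add le_rfl ?_)
        exact (norm_mul_le _ _).trans (mul_le_mul_of_nonneg_right (norm_mul_le _ _)
          (norm_nonneg _))
      have h5 : ‖(1 : Matrix (Fin q) (Fin q) ℝ)‖ ≤ 1 := by
        rw [← Matrix.diagonal_one, Matrix.l2_opNorm_diagonal]
        refine (pi_norm_le_iff_of_nonneg zero_le_one).mpr fun i => by simp
      nlinarith [norm_nonneg b]
    calc ‖Y * b‖ ≤ ‖Y‖ * ‖b‖ := norm_mul_le _ _
      _ ≤ ‖Y‖ * (4 / 3) := mul_le_mul_of_nonneg_left hbn (norm_nonneg _)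
      _ = _ := mul_comm _ _

lemma norm_one_le : ‖(1 : Matrix (Fin q) (Fin q) ℝ)‖ ≤ 1 := by
  rw [← Matrix.diagonal_one, Matrix.l2_opNorm_diagonal]
  exact (pi_norm_le_iff_of_nonneg zero_le_one).mpr fun i => by simp

/-- Rank is lower semicontinuous: by the perturbation lemma it cannot drop on a ball whose radius is
governed by a generalized inverse. -/
lemma isClosed_rank_le (r : ℕ) : IsClosed {X : Mat q | rank X ≤ r} := by
  rw [← isOpen_compl_iff, Metric.isOpen_iff]
  intro X hX
  obtain ⟨Y, h1, h2, -⟩ := exists_generalized_inverse (toMat X)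
  refine ⟨1 / (4 * (‖Y‖ + 1)), by positivity, fun Z hZ => ?_⟩
  have hle : ‖toMat (Z - X)‖ * ‖Y‖ ≤ 1 / 4 := by
    have h3 : ‖toMat (Z - X)‖ ≤ 1 / (4 * (‖Y‖ + 1)) :=
      (norm_toMat_le _).trans (by rw [← dist_eq_norm]; exact hZ.le)
    calc ‖toMat (Z - X)‖ * ‖Y‖ ≤ 1 / (4 * (‖Y‖ + 1)) * (‖Y‖ + 1) :=
          mul_le_mul h3 (by linarith) (norm_nonneg _) (by positivity)
      _ = 1 / 4 := by field_simp
  have := (exists_perturbed_inverse h1 h2 hle).1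
  rw [← toMat_add, add_sub_cancel] at this
  simp only [Set.mem_compl_iff, Set.mem_ofPred_eq, not_le] at hX ⊢
  exact hX.trans_le this

/-! ### Singular values -/

lemma toEuclideanLin_transpose_mul_self (X : Mat q) :
    LinearMap.adjoint (Matrix.toEuclideanLin (toMat X)) ∘ₗ Matrix.toEuclideanLin (toMat X) =
      Matrix.toEuclideanLin ((toMat X).transpose * toMat X) := by
  rw [← Matrix.toEuclideanLin_conjTranspose_eq_adjoint,
    Matrix.conjTranspose_eq_transpose_of_trivial]
  ext v i
  simp [Matrix.toEuclideanLin, Matrix.mulVec_mulVec]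

lemma spectrum_transpose_mul_self (X : Mat q) {μ : ℝ}
    (hμ : μ ∈ spectrum ℝ ((toMat X).transpose * toMat X)) :
    ∃ k, 1 ≤ k ∧ k ≤ q ∧ μ = sigma k X ^ 2 := by
  set T := Matrix.toEuclideanLin (toMat X) with hT
  have h1 : Module.End.HasEigenvalue (LinearMap.adjoint T ∘ₗ T) μ := by
    rw [toEuclideanLin_transpose_mul_self, Module.End.hasEigenvalue_iff_mem_spectrum,
      Matrix.spectrum_toLpLin]
    exact hμ
  obtain ⟨i, hi⟩ := T.isSymmetric_adjoint_comp_self.exists_eigenvalues_eq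
    (finrank_euclideanSpace_fin (𝕜 := ℝ) (n := q)) h1
  -- `sigma` counts from 1, the eigenvalues from 0.
  refine ⟨i + 1, by omega, i.2, ?_⟩
  rw [sigma, Nat.add_sub_cancel, ← hT,
    T.sq_singularValues_fin (finrank_euclideanSpace_fin (𝕜 := ℝ) (n := q))]
  exact hi.symm

lemma sigma_nonneg (k : ℕ) (X : Mat q) : 0 ≤ sigma k X := LinearMap.singularValues_nonneg _ _

lemma sigma_le_sigma {k l : ℕ} (h : k ≤ l) (X : Mat q) : sigma l X ≤ sigma k X :=
  LinearMap.singularValues_antitone _ (Nat.sub_le_sub_right h 1)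

lemma norm_toMat_le_sigma (X : Mat q) : ‖toMat X‖ ≤ sigma 1 X := by
  refine le_of_sq_le_sq ?_ (sigma_nonneg _ _)
  have h1 : ‖toMat X‖ ^ 2 = ‖(toMat X).transpose * toMat X‖ := by
    rw [sq, ← star_eq_transpose, CStarRing.norm_star_mul_self]
  have hsa := isSelfAdjoint_transpose_mul_self (toMat X)
  rw [h1]
  conv_lhs => rw [← cfc_id' ℝ ((toMat X).transpose * toMat X)]
  refine norm_cfc_le (by positivity) fun x hx => ?_
  obtain ⟨k, hk, -, rfl⟩ := spectrum_transpose_mul_self X hx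
  rw [Real.norm_of_nonneg (by positivity)]
  exact pow_le_pow_left₀ (sigma_nonneg _ _) (sigma_le_sigma hk X) 2

lemma finrank_range_toEuclideanLin (X : Mat q) :
    Module.finrank ℝ (Matrix.toEuclideanLin (toMat X)).range = rank X := by
  rw [rank, Matrix.rank_eq_finrank_range_toLin (toMat X) (PiLp.basisFun 2 ℝ (Fin q))
    (PiLp.basisFun 2 ℝ (Fin q))]
  rw [← Matrix.toLpLin_eq_toLin]

/-- Only nonzero singular values enter the norm of the generalized inverse. At rank `r` they have
index at most `r`, hence are at least `s / 2`. -/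
lemma exists_generalized_inverse_of_sigma {X : Mat q} {r : ℕ} {s : ℝ} (hs : 0 < s)
    (hrank : rank X = r) (hσ : s / 2 ≤ sigma r X) :
    ∃ Y : Matrix (Fin q) (Fin q) ℝ, toMat X * Y * toMat X = toMat X ∧ Y * toMat X * Y = Y ∧
      ‖Y‖ ≤ 2 / s := by
  obtain ⟨Y, h1, h2, h3⟩ := exists_generalized_inverse (toMat X)
  refine ⟨Y, h1, h2, (h3 (s / 2) (by positivity) fun μ hμ hμ0 => ?_).trans_eq (by field_simp)⟩
  obtain ⟨k, hk, -, rfl⟩ := spectrum_transpose_mul_self X hμ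
  have hk0 : sigma k X ≠ 0 := fun h => hμ0 (by rw [h]; simp)
  have : k ≤ r := by
    rw [sigma, Ne, LinearMap.singularValues_eq_zero_iff_le_finrank_range,
      finrank_range_toEuclideanLin, hrank] at hk0
    omega
  exact pow_le_pow_left₀ (by positivity) (hσ.trans (sigma_le_sigma this X)) 2

lemma norm_le_mul_norm_toMat (X : Mat q) : ‖X‖ ≤ q * ‖toMat X‖ := by
  have h : ‖X‖ ^ 2 ≤ q * ‖toMat X‖ ^ 2 := by
    rw [norm_sq_eq_sum]
    calc _ ≤ ∑ b : Fin q, ‖toMat X‖ ^ 2 := Finset.sum_le_sum fun b _ => ?_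
      _ = _ := by simp
    have h := Matrix.l2_opNorm_mulVec (toMat X) (EuclideanSpace.single b (1 : ℝ))
    have h2 := pow_le_pow_left₀ (norm_nonneg _) h 2
    rw [mul_pow, EuclideanSpace.norm_sq_eq] at h2
    simpa using h2
  refine le_of_sq_le_sq (h.trans ?_) (by positivity)
  rw [mul_pow]
  refine mul_le_mul_of_nonneg_right ?_ (by positivity)
  exact_mod_cast Nat.le_self_pow two_ne_zero q

/-! ### Best low-rank approximation -/

lemma norm_le_one_of_orthogonal {U : Matrix (Fin q) (Fin q) ℝ}
    (hU : U ∈ Matrix.orthogonalGroup (Fin q) ℝ) : ‖U‖ ≤ 1 := by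
  have h1 : ‖U‖ * ‖U‖ ≤ 1 := by
    rw [← CStarRing.norm_star_mul_self, (Unitary.mem_iff.mp hU).1]
    exact norm_one_le
  nlinarith [norm_nonneg U]

lemma norm_sandwich_orthogonal {U V : Matrix (Fin q) (Fin q) ℝ}
    (hU : U ∈ Matrix.orthogonalGroup (Fin q) ℝ) (hV : V ∈ Matrix.orthogonalGroup (Fin q) ℝ)
    (X : Mat q) : ‖sandwich U V X‖ = ‖X‖ := by
  have key : ∀ {U V : Matrix (Fin q) (Fin q) ℝ}, U ∈ Matrix.orthogonalGroup (Fin q) ℝ →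
      V ∈ Matrix.orthogonalGroup (Fin q) ℝ → ∀ X, ‖sandwich U V X‖ ≤ ‖X‖ := by
    intro U V hU hV X
    refine ((sandwich U V).le_opNorm X).trans ?_
    have := (norm_sandwich_le U V).trans (mul_le_mul (norm_le_one_of_orthogonal hU)
      (norm_le_one_of_orthogonal hV) (norm_nonneg _) zero_le_one)
    nlinarith [norm_nonneg X]
  refine le_antisymm (key hU hV X) ?_
  have h : X = sandwich (star U) (star V) (sandwich U V X) := by
    refine toMat_injective ?_
    have h1 := (Unitary.mem_iff.mp hU).1
    have h2 := (Unitary.mem_iff.mp hV).2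
    rw [toMat_sandwich, toMat_sandwich]
    calc toMat X = (star U * U) * toMat X * (V * star V) := by rw [h1, h2]; simp
      _ = _ := by noncomm_ring
  conv_lhs => rw [h]
  exact key (Unitary.star_mem hU) (Unitary.star_mem hV) _

/-- The trace of an orthogonal projection is the dimension of its range. -/
lemma sum_sq_norm_starProjection (S : Submodule ℝ (EuclideanSpace ℝ (Fin q))) :
    ∑ i, ‖S.starProjection (EuclideanSpace.single i (1 : ℝ))‖ ^ 2 = Module.finrank ℝ S := by
  have b := stdOrthonormalBasis ℝ S
  have h : ∀ x : EuclideanSpace ℝ (Fin q), ‖S.starProjection x‖ ^ 2 =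
      ∑ k, ⟪x, (b k : EuclideanSpace ℝ (Fin q))⟫_ℝ ^ 2 := by
    intro x
    rw [Submodule.starProjection_apply, Submodule.norm_coe, ← b.sum_sq_norm_inner_left]
    refine Finset.sum_congr rfl fun k _ => ?_
    rw [Submodule.inner_orthogonalProjectionOnto_eq_of_mem_right, Real.norm_eq_abs, sq_abs]
  simp only [h]
  rw [Finset.sum_comm]
  have h1 : ∀ k, ∑ i, ⟪EuclideanSpace.single i (1 : ℝ), (b k : EuclideanSpace ℝ (Fin q))⟫_ℝ ^ 2
      = 1 := by
    intro k
    have h2 : ‖(b k : EuclideanSpace ℝ (Fin q))‖ ^ 2 = 1 := by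
      rw [Submodule.norm_coe, b.norm_eq_one]; simp
    rw [EuclideanSpace.norm_sq_eq] at h2
    refine Eq.trans ?_ h2
    refine Finset.sum_congr rfl fun i _ => ?_
    rw [EuclideanSpace.inner_single_left]; simp
  simp [h1]

/-- Project column `i` of the difference onto the orthogonal complement of the range of `W`: only `τ
i` times the projected basis vector survives. The squared norms `a i` of these vectors are at most 1
and sum to at least `q - r`, and since `τ` decreases, `∑ τ i ^ 2 * a i` is smallest when this mass
sits on the tail. -/
lemma sum_tail_sq_le {r : ℕ} {τ : Fin q → ℝ} (hτ : Antitone τ) (hτ0 : ∀ i, 0 ≤ τ i)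
    {W : Mat q} (hW : rank W ≤ r) :
    ∑ i : Fin q, (if (i : ℕ) < r then 0 else τ i ^ 2) ≤ ‖ofMat (Matrix.diagonal τ) - W‖ ^ 2 := by
  rcases le_or_gt q r with hr | hr
  · rw [Finset.sum_eq_zero]
    · positivity
    · intro i _; rw [if_pos (i.2.trans_le hr)]
  set S := (Matrix.toEuclideanLin (toMat W)).range with hS
  set a : Fin q → ℝ := fun i => ‖Sᗮ.starProjection (EuclideanSpace.single i (1 : ℝ))‖ ^ 2 with ha
  have ha1 : ∀ i, a i ≤ 1 := by
    intro i
    have := Submodule.norm_starProjection_apply_le Sᗮ (EuclideanSpace.single i (1 : ℝ))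
    rw [PiLp.norm_single, norm_one] at this
    exact pow_le_one₀ (norm_nonneg _) this
  have ha0 : ∀ i, 0 ≤ a i := fun i => by positivity
  have hsum : (q : ℝ) - r ≤ ∑ i, a i := by
    rw [ha, sum_sq_norm_starProjection]
    have h1 := Submodule.finrank_add_finrank_orthogonal S
    have h2 : Module.finrank ℝ S = rank W := finrank_range_toEuclideanLin W
    rw [finrank_euclideanSpace_fin, h2] at h1
    have : q ≤ r + Module.finrank ℝ Sᗮ := by omega
    have := (Nat.cast_le (α := ℝ)).mpr this
    push_cast at this
    linarith
  have hcol : ∀ i, τ i ^ 2 * a i ≤ ∑ k, toMat (ofMat (Matrix.diagonal τ) - W) k i ^ 2 := by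
    intro i
    set v : EuclideanSpace ℝ (Fin q) :=
      WithLp.toLp 2 fun k => toMat (ofMat (Matrix.diagonal τ) - W) k i with hv
    have h1 : ∑ k, toMat (ofMat (Matrix.diagonal τ) - W) k i ^ 2 = ‖v‖ ^ 2 := by
      rw [EuclideanSpace.norm_sq_eq]; simp [hv]
    have h2 : v = τ i • EuclideanSpace.single i (1 : ℝ) -
        Matrix.toEuclideanLin (toMat W) (EuclideanSpace.single i (1 : ℝ)) := by
      ext k
      by_cases hk : k = i <;> simp [hv, Matrix.diagonal_apply, hk]
    have h3 : Sᗮ.starProjection v = τ i • Sᗮ.starProjection (EuclideanSpace.single i (1 : ℝ)) := by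
      have h0 : Sᗮ.starProjection
          (Matrix.toEuclideanLin (toMat W) (EuclideanSpace.single i (1 : ℝ))) = 0 := by
        rw [Submodule.starProjection_apply_eq_zero_iff, Submodule.orthogonal_orthogonal]
        exact ⟨_, rfl⟩
      rw [h2, map_sub, map_smul, h0, sub_zero]
    have h4 := Submodule.norm_starProjection_apply_le Sᗮ v
    rw [h1]
    refine le_trans (le_of_eq ?_) (pow_le_pow_left₀ (norm_nonneg _) h4 2)
    rw [h3, norm_smul, mul_pow, Real.norm_eq_abs, sq_abs]
  rw [norm_sq_eq_sum]
  refine le_trans ?_ (Finset.sum_le_sum fun i _ => hcol i)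
  rw [← sub_nonneg, ← Finset.sum_sub_distrib]
  -- The first discarded value separates head from tail: replacing every `τ i` by `t` only lowers
  -- the difference to be shown nonnegative.
  set t := τ ⟨r, hr⟩
  have hterm : ∀ i : Fin q, t ^ 2 * (a i - if (i : ℕ) < r then 0 else 1) ≤
      τ i ^ 2 * a i - if (i : ℕ) < r then 0 else τ i ^ 2 := by
    intro i
    split_ifs with hi
    · have : t ≤ τ i := hτ (by rw [Fin.le_def]; exact hi.le)
      have := pow_le_pow_left₀ (hτ0 _) this 2
      nlinarith [ha0 i]
    · have : τ i ≤ t := hτ (by rw [Fin.le_def]; exact not_lt.mp hi)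
      have := pow_le_pow_left₀ (hτ0 _) this 2
      nlinarith [ha1 i]
  refine le_trans ?_ (Finset.sum_le_sum fun i _ => hterm i)
  rw [← Finset.mul_sum, Finset.sum_sub_distrib]
  refine mul_nonneg (sq_nonneg _) ?_
  have hcount : ∑ i : Fin q, (if (i : ℕ) < r then (0 : ℝ) else 1) = q - r := by
    rw [Fin.sum_univ_eq_sum_range (fun i => if i < r then (0 : ℝ) else 1) q,
      ← Finset.sum_range_add_sum_Ico _ hr.le, Finset.sum_eq_zero, zero_add]
    · rw [Finset.sum_congr rfl (g := fun _ => (1 : ℝ))]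
      · simp [Nat.cast_sub hr.le]
      · intro i hi
        rw [if_neg (not_lt.mpr (Finset.mem_Ico.mp hi).1)]
    · intro i hi
      rw [if_pos (Finset.mem_range.mp hi)]
  rw [hcount]; linarith

lemma IsTruncatedSVD.rank_le {r : ℕ} {Y Z : Mat q} (h : IsTruncatedSVD r Y Z) : rank Z ≤ r := by
  obtain ⟨U, hU, V, hV, τ, hτ, hτ0, hY, hZ⟩ := h
  rw [rank, hZ]
  refine (Matrix.rank_mul_le_left _ _).trans ((Matrix.rank_mul_le_right _ _).trans ?_)
  rw [Matrix.rank_diagonal, Fintype.card_subtype]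
  calc _ ≤ (Finset.univ.filter fun i : Fin q => (i : ℕ) < r).card := by
        refine Finset.card_le_card fun i hi => ?_
        simp only [Finset.mem_filter, Finset.mem_univ, true_and] at hi ⊢
        by_contra h; simp [h] at hi
    _ ≤ (Finset.range r).card := by
        refine Finset.card_le_card_of_injOn (fun i => (i : ℕ)) (fun i hi => ?_)
          (fun i _ j _ h => Fin.ext h)
        simpa using hi
    _ = r := Finset.card_range r

/-- Eckart-Young. -/
lemma IsTruncatedSVD.norm_sub_le {r : ℕ} {Y Z : Mat q} (h : IsTruncatedSVD r Y Z) {W : Mat q}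
    (hW : rank W ≤ r) : ‖Y - Z‖ ≤ ‖Y - W‖ := by
  obtain ⟨U, hU, V, hV, τ, hτ, hτ0, hY, hZ⟩ := h
  have hV' : V.transpose ∈ Matrix.orthogonalGroup (Fin q) ℝ := by
    rw [← star_eq_transpose]; exact Unitary.star_mem hV
  have hUU := (Unitary.mem_iff.mp hU).2
  have hVV := (Unitary.mem_iff.mp hV).2
  set W' : Mat q := sandwich (star U) V W with hW'
  have e1 : Y - W = sandwich U V.transpose (ofMat (Matrix.diagonal τ) - W') := by
    refine toMat_injective ?_
    rw [toMat_sub, hY, map_sub, toMat_sub, hW']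
    simp only [toMat_sandwich, toMat_ofMat]
    congr 1
    calc toMat W = (U * star U) * toMat W * (V * star V) := by rw [hUU, hVV]; simp
      _ = _ := by rw [star_eq_transpose V]; noncomm_ring
  have e2 : Y - Z = sandwich U V.transpose (ofMat (Matrix.diagonal τ) -
      ofMat (Matrix.diagonal fun i : Fin q => if (i : ℕ) < r then τ i else 0)) := by
    refine toMat_injective ?_
    rw [toMat_sub, hY, hZ, map_sub, toMat_sub]
    simp only [toMat_sandwich, toMat_ofMat]
  refine le_of_sq_le_sq ?_ (norm_nonneg _)
  rw [e1, e2, norm_sandwich_orthogonal hU hV', norm_sandwich_orthogonal hU hV']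
  have hr' : rank W' ≤ r := by
    rw [hW', sandwich]
    exact (rank_lmul_le _ _).trans ((rank_rmul_le _ _).trans hW)
  refine le_trans (le_of_eq ?_) (sum_tail_sq_le hτ hτ0 hr')
  rw [norm_sq_eq_sum]
  refine Finset.sum_congr rfl fun b _ => ?_
  rw [Finset.sum_eq_single b]
  · simp only [toMat_sub, toMat_ofMat, Matrix.sub_apply, Matrix.diagonal_apply_eq]
    split_ifs <;> ring
  · intro a _ hab
    simp [Matrix.diagonal_apply_ne _ hab]
  · simp

/-! ### Stationary points of the rank-constrained problem -/

/-- `X` is stationary for `min ‖y - K(X)‖` subject to `rank X ≤ r`, in a quantitative sense. -/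
def IsStat (K : LMap q d) (y : EuclideanSpace ℝ (Fin d)) (r : ℕ) (κ : ℝ) (X : Mat q) : Prop :=
  rank X ≤ r ∧ ∀ W : Mat q, rank W ≤ r → 2 * ⟪K (W - X), y - K X⟫_ℝ ≤ κ * ‖W - X‖ ^ 2

/-- Expand `‖y - K W‖²` about `X`. The resulting condition replaces minimality from here on, because
Singular Value Projection limits satisfy it too and because it passes to limits in `K` and `X`. -/
lemma IsRankConstrainedMin.isStat {K : LMap q d} {y : EuclideanSpace ℝ (Fin d)} {r : ℕ} {κ : ℝ}
    {X : Mat q} (h : IsRankConstrainedMin K y r X)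
    (hK : ∀ Z, rank Z ≤ 2 * r → ‖K Z‖ ^ 2 ≤ κ * ‖Z‖ ^ 2) : IsStat K y r κ X := by
  refine ⟨h.1, fun W hW => ?_⟩
  have h1 := pow_le_pow_left₀ (norm_nonneg _) (h.2 W hW) 2
  have h2 : y - K W = (y - K X) - K (W - X) := by rw [map_sub]; abel
  rw [h2, norm_sub_sq_real (y - K X), real_inner_comm] at h1
  have h3 := hK (W - X) ((rank_sub_le _ _).trans (by have := h.1; omega))
  linarith

/-- Truncation is not continuous, but its optimality inequality (Eckart–Young) passes to the limit.
Expanding it gives the condition with constant `1 / ν`, and `ν ≥ 3 / 4`. -/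
lemma IsSVPOutput.isStat {K : LMap q d} {y : EuclideanSpace ℝ (Fin d)} {r : ℕ} {ν : ℝ}
    {X : Mat q} (hν : 3 / 4 ≤ ν) (h : IsSVPOutput K y r ν X) : IsStat K y r (4 / 3) X := by
  obtain ⟨Z, -, hZ, hlim⟩ := h
  have hlim' := hlim.comp (tendsto_add_atTop_nat 1)
  refine ⟨(isClosed_rank_le r).mem_of_tendsto hlim' (Eventually.of_forall fun k =>
    (hZ k).rank_le), fun W hW => ?_⟩
  set g := ContinuousLinearMap.adjoint K (y - K X) with hg
  have hY : Tendsto (fun k => Z k + ν • ContinuousLinearMap.adjoint K (y - K (Z k))) atTop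
      (𝓝 (X + ν • g)) := by
    refine hlim.add (Tendsto.const_smul ?_ ν)
    have hc : Continuous fun x => ContinuousLinearMap.adjoint K (y - K x) := by fun_prop
    exact (hc.tendsto X).comp hlim
  have hle : ‖(X + ν • g) - X‖ ≤ ‖(X + ν • g) - W‖ :=
    le_of_tendsto_of_tendsto' (hY.sub hlim').norm (hY.sub_const W).norm
      fun k => (hZ k).norm_sub_le hW
  have h1 := pow_le_pow_left₀ (norm_nonneg _) hle 2
  have h2 : (X + ν • g) - W = ν • g - (W - X) := by abel
  rw [h2, add_sub_cancel_left, norm_sub_sq_real, inner_smul_left, real_inner_comm, hg,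
    ContinuousLinearMap.adjoint_inner_right] at h1
  simp only [conj_trivial] at h1
  set I := ⟪K (W - X), y - K X⟫_ℝ
  rcases le_or_gt I 0 with hI | hI
  · nlinarith [sq_nonneg ‖W - X‖]
  · nlinarith [sq_nonneg ‖W - X‖]

/-- Substituting `W = M W'` only changes the quadratic term, by the square of the norm bound for the
inverse of `M`. -/
lemma IsStat.transport {K : LMap q d} {y : EuclideanSpace ℝ (Fin d)} {r : ℕ} {κ c : ℝ}
    {X : Mat q} {M M' : MatOp q} (h : IsStat (K.comp M) y r κ X) (hM : IsRankPreserver M)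
    (hMM' : ∀ Z, M (M' Z) = Z) (hM'M : ∀ Z, M' (M Z) = Z) (hκ : 0 ≤ κ)
    (hc : ∀ Z, ‖M' Z‖ ≤ c * ‖Z‖) : IsStat K y r (κ * c ^ 2) (M X) := by
  refine ⟨(hM X).trans_le h.1, fun W hW => ?_⟩
  have h1 := h.2 (M' W) (by rw [← hM, hMM']; exact hW)
  have h2 : M' W - X = M' (W - M X) := by rw [map_sub, hM'M]
  rw [h2] at h1
  simp only [ContinuousLinearMap.comp_apply, hMM'] at h1
  refine h1.trans ?_
  rw [mul_assoc, ← mul_pow]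
  exact mul_le_mul_of_nonneg_left (pow_le_pow_left₀ (norm_nonneg _) (hc _) 2) hκ

lemma nonpos_of_forall_le_mul {a b : ℝ} (h : ∀ t : ℝ, 0 < t → t * a ≤ t ^ 2 * b) : a ≤ 0 := by
  by_contra hc
  push Not at hc
  have h1 := h (a / (2 * (|b| + 1))) (by positivity)
  have h2 : a / (2 * (|b| + 1)) * a ≤ (a / (2 * (|b| + 1))) ^ 2 * (|b| + 1) :=
    h1.trans (mul_le_mul_of_nonneg_left (by linarith [le_abs_self b]) (by positivity))
  have h3 : (a / (2 * (|b| + 1))) ^ 2 * (|b| + 1) = a / (2 * (|b| + 1)) * (a / 2) := by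
    field_simp
  rw [h3] at h2
  have h4 := le_of_mul_le_mul_left h2 (by positivity)
  linarith

/-- Along a line inside the constraint set the condition bounds a linear function of `t` by a
quadratic one, for both signs of `t`. -/
lemma IsStat.inner_eq_zero_of_curve {K : LMap q d} {y : EuclideanSpace ℝ (Fin d)} {r : ℕ} {κ : ℝ}
    {X T : Mat q} (h : IsStat K y r κ X) (hT : ∀ t : ℝ, rank (X + t • T) ≤ r) :
    ⟪K T, y - K X⟫_ℝ = 0 := by
  have h1 : ∀ t : ℝ, t * (2 * ⟪K T, y - K X⟫_ℝ) ≤ t ^ 2 * (κ * ‖T‖ ^ 2) := by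
    intro t
    have h2 := h.2 _ (hT t)
    rw [add_sub_cancel_left, map_smul, inner_smul_left, norm_smul, mul_pow, Real.norm_eq_abs,
      sq_abs] at h2
    simp only [conj_trivial] at h2
    linarith
  have h2 := nonpos_of_forall_le_mul fun t _ => h1 t
  have h3 := nonpos_of_forall_le_mul (a := -(2 * ⟪K T, y - K X⟫_ℝ)) (b := κ * ‖T‖ ^ 2)
    fun t _ => by have := h1 (-t); nlinarith
  linarith

lemma IsStat.inner_tangent {K : LMap q d} {y : EuclideanSpace ℝ (Fin d)} {r : ℕ} {κ : ℝ}
    {X : Mat q} (h : IsStat K y r κ X) (A B : Matrix (Fin q) (Fin q) ℝ) :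
    ⟪K (lmul A X + rmul B X), y - K X⟫_ℝ = 0 := by
  rw [map_add, inner_add_left, h.inner_eq_zero_of_curve fun t => ?_,
    h.inner_eq_zero_of_curve fun t => ?_, add_zero]
  · have : X + t • rmul B X = rmul (1 + t • B) X := toMat_injective (by simp [mul_add])
    rw [this]; exact (rank_rmul_le _ _).trans h.1
  · have : X + t • lmul A X = lmul (1 + t • A) X := toMat_injective (by simp [add_mul])
    rw [this]; exact (rank_lmul_le _ _).trans h.1

/-- Near a matrix `X₁`, the matrices of low rank differ from `X₁` by a tangent vector up to a
quadratic error. -/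
lemma exists_normal_part {X₁ X₂ : Mat q} {Z₁ Z₂ : Matrix (Fin q) (Fin q) ℝ} {c : ℝ}
    (h₁ : toMat X₁ * Z₁ * toMat X₁ = toMat X₁) (h₂ : toMat X₂ * Z₂ * toMat X₂ = toMat X₂)
    (hc : ‖toMat X₁‖ * ‖Z₁‖ ≤ c) :
    ∃ N : Mat q, rank N ≤ rank X₂ ∧ ‖N‖ ≤ (1 + c) ^ 2 * ‖Z₂‖ * ‖X₂ - X₁‖ ^ 2 ∧
      ∃ A B, X₂ - X₁ - N = lmul A X₁ + rmul B X₁ := by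
  set x₁ := toMat X₁
  set x₂ := toMat X₂ with hx₂
  -- The left side is `x₂` modulo the tangent space at `x₁`. Write `x₂ = x₂ Z₂ x₂`; the outer
  -- factors kill `x₁`, so each `x₂` may be replaced by `x₂ - x₁`. This makes the term quadratic.
  have hN : (1 - x₁ * Z₁) * x₂ * (1 - Z₁ * x₁) =
      (1 - x₁ * Z₁) * (x₂ - x₁) * Z₂ * (x₂ - x₁) * (1 - Z₁ * x₁) := by
    have e1 : (1 - x₁ * Z₁) * (x₂ - x₁) = (1 - x₁ * Z₁) * x₂ := by
      rw [mul_sub, sub_mul 1 _ x₁, h₁]; simp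
    have e2 : (x₂ - x₁) * (1 - Z₁ * x₁) = x₂ * (1 - Z₁ * x₁) := by
      rw [sub_mul, mul_sub x₁, ← mul_assoc, h₁]; simp
    rw [e1, mul_assoc _ (x₂ - x₁), e2]
    calc _ = (1 - x₁ * Z₁) * (x₂ * Z₂ * x₂) * (1 - Z₁ * x₁) := by rw [h₂]
      _ = _ := by noncomm_ring
  have hb1 : ‖1 - x₁ * Z₁‖ ≤ 1 + c :=
    (norm_sub_le _ _).trans (add_le_add norm_one_le ((norm_mul_le _ _).trans hc))
  have hb2 : ‖1 - Z₁ * x₁‖ ≤ 1 + c :=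
    (norm_sub_le _ _).trans (add_le_add norm_one_le ((norm_mul_le _ _).trans
      (by rw [mul_comm]; exact hc)))
  have hc0 : 0 ≤ 1 + c := (norm_nonneg _).trans hb1
  refine ⟨sandwich (1 - x₁ * Z₁) (1 - Z₁ * x₁) X₂, ?_, ?_, ?_⟩
  · exact (rank_lmul_le _ _).trans (rank_rmul_le _ _)
  · have : sandwich (1 - x₁ * Z₁) (1 - Z₁ * x₁) X₂ =
        sandwich ((1 - x₁ * Z₁) * toMat (X₂ - X₁) * Z₂) (1 - Z₁ * x₁) (X₂ - X₁) := by
      refine toMat_injective ?_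
      rw [toMat_sandwich, toMat_sandwich, hN, toMat_sub]
    rw [this]
    refine ((ContinuousLinearMap.le_opNorm _ _).trans (mul_le_mul_of_nonneg_right
      (norm_sandwich_le _ _) (norm_nonneg _))).trans ?_
    have h3 : ‖(1 - x₁ * Z₁) * toMat (X₂ - X₁) * Z₂‖ ≤ (1 + c) * ‖X₂ - X₁‖ * ‖Z₂‖ := by
      refine (norm_mul_le _ _).trans (mul_le_mul_of_nonneg_right ?_ (norm_nonneg _))
      exact (norm_mul_le _ _).trans (mul_le_mul hb1 (norm_toMat_le _) (norm_nonneg _) hc0)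
    calc _ ≤ (1 + c) * ‖X₂ - X₁‖ * ‖Z₂‖ * (1 + c) * ‖X₂ - X₁‖ := by gcongr
      _ = _ := by ring
  -- With `P = x₁ Z₁` and `Q = Z₁ x₁` one has `x₂ - (1 - P) x₂ (1 - Q) = P x₂ + (1 - P) x₂ Q`, and
  -- the two terms are multiples of `x₁` from the right and from the left.
  · refine ⟨-1 + (1 - x₁ * Z₁) * x₂ * Z₁, Z₁ * x₂, toMat_injective ?_⟩
    simp only [toMat_sub, toMat_sandwich, toMat_add, toMat_lmul, toMat_rmul]
    noncomm_ring

/-- The lower bound makes the objective coercive on the closed set of low-rank matrices: outside the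
ball of radius `4 ‖y‖` it exceeds its value at 0. -/
lemma exists_isRankConstrainedMin {K : LMap q d} {r : ℕ}
    (hK : ∀ Z, rank Z ≤ r → ‖Z‖ ≤ 2 * ‖K Z‖) (y : EuclideanSpace ℝ (Fin d)) :
    ∃ X, IsRankConstrainedMin K y r X := by
  have hcomp : IsCompact ({X : Mat q | rank X ≤ r} ∩ Metric.closedBall 0 (4 * ‖y‖)) :=
    (isCompact_closedBall _ _).inter_left (isClosed_rank_le r)
  have h0 : (0 : Mat q) ∈ {X : Mat q | rank X ≤ r} ∩ Metric.closedBall 0 (4 * ‖y‖) := by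
    refine ⟨by simp [rank_zero], by simp⟩
  obtain ⟨X, hX, hmin⟩ := hcomp.exists_isMinOn ⟨0, h0⟩
    (f := fun X => ‖y - K X‖) (by fun_prop)
  refine ⟨X, hX.1, fun Z hZ => ?_⟩
  by_cases hb : ‖Z‖ ≤ 4 * ‖y‖
  · exact hmin ⟨hZ, by simpa using hb⟩
  · have h1 : ‖y - K X‖ ≤ ‖y‖ := by simpa using hmin h0
    have h2 := hK Z hZ
    have h3 := norm_sub_norm_le (K Z) y
    rw [norm_sub_rev] at h3
    push Not at hb
    linarith

/-! ### Low-rank updates for a perturbed map -/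

/-- `X` has rank `r`, spectral norm at most `s`, and a reflexive generalized inverse `Y` of norm at
most `2 / s`. -/
structure IsConditioned (r : ℕ) (s : ℝ) (X : Mat q) (Y : Matrix (Fin q) (Fin q) ℝ) : Prop where
  pos : 0 < s
  rank_eq : rank X = r
  norm_le : ‖toMat X‖ ≤ s
  inv : toMat X * Y * toMat X = toMat X
  inv' : Y * toMat X * Y = Y
  inv_norm_le : ‖Y‖ ≤ 2 / s

/-- The restricted isometry property of order `4 r` with constant `1 / 20`. -/
def HasRIP (r : ℕ) (L : LMap q d) : Prop := ∀ Z : Mat q, rank Z ≤ 4 * r →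
  0.95 * ‖Z‖ ^ 2 ≤ ‖L Z‖ ^ 2 ∧ ‖L Z‖ ^ 2 ≤ 1.05 * ‖Z‖ ^ 2

lemma HasRIP.le {r : ℕ} {L : LMap q d} (h : HasRIP r L) {Z : Mat q} (hZ : rank Z ≤ 4 * r) :
    ‖L Z‖ ≤ 1.025 * ‖Z‖ := by
  refine le_of_sq_le_sq ?_ (by positivity)
  nlinarith [(h Z hZ).2, sq_nonneg ‖Z‖]

lemma HasRIP.ge {r : ℕ} {L : LMap q d} (h : HasRIP r L) {Z : Mat q} (hZ : rank Z ≤ 4 * r) :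
    0.974 * ‖Z‖ ≤ ‖L Z‖ := by
  refine le_of_sq_le_sq ?_ (norm_nonneg _)
  nlinarith [(h Z hZ).1, sq_nonneg ‖Z‖]

/-- `C` is a perturbation of size `e`, with `e` small. -/
structure IsSmall (e : ℝ) (C : LMap q d) : Prop where
  nonneg : 0 ≤ e
  pos_dim : 1 ≤ q
  small : e * (q : ℝ) ^ 2 ≤ 1 / 90000
  dim_two : 2 ≤ q
  hs_le : hsNorm C ≤ e

namespace IsSmall
variable {e : ℝ} {C : LMap q d}

lemma le_mul (h : IsSmall e C) (Z : Mat q) : ‖C Z‖ ≤ e * ‖Z‖ :=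
  (norm_apply_le_hsNorm C Z).trans (mul_le_mul_of_nonneg_right h.hs_le (norm_nonneg _))

lemma eq_le (h : IsSmall e C) : e * q ≤ 1 / 180000 := by
  have h1 : (2 : ℝ) ≤ q := by exact_mod_cast h.dim_two
  nlinarith [h.small, mul_nonneg h.nonneg (by linarith : (0 : ℝ) ≤ q)]

lemma le_eq (h : IsSmall e C) : e ≤ e * q :=
  le_mul_of_one_le_right h.nonneg (by exact_mod_cast h.pos_dim)

lemma e_le (h : IsSmall e C) : e ≤ 1 / 180000 := h.le_eq.trans h.eq_le

lemma apply_le (h : IsSmall e C) {r : ℕ} {s : ℝ} {X : Mat q} {Y : Matrix (Fin q) (Fin q) ℝ}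
    (hX : IsConditioned r s X Y) : ‖C X‖ ≤ e * q * s := by
  refine (h.le_mul X).trans ?_
  rw [mul_assoc]
  refine mul_le_mul_of_nonneg_left ((norm_le_mul_norm_toMat X).trans ?_) h.nonneg
  exact mul_le_mul_of_nonneg_left hX.norm_le (Nat.cast_nonneg _)

end IsSmall

section
variable {r : ℕ} {s e κ : ℝ} {X Xt : Mat q} {Y : Matrix (Fin q) (Fin q) ℝ} {Ls C : LMap q d}

lemma perturbed_le (hL : HasRIP r Ls) (hC : IsSmall e C) {Z : Mat q} (hZ : rank Z ≤ 4 * r) :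
    ‖(Ls + C) Z‖ ≤ 1.03 * ‖Z‖ := by
  have h1 := hL.le hZ
  have h2 := hC.le_mul Z
  have h3 := hC.e_le
  have h4 := norm_add_le (Ls Z) (C Z)
  rw [add_apply]
  nlinarith [norm_nonneg Z]

lemma perturbed_ge (hL : HasRIP r Ls) (hC : IsSmall e C) {Z : Mat q} (hZ : rank Z ≤ 4 * r) :
    0.97 * ‖Z‖ ≤ ‖(Ls + C) Z‖ := by
  have h1 := hL.ge hZ
  have h2 := hC.le_mul Z
  have h3 := hC.e_le
  have h4 := norm_sub_norm_le (Ls Z) (-(C Z))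
  rw [norm_neg, sub_neg_eq_add] at h4
  rw [add_apply]
  nlinarith [norm_nonneg Z]

/-- Test stationarity with the true matrix. The constant `κ ≤ 1.4` is harmless because it is below
twice the lower isometry bound `0.97 ^ 2`, so a multiple of `‖K (X - Xt)‖²` is left over to absorb.
-/
lemma IsStat.norm_sub_le (hL : HasRIP r Ls) (hC : IsSmall e C) (hX : rank X ≤ r)
    (hκ : κ ≤ 1.4) (h : IsStat (Ls + C) (Ls X) r κ Xt) : ‖Xt - X‖ ≤ 5 * ‖C X‖ := by
  set K := Ls + C with hK
  have h1 := h.2 X hX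
  have hrk : rank (X - Xt) ≤ 4 * r := (rank_sub_le _ _).trans (by have := h.1; omega)
  have h2 : Ls X - K Xt = K (X - Xt) - C X := by
    rw [map_sub, hK]; simp only [add_apply]; abel
  rw [h2, inner_sub_right, real_inner_self_eq_norm_sq] at h1
  have h3 := perturbed_ge hL hC hrk
  have h4 := real_inner_le_norm (K (X - Xt)) (C X)
  rw [← hK] at h3
  rw [norm_sub_rev Xt X]
  set k := ‖K (X - Xt)‖
  set x := ‖X - Xt‖
  have hx : 0 ≤ x := norm_nonneg _
  have hk : 0 ≤ k := norm_nonneg _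
  have h5 : 0.9409 * x ^ 2 ≤ k ^ 2 := by
    have := pow_le_pow_left₀ (by positivity) h3 2
    nlinarith
  have h6 : k * (0.5 * k) ≤ k * (2 * ‖C X‖) := by nlinarith [sq_nonneg x]
  rcases hk.eq_or_lt with h0 | h0
  · have : x = 0 := by nlinarith
    rw [this]; positivity
  · have := le_of_mul_le_mul_left h6 h0
    linarith

lemma IsStat.norm_sub_le' (hL : HasRIP r Ls) (hC : IsSmall e C) (hX : IsConditioned r s X Y)
    (hκ : κ ≤ 1.4) (h : IsStat (Ls + C) (Ls X) r κ Xt) : ‖Xt - X‖ ≤ 5 * (e * q) * s := by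
  have h1 := h.norm_sub_le hL hC hX.rank_eq.le hκ
  have h2 := hC.apply_le hX
  linarith

/-- `Xt` is too close to `X` for its rank to drop, so it has rank exactly `r` and inherits a
well-bounded generalized inverse. -/
lemma IsStat.exists_inverse (hL : HasRIP r Ls) (hC : IsSmall e C) (hX : IsConditioned r s X Y)
    (hκ : κ ≤ 1.4) (h : IsStat (Ls + C) (Ls X) r κ Xt) :
    ∃ Z : Matrix (Fin q) (Fin q) ℝ, toMat Xt * Z * toMat Xt = toMat Xt ∧ ‖Z‖ ≤ 8 / (3 * s) := by
  have h1 := h.norm_sub_le' hL hC hX hκ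
  have hs := hX.pos
  have hsmall : ‖toMat (Xt - X)‖ * ‖Y‖ ≤ 1 / 4 := by
    calc _ ≤ (5 * (e * q) * s) * (2 / s) := by
          refine mul_le_mul ((norm_toMat_le _).trans h1) hX.inv_norm_le (norm_nonneg _)
            (by have := hC.nonneg; positivity)
      _ = 10 * (e * q) := by field_simp; ring
      _ ≤ 1 / 4 := by have := hC.eq_le; linarith
  have h2 := (exists_perturbed_inverse hX.inv hX.inv' hsmall).2
  rw [← toMat_add, add_sub_cancel] at h2
  obtain ⟨Z, hZ1, hZ2⟩ := h2 (h.1.trans hX.rank_eq.ge)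
  refine ⟨Z, hZ1, hZ2.trans ?_⟩
  calc 4 / 3 * ‖Y‖ ≤ 4 / 3 * (2 / s) := by linarith [hX.inv_norm_le]
    _ = _ := by field_simp; norm_num

lemma IsStat.norm_residual_le (hL : HasRIP r Ls) (hC : IsSmall e C) (hX : rank X ≤ r)
    (hκ : κ ≤ 1.4) (h : IsStat (Ls + C) (Ls X) r κ Xt) :
    ‖Ls X - (Ls + C) Xt‖ ≤ 6.2 * ‖C X‖ := by
  have h1 := h.norm_sub_le hL hC hX hκ
  have h2 : Ls X - (Ls + C) Xt = -((Ls + C) (Xt - X)) - C X := by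
    rw [map_sub]; simp only [add_apply]; abel
  have h3 : ‖(Ls + C) (Xt - X)‖ ≤ 1.03 * ‖Xt - X‖ :=
    perturbed_le hL hC ((rank_sub_le _ _).trans (by have := h.1; omega))
  rw [h2]
  have h4 := _root_.norm_sub_le (-((Ls + C) (Xt - X))) (C X)
  rw [norm_neg] at h4
  linarith [norm_nonneg (C X)]

/-- The residual at `X₁` is orthogonal to the image of the tangent space at `X₁`. Only the quadratic
normal part of `X₂ - X₁` pairs with it, and the residual is itself of order `e`. Adding the
estimates with the roles exchanged bounds `‖K (X₂ - X₁)‖²` by `0.02 ‖X₂ - X₁‖²`, against the lower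
isometry bound. -/
lemma IsStat.unique (hL : HasRIP r Ls) (hC : IsSmall e C) (hX : IsConditioned r s X Y)
    {κ₁ κ₂ : ℝ} (hκ₁ : κ₁ ≤ 1.4) (hκ₂ : κ₂ ≤ 1.4) {X₁ X₂ : Mat q}
    (h₁ : IsStat (Ls + C) (Ls X) r κ₁ X₁) (h₂ : IsStat (Ls + C) (Ls X) r κ₂ X₂) : X₁ = X₂ := by
  have hs := hX.pos
  have half : ∀ {κ₁ κ₂ : ℝ} {X₁ X₂ : Mat q}, κ₁ ≤ 1.4 → κ₂ ≤ 1.4 →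
      IsStat (Ls + C) (Ls X) r κ₁ X₁ → IsStat (Ls + C) (Ls X) r κ₂ X₂ →
      ⟪(Ls + C) (X₂ - X₁), Ls X - (Ls + C) X₁⟫_ℝ ≤ 0.01 * ‖X₂ - X₁‖ ^ 2 := by
    intro κ₁ κ₂ X₁ X₂ hκ₁ hκ₂ h₁ h₂
    obtain ⟨Z₁, hZ₁, hn₁⟩ := h₁.exists_inverse hL hC hX hκ₁
    obtain ⟨Z₂, hZ₂, hn₂⟩ := h₂.exists_inverse hL hC hX hκ₂
    have hX1 : ‖toMat X₁‖ ≤ 1.1 * s := by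
      have e1 := h₁.norm_sub_le' hL hC hX hκ₁
      have e2 : toMat X₁ = toMat X + toMat (X₁ - X) := by simp
      have e3 := norm_add_le (toMat X) (toMat (X₁ - X))
      rw [← e2] at e3
      have e4 := norm_toMat_le (X₁ - X)
      have e5 := hX.norm_le
      have e6 := hC.eq_le
      nlinarith
    have hc : ‖toMat X₁‖ * ‖Z₁‖ ≤ 3 := by
      calc _ ≤ 1.1 * s * (8 / (3 * s)) :=
            mul_le_mul hX1 hn₁ (norm_nonneg _) (by positivity)
        _ = 1.1 * 8 / 3 := by field_simp
        _ ≤ 3 := by norm_num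
    obtain ⟨N, hNr, hN, A, B, hAB⟩ := exists_normal_part hZ₁ hZ₂ hc
    have e1 : X₂ - X₁ = N + (lmul A X₁ + rmul B X₁) := by rw [← hAB]; abel
    conv_lhs => rw [e1, map_add, inner_add_left, h₁.inner_tangent A B, add_zero]
    have e2 : ‖(Ls + C) N‖ ≤ 1.03 * ‖N‖ :=
      perturbed_le hL hC (hNr.trans (by have := h₂.1; omega))
    have e3 := h₁.norm_residual_le hL hC hX.rank_eq.le hκ₁
    have e4 := hC.apply_le hX
    have e5 : ‖N‖ ≤ 43 / s * ‖X₂ - X₁‖ ^ 2 := by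
      refine hN.trans (mul_le_mul_of_nonneg_right ?_ (sq_nonneg _))
      calc (1 + 3 : ℝ) ^ 2 * ‖Z₂‖ ≤ 16 * (8 / (3 * s)) := by linarith
        _ = 128 / 3 / s := by field_simp; norm_num
        _ ≤ 43 / s := by gcongr; norm_num
    calc _ ≤ ‖(Ls + C) N‖ * ‖Ls X - (Ls + C) X₁‖ := real_inner_le_norm _ _
      _ ≤ (1.03 * (43 / s * ‖X₂ - X₁‖ ^ 2)) * (6.2 * (e * q * s)) := by
          refine mul_le_mul (by linarith) (by linarith) (norm_nonneg _) (by positivity)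
      _ = 1.03 * 43 * 6.2 * (e * q) * ‖X₂ - X₁‖ ^ 2 := by field_simp
      _ ≤ 0.01 * ‖X₂ - X₁‖ ^ 2 := by
          refine mul_le_mul_of_nonneg_right ?_ (sq_nonneg _)
          have := hC.eq_le
          linarith
  have a1 := half hκ₁ hκ₂ h₁ h₂
  have a2 := half hκ₂ hκ₁ h₂ h₁
  have a3 : (Ls + C) (X₂ - X₁) = (Ls X - (Ls + C) X₁) - (Ls X - (Ls + C) X₂) := by
    rw [map_sub]; abel
  have a4 : ‖(Ls + C) (X₂ - X₁)‖ ^ 2 =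
      ⟪(Ls + C) (X₂ - X₁), Ls X - (Ls + C) X₁⟫_ℝ + ⟪(Ls + C) (X₁ - X₂), Ls X - (Ls + C) X₂⟫_ℝ := by
    have : (Ls + C) (X₁ - X₂) = -(Ls + C) (X₂ - X₁) := by rw [← map_neg]; congr 1; abel
    rw [this, inner_neg_left, ← sub_eq_add_neg, ← inner_sub_right, ← a3,
      real_inner_self_eq_norm_sq]
  have a5 : 0.97 * ‖X₂ - X₁‖ ≤ ‖(Ls + C) (X₂ - X₁)‖ :=
    perturbed_ge hL hC ((rank_sub_le _ _).trans (by have := h₁.1; have := h₂.1; omega))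
  rw [norm_sub_rev X₁ X₂] at a2
  have a6 := pow_le_pow_left₀ (by positivity) a5 2
  have a7 : ‖X₂ - X₁‖ ^ 2 ≤ 0 := by nlinarith
  have a8 : X₂ - X₁ = 0 := by
    rw [← norm_eq_zero]
    exact pow_eq_zero_iff two_ne_zero |>.mp (le_antisymm a7 (sq_nonneg _))
  exact (sub_eq_zero.mp a8).symm

lemma mul_tangent_mem (X : Mat q) (A B : Matrix (Fin q) (Fin q) ℝ) :
    lmul A X + rmul B X ∈ tangentSpace X := ⟨B, A, by simp [add_comm]⟩

/-- Tangency means `(1 - xY) t (1 - Yx) = 0`, that is, `t = (1 - xY) t Y x + x Y t`; the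
coefficients can be read off. The factor 8 is `3 * 2 + 2`. -/
lemma exists_tangent_coefficients (hX : IsConditioned r s X Y) {t : Mat q}
    (ht : t ∈ tangentSpace X) :
    ∃ A B, t = lmul A X + rmul B X ∧ ‖A‖ + ‖B‖ ≤ 8 / s * ‖t‖ := by
  obtain ⟨a, b, hab⟩ := ht
  set x := toMat X with hx
  have hs := hX.pos
  have hxY : x * Y * x = x := hX.inv
  have h0 : (1 - x * Y) * toMat t * (1 - Y * x) = 0 := by
    rw [hab]
    calc _ = (x - x * Y * x) * a * (1 - Y * x) + (1 - x * Y) * b * (x - x * Y * x) := by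
          noncomm_ring
      _ = 0 := by rw [hxY]; simp
  refine ⟨(1 - x * Y) * toMat t * Y, Y * toMat t, toMat_injective ?_, ?_⟩
  · rw [toMat_add, toMat_lmul, toMat_rmul, ← hx, ← sub_eq_zero]
    refine Eq.trans ?_ h0
    noncomm_ring
  · have h1 : ‖1 - x * Y‖ ≤ 3 := by
      refine (norm_sub_le _ _).trans ?_
      have : ‖x * Y‖ ≤ s * (2 / s) := (norm_mul_le _ _).trans
        (mul_le_mul hX.norm_le hX.inv_norm_le (norm_nonneg _) hs.le)
      have e : s * (2 / s) = 2 := by field_simp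
      linarith [norm_one_le (q := q)]
    have h2 : ‖(1 - x * Y) * toMat t * Y‖ ≤ 3 * ‖t‖ * (2 / s) :=
      (norm_mul_le _ _).trans (mul_le_mul ((norm_mul_le _ _).trans
        (mul_le_mul h1 (norm_toMat_le t) (norm_nonneg _) (by norm_num))) hX.inv_norm_le
        (norm_nonneg _) (by positivity))
    have h3 : ‖Y * toMat t‖ ≤ 2 / s * ‖t‖ := (norm_mul_le _ _).trans
      (mul_le_mul hX.inv_norm_le (norm_toMat_le t) (norm_nonneg _) (by positivity))
    calc _ ≤ 3 * ‖t‖ * (2 / s) + 2 / s * ‖t‖ := add_le_add h2 h3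
      _ = _ := by ring

lemma inner_starProjection_of_mem {E : Type*} [NormedAddCommGroup E] [InnerProductSpace ℝ E]
    (S : Submodule ℝ E) [S.HasOrthogonalProjection] {t : E} (ht : t ∈ S) (x : E) :
    ⟪t, x⟫_ℝ = ⟪t, S.starProjection x⟫_ℝ := by
  conv_lhs => rw [← Submodule.starProjection_eq_self_iff.mpr ht]
  rw [Submodule.inner_starProjection_left_eq_right]

/-- The arithmetic of the next estimate: `t` stands for the norm of the tangent vector, `l` for that
of its image, and `w` is the second-order scale. -/
lemma le_of_quadratic_bound {t p w l i₁ i₂ i₃ i₄ i₅ i₀ : ℝ} (ht : 0 ≤ t) (hw : 0 ≤ w) (hp : 0 ≤ p)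
    (hlow : 0.95 * t ^ 2 ≤ l ^ 2) (hi1 : i₀ = -l ^ 2 - i₃ - i₅ - i₄) (hi2 : i₀ = -i₁ - i₂)
    (h₁ : |i₁| ≤ 256 * w * t) (h₂ : |i₂| ≤ 6.2 * w * t) (h₃ : |i₃| ≤ 631 * w * t)
    (h₄ : |i₄| ≤ 5.2 * w * t) (h₅ : |i₅| ≤ p * t) : t ≤ 20 / 19 * p + 1040 * w := by
  rw [abs_le] at h₁ h₂ h₃ h₄ h₅
  have h3 : 0 ≤ w * t := by positivity
  have hfin : t * (0.95 * t) ≤ t * (p + 900 * w) := by nlinarith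
  rcases ht.eq_or_lt with h0 | h0
  · rw [← h0]; positivity
  · have := le_of_mul_le_mul_left hfin h0
    linarith

set_option maxHeartbeats 800000 in
/-- First-order description of the low-rank update: up to second-order terms it is the tangent
vector determined by the part of the perturbation which does not come from a rank-preserver. -/
lemma IsStat.decomposition (hL : HasRIP r Ls) (hC : IsSmall e C) (hX : IsConditioned r s X Y)
    (hκ : κ ≤ 1.4) (h : IsStat (Ls + C) (Ls X) r κ Xt) {Cp : LMap q d}
    {A₀ B₀ : Matrix (Fin q) (Fin q) ℝ} (hdec : C = Cp + Ls.comp (lmul A₀ + rmul B₀)) :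
    ∃ t N : Mat q, Xt - X + (lmul A₀ + rmul B₀) X = t + N ∧ t ∈ tangentSpace X ∧ rank N ≤ r ∧
      ‖N‖ ≤ 600 * (e * q) * ‖C X‖ ∧
      ‖t‖ ≤ 20 / 19 * ‖(tangentSpace X).starProjection (ContinuousLinearMap.adjoint Ls (Cp X))‖
        + 1040 * (e * q) * ‖C X‖ := by
  have hs := hX.pos
  have hΔ := h.norm_sub_le hL hC hX.rank_eq.le hκ
  have hΔ' := h.norm_sub_le' hL hC hX hκ
  have hρ := h.norm_residual_le hL hC hX.rank_eq.le hκ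
  have heq := hC.eq_le
  have hle := hC.le_eq
  have he0 := hC.nonneg
  obtain ⟨Z, hZ, hZn⟩ := h.exists_inverse hL hC hX hκ
  have hc : ‖toMat X‖ * ‖Y‖ ≤ 2 := by
    calc _ ≤ s * (2 / s) := mul_le_mul hX.norm_le hX.inv_norm_le (norm_nonneg _) hs.le
      _ = 2 := by field_simp
  obtain ⟨N, hNr, hN, A, B, hAB⟩ := exists_normal_part hX.inv hZ hc
  have hNr' : rank N ≤ r := hNr.trans h.1
  set δ := ‖C X‖ with hδ
  have hδ0 : 0 ≤ δ := norm_nonneg _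
  set ε := e * q with hε
  have hε0 : 0 ≤ ε := by positivity
  have hN' : ‖N‖ ≤ 600 * ε * δ := by
    refine hN.trans ?_
    calc (1 + 2) ^ 2 * ‖Z‖ * ‖Xt - X‖ ^ 2 ≤ 9 * (8 / (3 * s)) * ((5 * ε * s) * (5 * δ)) := by
          refine mul_le_mul (by linarith) ?_ (sq_nonneg _) (by positivity)
          rw [sq]
          exact mul_le_mul hΔ' hΔ (norm_nonneg _) (by positivity)
      _ = 600 * ε * δ := by field_simp; ring
  set t := Xt - X + (lmul A₀ + rmul B₀) X - N with ht
  have htmem : t ∈ tangentSpace X := by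
    have : t = (lmul A X + rmul B X) + (lmul A₀ X + rmul B₀ X) := by
      rw [← hAB, ht, add_apply]; abel
    rw [this]
    exact Submodule.add_mem _ (mul_tangent_mem X A B) (mul_tangent_mem X A₀ B₀)
  refine ⟨t, N, by rw [ht]; abel, htmem, hNr', hN', ?_⟩
  -- Stationarity concerns tangent directions at `Xt`, not at `X`. Using the coefficients of `t` at
  -- `Xt` gives `t` plus an error, called `u` below, of order `‖t‖ ‖Xt - X‖ / s`.
  obtain ⟨A', B', ht', hA'B'⟩ := exists_tangent_coefficients hX htmem
  have htr : rank t ≤ 4 * r := by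
    rw [ht']
    refine (rank_add_le _ _).trans ?_
    have := rank_lmul_le A' X; have := rank_rmul_le B' X; have := hX.rank_eq; omega
  set p := ‖(tangentSpace X).starProjection (ContinuousLinearMap.adjoint Ls (Cp X))‖ with hp
  set ρ := Ls X - (Ls + C) Xt with hρdef
  set D := Xt - X with hD
  have hrankD : rank D ≤ 2 * r := (rank_sub_le _ _).trans (by have := hX.rank_eq; have := h.1; omega)
  -- residual in terms of the decomposition
  have hρeq : ρ = -(Ls t) - Ls N - Cp X - C D := by
    have e1 : Ls t = Ls Xt - Ls X + Ls ((lmul A₀ + rmul B₀) X) - Ls N := by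
      rw [ht]; simp only [hD, map_sub, map_add]
    have e2 : C D = C Xt - C X := by rw [hD, map_sub]
    have e3 : C X = Cp X + Ls ((lmul A₀ + rmul B₀) X) := by
      conv_lhs => rw [hdec]
      rfl
    rw [hρdef, e1, e2, e3, add_apply]; abel
  have hi1 : ⟪Ls t, ρ⟫_ℝ = -‖Ls t‖ ^ 2 - ⟪Ls t, Ls N⟫_ℝ - ⟪Ls t, Cp X⟫_ℝ - ⟪Ls t, C D⟫_ℝ := by
    rw [hρeq, inner_sub_right, inner_sub_right, inner_sub_right, inner_neg_right,
      real_inner_self_eq_norm_sq]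
  -- stationarity
  set u := lmul A' D + rmul B' D with hu
  have hu1 : ‖u‖ ≤ 8 / s * ‖t‖ * ‖D‖ := by
    refine (norm_add_le _ _).trans ?_
    have e1 := norm_lmul_apply_le A' D
    have e2 := norm_rmul_apply_le B' D
    have e3 := mul_le_mul_of_nonneg_right hA'B' (norm_nonneg D)
    linarith
  have hur : rank u ≤ 4 * r := by
    refine (rank_add_le _ _).trans ?_
    have := rank_lmul_le A' D; have := rank_rmul_le B' D; omega
  have hi2 : ⟪Ls t, ρ⟫_ℝ = -⟪(Ls + C) u, ρ⟫_ℝ - ⟪C t, ρ⟫_ℝ := by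
    have e1 := h.inner_tangent A' B'
    have e2 : lmul A' Xt + rmul B' Xt = t + u := by
      rw [ht', hu, hD, map_sub, map_sub]; abel
    rw [e2, map_add, inner_add_left, ← hρdef] at e1
    have e3 : (Ls + C) t = Ls t + C t := rfl
    rw [e3, inner_add_left] at e1
    linarith
  have hb1 : |⟪(Ls + C) u, ρ⟫_ℝ| ≤ 256 * (ε * δ) * ‖t‖ := by
    refine (abs_real_inner_le_norm _ _).trans ?_
    have e1 := perturbed_le hL hC hur
    calc ‖(Ls + C) u‖ * ‖ρ‖ ≤ (1.03 * (8 / s * ‖t‖ * (5 * ε * s))) * (6.2 * δ) := by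
          refine mul_le_mul (e1.trans ?_) hρ (norm_nonneg _) (by positivity)
          refine mul_le_mul_of_nonneg_left (hu1.trans ?_) (by norm_num)
          exact mul_le_mul_of_nonneg_left hΔ' (by positivity)
      _ = 1.03 * 8 * 5 * 6.2 * (ε * δ) * ‖t‖ := by field_simp
      _ ≤ _ := by
          refine mul_le_mul_of_nonneg_right ?_ (norm_nonneg _)
          exact mul_le_mul_of_nonneg_right (by norm_num) (by positivity)
  have hb2 : |⟪C t, ρ⟫_ℝ| ≤ 6.2 * (ε * δ) * ‖t‖ := by
    refine (abs_real_inner_le_norm _ _).trans ?_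
    calc ‖C t‖ * ‖ρ‖ ≤ (ε * ‖t‖) * (6.2 * δ) := by
          refine mul_le_mul ((hC.le_mul t).trans ?_) hρ (norm_nonneg _) (by positivity)
          exact mul_le_mul_of_nonneg_right hle (norm_nonneg _)
      _ = _ := by ring
  have hLt := hL.le htr
  have hb3 : |⟪Ls t, Ls N⟫_ℝ| ≤ 631 * (ε * δ) * ‖t‖ := by
    refine (abs_real_inner_le_norm _ _).trans ?_
    calc ‖Ls t‖ * ‖Ls N‖ ≤ (1.025 * ‖t‖) * (1.025 * (600 * ε * δ)) := by
          refine mul_le_mul hLt ((hL.le (hNr'.trans (by omega))).trans ?_) (norm_nonneg _)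
            (by positivity)
          exact mul_le_mul_of_nonneg_left hN' (by norm_num)
      _ = 630.375 * ((ε * δ) * ‖t‖) := by ring
      _ ≤ 631 * ((ε * δ) * ‖t‖) := mul_le_mul_of_nonneg_right (by norm_num) (by positivity)
      _ = _ := by ring
  have hb4 : |⟪Ls t, C D⟫_ℝ| ≤ 5.2 * (ε * δ) * ‖t‖ := by
    refine (abs_real_inner_le_norm _ _).trans ?_
    calc ‖Ls t‖ * ‖C D‖ ≤ (1.025 * ‖t‖) * (ε * (5 * δ)) := by
          refine mul_le_mul hLt ((hC.le_mul D).trans ?_) (norm_nonneg _) (by positivity)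
          exact mul_le_mul hle hΔ (norm_nonneg _) hε0
      _ = 5.125 * ((ε * δ) * ‖t‖) := by ring
      _ ≤ 5.2 * ((ε * δ) * ‖t‖) := mul_le_mul_of_nonneg_right (by norm_num) (by positivity)
      _ = _ := by ring
  have hb5 : |⟪Ls t, Cp X⟫_ℝ| ≤ p * ‖t‖ := by
    rw [← ContinuousLinearMap.adjoint_inner_right, inner_starProjection_of_mem _ htmem, mul_comm]
    exact abs_real_inner_le_norm _ _
  have hlow := (hL t htr).1
  have hfin := le_of_quadratic_bound (norm_nonneg t) (mul_nonneg hε0 hδ0) (norm_nonneg _) hlow hi1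
    hi2 hb1 hb2 hb3 hb4 hb5
  exact hfin.trans_eq (by ring)
end

/-! ### Averages -/

lemma avg_mul_le {a b : Fin n → ℝ} {α β : ℝ} (hα : 0 ≤ α) (hβ : 0 ≤ β)
    (ha : (n : ℝ)⁻¹ * ∑ j, a j ^ 2 ≤ α ^ 2) (hb : (n : ℝ)⁻¹ * ∑ j, b j ^ 2 ≤ β ^ 2) :
    (n : ℝ)⁻¹ * ∑ j, a j * b j ≤ α * β := by
  have h0 : (0 : ℝ) ≤ (n : ℝ)⁻¹ := by positivity
  refine le_of_sq_le_sq ?_ (mul_nonneg hα hβ)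
  have h1 := Finset.sum_mul_sq_le_sq_mul_sq Finset.univ a b
  calc ((n : ℝ)⁻¹ * ∑ j, a j * b j) ^ 2 = (n : ℝ)⁻¹ ^ 2 * (∑ j, a j * b j) ^ 2 := by ring
    _ ≤ (n : ℝ)⁻¹ ^ 2 * ((∑ j, a j ^ 2) * ∑ j, b j ^ 2) :=
        mul_le_mul_of_nonneg_left h1 (by positivity)
    _ = ((n : ℝ)⁻¹ * ∑ j, a j ^ 2) * ((n : ℝ)⁻¹ * ∑ j, b j ^ 2) := by ring
    _ ≤ α ^ 2 * β ^ 2 := mul_le_mul ha hb (by positivity) (by positivity)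
    _ = _ := by ring

lemma avg_le_avg {a b : Fin n → ℝ} (h : ∀ j, a j ≤ b j) :
    (n : ℝ)⁻¹ * ∑ j, a j ≤ (n : ℝ)⁻¹ * ∑ j, b j :=
  mul_le_mul_of_nonneg_left (Finset.sum_le_sum fun j _ => h j) (by positivity)

section
variable {V : Type*} [NormedAddCommGroup V] [InnerProductSpace ℝ V]

lemma boxOp_apply (A B Z : Mat q) : boxOp A B Z = ⟪B, Z⟫_ℝ • A := by
  simp [boxOp]

lemma hsInner_comp_boxOp (G H : Mat q →L[ℝ] V) (A B : Mat q) :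
    hsInner G (H.comp (boxOp A B)) = ⟪G B, H A⟫_ℝ := by
  have : H.comp (boxOp A B) = (innerSL ℝ B).smulRight (H A) := by
    ext Z; simp [boxOp]
  rw [this, hsInner_smulRight]

lemma hsInner_comp_covariance (G H : Mat q →L[ℝ] V) (X : Fin n → Mat q) :
    hsInner G (H.comp (covariance X)) = (n : ℝ)⁻¹ * ∑ j, ⟪G (X j), H (X j)⟫_ℝ := by
  have : H.comp (covariance X) = (n : ℝ)⁻¹ • ∑ j, H.comp (boxOp (X j) (X j)) := by
    ext Z; simp [covariance, sum_apply]
  rw [this, hsInner_smul_right, hsInner_sum_right]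
  simp only [hsInner_comp_boxOp]

lemma avg_sq_norm_le {X : Fin n → Mat q} {Λ c : ℝ} (hΛ : 0 ≤ Λ) (hc : 0 ≤ c)
    (hcov : ∀ Z, ‖covariance X Z - Λ • Z‖ ≤ Λ * c * ‖Z‖) [FiniteDimensional ℝ V]
    (G : Mat q →L[ℝ] V) :
    (n : ℝ)⁻¹ * ∑ j, ‖G (X j)‖ ^ 2 ≤ (1 + c) * Λ * hsNorm G ^ 2 := by
  have h1 : (n : ℝ)⁻¹ * ∑ j, ‖G (X j)‖ ^ 2 = hsInner G (G.comp (covariance X)) := by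
    rw [hsInner_comp_covariance]
    simp only [real_inner_self_eq_norm_sq]
  have h2 : ‖covariance X‖ ≤ (1 + c) * Λ := by
    refine ContinuousLinearMap.opNorm_le_bound _ (by positivity) fun Z => ?_
    have e : covariance X Z = (covariance X Z - Λ • Z) + Λ • Z := by abel
    rw [e]
    refine (norm_add_le _ _).trans ?_
    rw [norm_smul, Real.norm_of_nonneg hΛ]
    linarith [hcov Z]
  rw [h1]
  refine (hsInner_le _ _).trans ?_
  have h3 := (hsNorm_comp_right_le G (covariance X)).trans
    (mul_le_mul_of_nonneg_left h2 (hsNorm_nonneg G))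
  calc _ ≤ hsNorm G * (hsNorm G * ((1 + c) * Λ)) := mul_le_mul_of_nonneg_left h3 (hsNorm_nonneg G)
    _ = _ := by ring

lemma hsInner_comp_covariance_sub (G H : Mat q →L[ℝ] V) (X : Fin n → Mat q) (Λ : ℝ) {c : ℝ}
    (hΛ : 0 ≤ Λ) (hc : 0 ≤ c) (hcov : ∀ Z, ‖covariance X Z - Λ • Z‖ ≤ Λ * c * ‖Z‖)
    [FiniteDimensional ℝ V] :
    |hsInner G (H.comp (covariance X)) - Λ * hsInner G H| ≤ Λ * c * hsNorm H * hsNorm G := by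
  have e : hsInner G (H.comp (covariance X)) - Λ * hsInner G H =
      hsInner G (H.comp (covariance X - Λ • ContinuousLinearMap.id ℝ (Mat q))) := by
    rw [← hsInner_smul_right, ← hsInner_sub_right]
    congr 1
    ext Z; simp
  have h2 : ‖covariance X - Λ • ContinuousLinearMap.id ℝ (Mat q)‖ ≤ Λ * c :=
    ContinuousLinearMap.opNorm_le_bound _ (by positivity) hcov
  rw [e]
  refine (abs_hsInner_le _ _).trans ?_
  have h3 := (hsNorm_comp_right_le H _).trans (mul_le_mul_of_nonneg_left h2 (hsNorm_nonneg H))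
  calc _ ≤ hsNorm G * (hsNorm H * (Λ * c)) := mul_le_mul_of_nonneg_left h3 (hsNorm_nonneg G)
    _ = _ := by ring
end

/-! ### Tangent directions of the rank-preservers -/

/-- The operator `Z ↦ A Z + Z B`. -/
def tangentOp (A B : Matrix (Fin q) (Fin q) ℝ) : MatOp q := lmul A + rmul B

/-- `G` is orthogonal to all the maps `Z ↦ L(A Z + Z B)`. -/
def IsNormalTo (L G : LMap q d) : Prop := ∀ A B, hsInner G (L.comp (tangentOp A B)) = 0

/-- Orthogonal projection in the Hilbert–Schmidt space onto the maps `L ∘ T`. To first order the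
tangential part is the effect of a rank-preserver; only the normal part counts as an error. -/
lemma exists_normal_decomposition (L C : LMap q d) :
    ∃ (Cp : LMap q d) (A B : Matrix (Fin q) (Fin q) ℝ), C = Cp + L.comp (tangentOp A B) ∧
      IsNormalTo L Cp ∧ hsNorm Cp ≤ hsNorm C ∧ hsNorm (L.comp (tangentOp A B)) ≤ hsNorm C := by
  let f : Matrix (Fin q) (Fin q) ℝ × Matrix (Fin q) (Fin q) ℝ →ₗ[ℝ] LMap q d :=
    { toFun := fun w => L.comp (tangentOp w.1 w.2)
      map_add' := fun v w => by
        ext Z : 1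
        simp only [ContinuousLinearMap.comp_apply, add_apply, ← map_add, tangentOp]
        congr 1
        exact toMat_injective (by simp [add_mul, mul_add]; abel)
      map_smul' := fun c w => by
        ext Z : 1
        simp only [ContinuousLinearMap.comp_apply, smul_apply, ← map_smul, tangentOp,
          RingHom.id_apply]
        congr 1
        exact toMat_injective (by simp) }
  let S := ((cols (q := q) (EuclideanSpace ℝ (Fin d))) ∘ₗ f).range
  obtain ⟨w, hw⟩ : S.starProjection (cols _ C) ∈ S := Submodule.starProjection_apply_mem _ _
  have hw' : cols _ (L.comp (tangentOp w.1 w.2)) = S.starProjection (cols _ C) := hw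
  have hCp : cols _ (C - L.comp (tangentOp w.1 w.2)) = Sᗮ.starProjection (cols _ C) := by
    rw [map_sub, hw']
    rw [Submodule.starProjection_orthogonal']; rfl
  refine ⟨C - L.comp (tangentOp w.1 w.2), w.1, w.2, by abel, fun A B => ?_, ?_, ?_⟩
  · rw [hsInner, hCp]
    have h1 : Sᗮ.starProjection (cols _ C) ∈ Sᗮ := Submodule.starProjection_apply_mem _ _
    exact Submodule.inner_left_of_mem_orthogonal (K := S) ⟨(A, B), rfl⟩ h1
  · rw [hsNorm, hCp]; exact Submodule.norm_starProjection_apply_le _ _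
  · rw [hsNorm, hw']; exact Submodule.norm_starProjection_apply_le _ _

/-- The Hilbert–Schmidt norm is computed on matrix units. If their images have low rank, the
restricted isometry property applies to each of them, and no spectral norm of `L` enters. -/
lemma hsNorm_comp_le_of_rank {r : ℕ} {L : LMap q d} (hL : HasRIP r L) (T : MatOp q)
    (hT : ∀ p, rank (T (EuclideanSpace.single p 1)) ≤ 4 * r) :
    hsNorm (L.comp T) ≤ 1.025 * hsNorm T ∧ 0.974 * hsNorm T ≤ hsNorm (L.comp T) := by
  constructor
  · refine le_of_sq_le_sq ?_ (mul_nonneg (by norm_num) (hsNorm_nonneg _))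
    rw [mul_pow, hsNorm_sq, hsNorm_sq, Finset.mul_sum]
    refine Finset.sum_le_sum fun p _ => ?_
    rw [← mul_pow]
    exact pow_le_pow_left₀ (norm_nonneg _) (hL.le (hT p)) 2
  · refine le_of_sq_le_sq ?_ (hsNorm_nonneg _)
    rw [mul_pow, hsNorm_sq, hsNorm_sq, Finset.mul_sum]
    refine Finset.sum_le_sum fun p _ => ?_
    rw [← mul_pow]
    exact pow_le_pow_left₀ (by positivity) (hL.ge (hT p)) 2

lemma tangentOp_shift (A B : Matrix (Fin q) (Fin q) ℝ) (c : ℝ) :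
    tangentOp (A + c • 1) (B - c • 1) = tangentOp A B := by
  ext Z : 1
  exact toMat_injective (by simp [tangentOp, add_mul, mul_sub])

/-- The coefficients of a tangent operator can be chosen of its size. -/
lemma exists_small_coefficients (hq : 1 ≤ q) (A B : Matrix (Fin q) (Fin q) ℝ) :
    ∃ A' B', tangentOp A' B' = tangentOp A B ∧ ‖A'‖ ≤ hsNorm (tangentOp A B) ∧
      ‖B'‖ ≤ 2 * hsNorm (tangentOp A B) := by
  let o : Fin q := ⟨0, hq⟩
  -- The coefficients are determined up to a multiple of the identity moved from one to the other;
  -- this choice makes the `(o, o)` entry of `B'` vanish.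
  set A' := A + B o o • (1 : Matrix (Fin q) (Fin q) ℝ) with hA'
  set B' := B - B o o • (1 : Matrix (Fin q) (Fin q) ℝ) with hB'
  have hT : tangentOp A' B' = tangentOp A B := tangentOp_shift A B _
  have hB0 : B' o o = 0 := by simp [hB']
  set w := hsNorm (tangentOp A B) with hw
  have hent : ∀ a b c e : Fin q, tangentOp A' B' (EuclideanSpace.single (a, b) 1) (c, e) =
      A' c a * (if b = e then 1 else 0) + (if c = a then 1 else 0) * B' b e := by
    intro a b c e
    rw [← toMat_apply]
    have h1 : toMat (EuclideanSpace.single (a, b) (1 : ℝ)) = Matrix.single a b 1 := by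
      ext i j
      rw [toMat_apply]
      by_cases hi : i = a <;> by_cases hj : j = b <;>
        simp [Matrix.single_apply, hi, hj, Prod.ext_iff, eq_comm]
    simp only [tangentOp, add_apply, toMat_add, toMat_lmul, toMat_rmul, h1,
      Matrix.add_apply, Matrix.mul_apply, Matrix.single_apply]
    congr 1
    · rw [Finset.sum_eq_single a] <;> simp +contextual
      intro x hx; simp [Ne.symm hx]
    · rw [Finset.sum_eq_single b]
      · simp [eq_comm]
      · intro x _ hx; simp [Ne.symm hx]
      · simp
  have hsum : w ^ 2 = ∑ a, ∑ b, ∑ c, ∑ e,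
      (tangentOp A' B' (EuclideanSpace.single (a, b) 1) (c, e)) ^ 2 := by
    rw [hw, ← hT, hsNorm_sq, Fintype.sum_prod_type]
    refine Finset.sum_congr rfl fun a _ => Finset.sum_congr rfl fun b _ => ?_
    rw [EuclideanSpace.norm_sq_eq, Fintype.sum_prod_type]
    simp
  have hw0 : 0 ≤ w := hsNorm_nonneg _
  -- Entries of the operator with both column indices equal to `o` are those of `A'`, since `B'`
  -- vanishes at `(o, o)`. Entries with both row indices `o` are those of `B'` plus a multiple of
  -- the identity.
  have hA : ‖A'‖ ≤ w := by
    rw [← toMat_ofMat A']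
    refine (norm_toMat_le _).trans (le_of_sq_le_sq ?_ hw0)
    rw [hsum, norm_sq_eq_sum]
    refine Finset.sum_le_sum fun a _ => ?_
    refine le_trans ?_ (Finset.single_le_sum (f := fun b => ∑ c, ∑ e,
      (tangentOp A' B' (EuclideanSpace.single (a, b) 1) (c, e)) ^ 2)
      (fun b _ => by positivity) (Finset.mem_univ o))
    refine Finset.sum_le_sum fun c _ => ?_
    refine le_trans ?_ (Finset.single_le_sum (fun b _ => by positivity) (Finset.mem_univ o))
    rw [hent, hB0]; simp
  have hB : ‖B' + A' o o • (1 : Matrix (Fin q) (Fin q) ℝ)‖ ≤ w := by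
    rw [← toMat_ofMat (B' + A' o o • 1)]
    refine (norm_toMat_le _).trans (le_of_sq_le_sq ?_ hw0)
    rw [hsum, norm_sq_eq_sum, Finset.sum_comm]
    refine le_trans ?_ (Finset.single_le_sum (f := fun a => ∑ b, ∑ c, ∑ e,
      (tangentOp A' B' (EuclideanSpace.single (a, b) 1) (c, e)) ^ 2)
      (fun a _ => by positivity) (Finset.mem_univ o))
    refine Finset.sum_le_sum fun b _ => ?_
    refine le_trans ?_ (Finset.single_le_sum (f := fun c => ∑ e,
      (tangentOp A' B' (EuclideanSpace.single (o, b) 1) (c, e)) ^ 2)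
      (fun a _ => by positivity) (Finset.mem_univ o))
    refine Finset.sum_le_sum fun e _ => ?_
    rw [hent]
    simp [Matrix.one_apply, add_comm]
  have hA0 : |A' o o| ≤ w := by
    have h1 := (Matrix.l2_opNorm_mulVec A' (EuclideanSpace.single o (1 : ℝ)))
    have h2 := PiLp.norm_apply_le
      ((WithLp.toLp 2 (A'.mulVec (EuclideanSpace.single o (1 : ℝ)).ofLp) : EuclideanSpace ℝ (Fin q)))
      o
    have h3 := h2.trans h1
    simp at h3
    exact h3.trans hA
  refine ⟨A', B', hT, hA, ?_⟩
  have e : B' = (B' + A' o o • (1 : Matrix (Fin q) (Fin q) ℝ)) - A' o o • 1 := by abel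
  rw [e]
  refine (norm_sub_le _ _).trans ?_
  have : ‖A' o o • (1 : Matrix (Fin q) (Fin q) ℝ)‖ ≤ w := by
    rw [norm_smul, Real.norm_eq_abs]
    calc _ ≤ w * 1 := mul_le_mul hA0 norm_one_le (norm_nonneg _) hw0
      _ = w := mul_one w
  linarith

/-! ### Least squares -/

/-- The normal equations give Pythagoras' identity around `L`; the spanning condition makes the
excess vanish only at `L`. -/
lemma isLeastSquares_iff {y : Fin n → EuclideanSpace ℝ (Fin d)} {X : Fin n → Mat q}
    {L : LMap q d} (hnormal : ∀ H : LMap q d, ∑ j, ⟪y j - L (X j), H (X j)⟫_ℝ = 0)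
    (hspan : ∀ H : LMap q d, (∀ j, H (X j) = 0) → H = 0) (L' : LMap q d) :
    IsLeastSquares y X L' ↔ L' = L := by
  have key : ∀ H : LMap q d, ∑ j, ‖y j - H (X j)‖ ^ 2 =
      ∑ j, ‖y j - L (X j)‖ ^ 2 + ∑ j, ‖(L - H) (X j)‖ ^ 2 := by
    intro H
    have h1 : ∀ j, ‖y j - H (X j)‖ ^ 2 = ‖y j - L (X j)‖ ^ 2 +
        2 * ⟪y j - L (X j), (L - H) (X j)⟫_ℝ + ‖(L - H) (X j)‖ ^ 2 := by
      intro j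
      rw [← norm_add_sq_real]
      congr 2
      rw [sub_apply]; abel
    simp only [h1]
    rw [Finset.sum_add_distrib, Finset.sum_add_distrib, ← Finset.mul_sum, hnormal]
    ring
  constructor
  · intro h
    have h1 := h L
    rw [key L'] at h1
    have h2 : ∑ j, ‖(L - L') (X j)‖ ^ 2 = 0 :=
      le_antisymm (by linarith) (Finset.sum_nonneg fun j _ => sq_nonneg _)
    have h3 : L - L' = 0 := hspan _ fun j => by
      have := (Finset.sum_eq_zero_iff_of_nonneg fun j _ => sq_nonneg _).mp h2 j (Finset.mem_univ j)
      rwa [sq_eq_zero_iff, norm_eq_zero] at this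
    exact (sub_eq_zero.mp h3).symm
  · rintro rfl H
    rw [key H]
    have : 0 ≤ ∑ j, ‖(L' - H) (X j)‖ ^ 2 := Finset.sum_nonneg fun j _ => sq_nonneg _
    linarith

/-! ### The contraction estimate -/

/-- A well-conditioned and nearly isotropic collection of matrices of rank `r`, together with a map
satisfying the restricted isometry property. -/
structure IsEnsemble (r : ℕ) (s Λ : ℝ) (Ls : LMap q d) (X : Fin n → Mat q)
    (Y : Fin n → Matrix (Fin q) (Fin q) ℝ) : Prop where
  one_le : 1 ≤ r
  cond : ∀ j, IsConditioned r s (X j) (Y j)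
  rip : HasRIP r Ls
  pos : 0 < Λ
  cov : ∀ Z, ‖covariance X Z - Λ • Z‖ ≤ Λ * (1 / 600) * ‖Z‖
  omega : ∀ G : LMap q d, IsNormalTo Ls G → (n : ℝ)⁻¹ * ∑ j,
    ‖(tangentSpace (X j)).starProjection (ContinuousLinearMap.adjoint Ls (G (X j)))‖ ^ 2 ≤
      Λ / 8 * hsNorm G ^ 2

section
variable {r : ℕ} {s Λ e κ : ℝ} {Ls C : LMap q d} {X Xt : Fin n → Mat q}
  {Y : Fin n → Matrix (Fin q) (Fin q) ℝ}

lemma IsEnsemble.avg_le (h : IsEnsemble r s Λ Ls X Y) {V : Type*} [NormedAddCommGroup V]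
    [InnerProductSpace ℝ V] [FiniteDimensional ℝ V] (G : Mat q →L[ℝ] V) :
    (n : ℝ)⁻¹ * ∑ j, ‖G (X j)‖ ^ 2 ≤ (1 + 1 / 600) * Λ * hsNorm G ^ 2 :=
  avg_sq_norm_le h.pos.le (by norm_num) h.cov G

/-- Each rank-one term moves by `O(e ‖X j‖²)`, and the average of `‖X j‖²` is at most about `Λ q²`.
This is where `e q²`, and not just `e`, must be small. -/
lemma IsEnsemble.covariance_update (h : IsEnsemble r s Λ Ls X Y) (hC : IsSmall e C)
    (hκ : κ ≤ 1.4) (hX : ∀ j, IsStat (Ls + C) (Ls (X j)) r κ (Xt j)) (Z : Mat q) :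
    ‖covariance Xt Z - Λ • Z‖ ≤ Λ * (1 / 500) * ‖Z‖ := by
  have he := hC.e_le
  have he0 := hC.nonneg
  have hΔ : ∀ j, ‖Xt j - X j‖ ≤ 5 * e * ‖X j‖ := fun j => by
    have h1 := (hX j).norm_sub_le h.rip hC (h.cond j).rank_eq.le hκ
    have h2 := hC.le_mul (X j)
    linarith
  have e1 : covariance Xt Z - Λ • Z = (covariance X Z - Λ • Z) +
      (n : ℝ)⁻¹ • ∑ j, (boxOp (Xt j) (Xt j) Z - boxOp (X j) (X j) Z) := by
    simp only [covariance, smul_apply, sum_apply, Finset.sum_sub_distrib, smul_sub]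
    abel
  have hterm : ∀ j, ‖boxOp (Xt j) (Xt j) Z - boxOp (X j) (X j) Z‖ ≤
      10.1 * e * ‖Z‖ * ‖X j‖ ^ 2 := by
    intro j
    have e2 : boxOp (Xt j) (Xt j) Z - boxOp (X j) (X j) Z =
        ⟪Xt j - X j, Z⟫_ℝ • Xt j + ⟪X j, Z⟫_ℝ • (Xt j - X j) := by
      rw [boxOp_apply, boxOp_apply, inner_sub_left, sub_smul, smul_sub]; abel
    have e3 : ‖Xt j‖ ≤ 1.01 * ‖X j‖ := by
      have : Xt j = (Xt j - X j) + X j := by abel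
      have h2 := norm_add_le (Xt j - X j) (X j)
      rw [← this] at h2
      have := hΔ j
      nlinarith [norm_nonneg (X j)]
    rw [e2]
    refine (norm_add_le _ _).trans ?_
    rw [norm_smul, norm_smul]
    have i1 : ‖⟪Xt j - X j, Z⟫_ℝ‖ * ‖Xt j‖ ≤ (5 * e * ‖X j‖ * ‖Z‖) * (1.01 * ‖X j‖) :=
      mul_le_mul ((norm_inner_le_norm _ _).trans
        (mul_le_mul_of_nonneg_right (hΔ j) (norm_nonneg _))) e3 (norm_nonneg _) (by positivity)
    have i2 : ‖⟪X j, Z⟫_ℝ‖ * ‖Xt j - X j‖ ≤ (‖X j‖ * ‖Z‖) * (5 * e * ‖X j‖) :=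
      mul_le_mul (norm_inner_le_norm _ _) (hΔ j) (norm_nonneg _) (by positivity)
    have : 0 ≤ e * ‖Z‖ * ‖X j‖ ^ 2 := by positivity
    linarith
  have hq := h.avg_le (ContinuousLinearMap.id ℝ (Mat q))
  rw [hsNorm_id] at hq
  simp only [ContinuousLinearMap.id_apply] at hq
  rw [e1]
  refine (norm_add_le _ _).trans ?_
  have h3 : ‖(n : ℝ)⁻¹ • ∑ j, (boxOp (Xt j) (Xt j) Z - boxOp (X j) (X j) Z)‖ ≤
      10.1 * e * ‖Z‖ * ((1 + 1 / 600) * Λ * (q : ℝ) ^ 2) := by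
    rw [norm_smul, Real.norm_of_nonneg (by positivity)]
    calc _ ≤ (n : ℝ)⁻¹ * ∑ j, 10.1 * e * ‖Z‖ * ‖X j‖ ^ 2 :=
          mul_le_mul_of_nonneg_left ((norm_sum_le _ _).trans
            (Finset.sum_le_sum fun j _ => hterm j)) (by positivity)
      _ = 10.1 * e * ‖Z‖ * ((n : ℝ)⁻¹ * ∑ j, ‖X j‖ ^ 2) := by rw [← Finset.mul_sum]; ring
      _ ≤ _ := mul_le_mul_of_nonneg_left hq (by positivity)
  have h4 := h.cov Z
  have h5 : 10.1 * e * ‖Z‖ * ((1 + 1 / 600) * Λ * (q : ℝ) ^ 2) =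
      10.1 * (1 + 1 / 600) * (e * (q : ℝ) ^ 2) * (Λ * ‖Z‖) := by ring
  have h6 : 10.1 * (1 + 1 / 600) * (e * (q : ℝ) ^ 2) * (Λ * ‖Z‖) ≤
      10.1 * (1 + 1 / 600) * (1 / 90000) * (Λ * ‖Z‖) := by
    refine mul_le_mul_of_nonneg_right ?_ (mul_nonneg h.pos.le (norm_nonneg _))
    linarith [hC.small]
  have h7 : 0 ≤ Λ * ‖Z‖ := mul_nonneg h.pos.le (norm_nonneg _)
  linarith

lemma exists_solution_of_covariance (hΛ : 0 < Λ)
    (hcov : ∀ Z, ‖covariance Xt Z - Λ • Z‖ ≤ Λ * (1 / 500) * ‖Z‖) (R : MatOp q) :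
    ∃ D : MatOp q, D.comp (covariance Xt) = R := by
  have hinj : Function.Injective (covariance Xt) := by
    rw [injective_iff_map_eq_zero]
    intro Z hZ
    have h1 := hcov Z
    rw [hZ, zero_sub, norm_neg, norm_smul, Real.norm_of_nonneg hΛ.le] at h1
    have h2 : 0 ≤ ‖Z‖ := norm_nonneg Z
    rw [← norm_eq_zero]
    by_contra hne
    have h3 : 0 < ‖Z‖ := lt_of_le_of_ne h2 (Ne.symm hne)
    nlinarith [mul_pos hΛ h3]
  let S := LinearEquiv.ofInjectiveEndo (covariance Xt : Mat q →ₗ[ℝ] Mat q) hinj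
  refine ⟨R.comp (LinearMap.toContinuousLinearMap (S.symm : Mat q →ₗ[ℝ] Mat q)), ?_⟩
  ext Z : 1
  simp only [ContinuousLinearMap.comp_apply]
  congr 1
  exact S.symm_apply_apply Z

/-- The linear operator describing the least-squares update. -/
def updateRhs (X Xt : Fin n → Mat q) : MatOp q :=
  -((n : ℝ)⁻¹ • ∑ j, boxOp (Xt j - X j) (Xt j))

lemma hsInner_comp_updateRhs (G H : LMap q d) (X Xt : Fin n → Mat q) :
    hsInner G (H.comp (updateRhs X Xt)) = -((n : ℝ)⁻¹ * ∑ j, ⟪G (Xt j), H (Xt j - X j)⟫_ℝ) := by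
  have : H.comp (updateRhs X Xt) =
      -((n : ℝ)⁻¹ • ∑ j, H.comp (boxOp (Xt j - X j) (Xt j))) := by
    ext Z; simp [updateRhs, sum_apply]
  rw [this, hsInner_neg_right, hsInner_smul_right, hsInner_sum_right]
  simp only [hsInner_comp_boxOp]

/-- Test the normal equations with `Ls ∘ D` itself. On the right side the pointwise bound `‖Xt - X‖
≤ 5 ‖C X‖` averages to order `√Λ e`. -/
lemma IsEnsemble.hsNorm_update_le (h : IsEnsemble r s Λ Ls X Y) (hC : IsSmall e C)
    (hκ : κ ≤ 1.4) (hX : ∀ j, IsStat (Ls + C) (Ls (X j)) r κ (Xt j)) {D : MatOp q}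
    (hD : D.comp (covariance Xt) = updateRhs X Xt) : hsNorm (Ls.comp D) ≤ 6 * e := by
  have hΛ := h.pos
  have he0 := hC.nonneg
  set G := Ls.comp D with hG
  have hcov := h.covariance_update hC hκ hX
  have h1 := hsInner_comp_covariance_sub G G Xt Λ hΛ.le (by norm_num) hcov
  have h2 : G.comp (covariance Xt) = Ls.comp (updateRhs X Xt) := by
    rw [hG, ContinuousLinearMap.comp_assoc, hD]
  rw [h2, hsInner_comp_updateRhs, hsInner_self] at h1
  obtain ⟨l, hl0, hl⟩ : ∃ l : ℝ, 0 ≤ l ∧ l ^ 2 = Λ := ⟨√Λ, Real.sqrt_nonneg _, Real.sq_sqrt hΛ.le⟩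
  have h3 : (n : ℝ)⁻¹ * ∑ j, ‖G (Xt j)‖ ^ 2 ≤ (1.01 * l * hsNorm G) ^ 2 := by
    refine (avg_sq_norm_le hΛ.le (by norm_num) hcov G).trans ?_
    rw [mul_pow, mul_pow, hl]
    have : 0 ≤ Λ * hsNorm G ^ 2 := by positivity
    linarith
  have h4 : (n : ℝ)⁻¹ * ∑ j, ‖Ls (Xt j - X j)‖ ^ 2 ≤ (5.2 * l * e) ^ 2 := by
    calc _ ≤ (n : ℝ)⁻¹ * ∑ j, 26.3 * ‖C (X j)‖ ^ 2 := by
          refine avg_le_avg fun j => ?_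
          have i1 := (hX j).norm_sub_le h.rip hC (h.cond j).rank_eq.le hκ
          have i2 : ‖Ls (Xt j - X j)‖ ≤ 1.025 * ‖Xt j - X j‖ := h.rip.le
            ((rank_sub_le _ _).trans (by have := (hX j).1; have := (h.cond j).rank_eq; omega))
          have i3 : ‖Ls (Xt j - X j)‖ ≤ 5.125 * ‖C (X j)‖ := by linarith
          have i4 := pow_le_pow_left₀ (norm_nonneg _) i3 2
          nlinarith [sq_nonneg ‖C (X j)‖]
      _ = 26.3 * ((n : ℝ)⁻¹ * ∑ j, ‖C (X j)‖ ^ 2) := by rw [← Finset.mul_sum]; ring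
      _ ≤ 26.3 * ((1 + 1 / 600) * Λ * e ^ 2) := by
          refine mul_le_mul_of_nonneg_left ((h.avg_le C).trans ?_) (by norm_num)
          exact mul_le_mul_of_nonneg_left (pow_le_pow_left₀ (hsNorm_nonneg _) hC.hs_le 2)
            (by positivity)
      _ ≤ (5.2 * l * e) ^ 2 := by
          rw [mul_pow, mul_pow, hl]
          have : 0 ≤ Λ * e ^ 2 := by positivity
          linarith
  have hg := hsNorm_nonneg G
  have h5 := avg_mul_le (by positivity) (by positivity) h3 h4
  have h6 : -((n : ℝ)⁻¹ * ∑ j, ⟪G (Xt j), Ls (Xt j - X j)⟫_ℝ) ≤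
      (n : ℝ)⁻¹ * ∑ j, ‖G (Xt j)‖ * ‖Ls (Xt j - X j)‖ := by
    rw [← mul_neg, ← Finset.sum_neg_distrib]
    refine avg_le_avg fun j => ?_
    exact (neg_le_abs _).trans (abs_real_inner_le_norm _ _)
  have h7 := neg_le_of_abs_le h1
  have h8 : Λ * (hsNorm G * hsNorm G) ≤ Λ * (hsNorm G * (6 * e)) := by
    have e1 : 1.01 * l * hsNorm G * (5.2 * l * e) = 5.252 * (Λ * (hsNorm G * e)) := by
      rw [← hl]; ring
    have e2 : 0 ≤ Λ * (hsNorm G * hsNorm G) := by positivity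
    have e3 : 0 ≤ Λ * (hsNorm G * e) := by positivity
    nlinarith
  have h9 := le_of_mul_le_mul_left h8 hΛ
  rcases hg.eq_or_lt with h0 | h0
  · rw [← h0]; positivity
  · exact le_of_mul_le_mul_left h9 h0

/-- The leading term is `20 / 19 * 0.36 ^ 2 < 0.14`, where `0.36 ^ 2` slightly exceeds the `1 / 8`
in `IsEnsemble.omega`. The other terms are far below the gap to `1 / 4`. -/
lemma contraction_arith {l g e ε x₁ x₂ x₃ x₄ x₅ x₆ : ℝ} (hg : 0 ≤ g) (he : 0 ≤ e)
    (hε : ε ≤ 1 / 180000) (heε : e ≤ ε)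
    (h₁ : x₁ ≤ 20 / 19 * ((0.36 * l * g) * (0.36 * l * e)) +
      1040 * ε * ((0.36 * l * g) * (1.01 * l * e)))
    (h₂ : x₂ ≤ 615 * ε * ((1.01 * l * g) * (1.01 * l * e)))
    (h₃ : x₃ ≤ l ^ 2 * (1 / 600) * e * g)
    (h₄ : x₄ ≤ 25.7 * g * (1.01 * l * e) ^ 2)
    (h₅ : x₅ ≤ l ^ 2 * (1 / 500) * (6 * e) * g)
    (h₆ : l ^ 2 * x₆ ≤ x₁ + x₂ + x₃ + x₄ + x₅) : l ^ 2 * x₆ ≤ l ^ 2 * (e / 4 * g) := by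
  have hb : 0 ≤ l ^ 2 * (e * g) := by positivity
  have b1 : ε * (l ^ 2 * (e * g)) ≤ 1 / 180000 * (l ^ 2 * (e * g)) :=
    mul_le_mul_of_nonneg_right hε hb
  have b2 : e * (l ^ 2 * (e * g)) ≤ 1 / 180000 * (l ^ 2 * (e * g)) :=
    mul_le_mul_of_nonneg_right (heε.trans hε) hb
  nlinarith

/-- The component of the least-squares update which is normal to the rank-preservers is
contracted. -/
lemma IsEnsemble.hsInner_update_le (h : IsEnsemble r s Λ Ls X Y) (hC : IsSmall e C)
    (hκ : κ ≤ 1.4) (hX : ∀ j, IsStat (Ls + C) (Ls (X j)) r κ (Xt j)) {D : MatOp q}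
    (hD : D.comp (covariance Xt) = updateRhs X Xt) {G : LMap q d} (hG : IsNormalTo Ls G) :
    hsInner G (Ls.comp D) ≤ e / 4 * hsNorm G := by
  have hΛ := h.pos
  have he0 := hC.nonneg
  obtain ⟨Cp, A₀, B₀, hdec, hCp, hCpn, hWn⟩ := exists_normal_decomposition Ls C
  replace hCpn := hCpn.trans hC.hs_le
  replace hWn := hWn.trans hC.hs_le
  set W := tangentOp A₀ B₀ with hW
  choose t N htN ht hNr hN htn using fun j =>
    (hX j).decomposition h.rip hC (h.cond j) hκ (A₀ := A₀) (B₀ := B₀) hdec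
  set ε := e * q with hε
  have hε0 : 0 ≤ ε := by positivity
  set g := hsNorm G with hg
  have hg0 : 0 ≤ g := hsNorm_nonneg G
  obtain ⟨l, hl0, hl⟩ : ∃ l : ℝ, 0 ≤ l ∧ l ^ 2 = Λ := ⟨√Λ, Real.sqrt_nonneg _, Real.sq_sqrt hΛ.le⟩
  have hcov := h.covariance_update hC hκ hX
  -- averages
  have hP : ∀ (H : LMap q d) (m : ℝ), 0 ≤ m → IsNormalTo Ls H → hsNorm H ≤ m → (n : ℝ)⁻¹ * ∑ j,
      ‖(tangentSpace (X j)).starProjection (ContinuousLinearMap.adjoint Ls (H (X j)))‖ ^ 2 ≤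
        (0.36 * l * m) ^ 2 := by
    intro H m hm hH hHm
    refine (h.omega H hH).trans ?_
    rw [mul_pow, mul_pow, hl]
    have i1 := pow_le_pow_left₀ (hsNorm_nonneg H) hHm 2
    have i2 := mul_le_mul_of_nonneg_left i1 hΛ.le
    have i3 : 0 ≤ Λ * m ^ 2 := by positivity
    linarith
  have hQ : ∀ (H : LMap q d) (m : ℝ), 0 ≤ m → hsNorm H ≤ m →
      (n : ℝ)⁻¹ * ∑ j, ‖H (X j)‖ ^ 2 ≤ (1.01 * l * m) ^ 2 := by
    intro H m hm hHm
    refine (h.avg_le H).trans ?_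
    rw [mul_pow, mul_pow, hl]
    have i1 := pow_le_pow_left₀ (hsNorm_nonneg H) hHm 2
    have i2 := mul_le_mul_of_nonneg_left i1 hΛ.le
    have i3 : 0 ≤ Λ * m ^ 2 := by positivity
    linarith
  set a : Fin n → ℝ := fun j =>
    ‖(tangentSpace (X j)).starProjection (ContinuousLinearMap.adjoint Ls (G (X j)))‖ with ha
  set b : Fin n → ℝ := fun j =>
    ‖(tangentSpace (X j)).starProjection (ContinuousLinearMap.adjoint Ls (Cp (X j)))‖ with hb
  have hab := avg_mul_le (by positivity) (by positivity) (hP G g hg0 hG le_rfl) (hP Cp e he0 hCp hCpn)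
  have haδ := avg_mul_le (by positivity) (by positivity) (hP G g hg0 hG le_rfl) (hQ C e he0 hC.hs_le)
  have hgδ := avg_mul_le (by positivity) (by positivity) (hQ G g hg0 le_rfl) (hQ C e he0 hC.hs_le)
  have hδδ := hQ C e he0 hC.hs_le
  -- The motion along the rank-preserver direction `W` is of full order `e`. It drops out because
  -- `G` is orthogonal to `Ls ∘ W`, so only the anisotropy of the covariance remains.
  have hWcov := hsInner_comp_covariance_sub G (Ls.comp W) X Λ hΛ.le (by norm_num) h.cov
  rw [hG A₀ B₀, mul_zero, sub_zero, hsInner_comp_covariance] at hWcov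
  have hDcov := hsInner_comp_covariance_sub G (Ls.comp D) Xt Λ hΛ.le (by norm_num) hcov
  have hDn := h.hsNorm_update_le hC hκ hX hD
  rw [ContinuousLinearMap.comp_assoc, hD, hsInner_comp_updateRhs] at hDcov
  -- pointwise bound
  have hpt : ∀ j, -⟪G (Xt j), Ls (Xt j - X j)⟫_ℝ ≤
      (20 / 19 * (a j * b j) + 1040 * ε * (a j * ‖C (X j)‖)) +
        615 * ε * (‖G (X j)‖ * ‖C (X j)‖) + ⟪G (X j), (Ls.comp W) (X j)⟫_ℝ +
        25.7 * g * ‖C (X j)‖ ^ 2 := by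
    intro j
    set Δ := Xt j - X j with hΔ
    have hΔn : ‖Δ‖ ≤ 5 * ‖C (X j)‖ := (hX j).norm_sub_le h.rip hC (h.cond j).rank_eq.le hκ
    have hLΔ : ‖Ls Δ‖ ≤ 1.025 * ‖Δ‖ := h.rip.le
      ((rank_sub_le _ _).trans (by have := (hX j).1; have := (h.cond j).rank_eq; omega))
    have e1 : G (Xt j) = G (X j) + G Δ := by rw [hΔ, map_sub]; abel
    have e2 : Ls Δ = Ls (t j) + Ls (N j) - (Ls.comp W) (X j) := by
      have : Δ = t j + N j - W (X j) := by
        rw [← htN j, hW, tangentOp]; exact (add_sub_cancel_right _ _).symm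
      rw [this]; simp
    rw [e1, inner_add_left]
    have e3 : ⟪G (X j), Ls Δ⟫_ℝ = ⟪G (X j), Ls (t j)⟫_ℝ + ⟪G (X j), Ls (N j)⟫_ℝ -
        ⟪G (X j), (Ls.comp W) (X j)⟫_ℝ := by rw [e2, inner_sub_right, inner_add_right]
    have i1 : |⟪G (X j), Ls (t j)⟫_ℝ| ≤ a j * ‖t j‖ := by
      rw [← ContinuousLinearMap.adjoint_inner_left, real_inner_comm,
        inner_starProjection_of_mem _ (ht j), mul_comm]
      exact abs_real_inner_le_norm _ _
    have i2 : |⟪G (X j), Ls (N j)⟫_ℝ| ≤ ‖G (X j)‖ * (1.025 * (600 * ε * ‖C (X j)‖)) := by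
      refine (abs_real_inner_le_norm _ _).trans (mul_le_mul_of_nonneg_left ?_ (norm_nonneg _))
      exact (h.rip.le ((hNr j).trans (by omega))).trans
        (mul_le_mul_of_nonneg_left (hN j) (by norm_num))
    have i3 : |⟪G Δ, Ls Δ⟫_ℝ| ≤ (g * (5 * ‖C (X j)‖)) * (1.025 * (5 * ‖C (X j)‖)) := by
      refine (abs_real_inner_le_norm _ _).trans (mul_le_mul ?_ ?_ (norm_nonneg _) (by positivity))
      · exact (norm_apply_le_hsNorm G Δ).trans (mul_le_mul_of_nonneg_left hΔn hg0)
      · exact hLΔ.trans (mul_le_mul_of_nonneg_left hΔn (by norm_num))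
    have i4 : a j * ‖t j‖ ≤ a j * (20 / 19 * b j + 1040 * ε * ‖C (X j)‖) :=
      mul_le_mul_of_nonneg_left (htn j) (norm_nonneg _)
    have j1 := neg_le_of_abs_le i1
    have j2 := neg_le_of_abs_le i2
    have j3 := neg_le_of_abs_le i3
    have p1 : 0 ≤ g * ‖C (X j)‖ ^ 2 := by positivity
    rw [e3]
    linarith
  have hsum := avg_le_avg hpt
  have hneg : (n : ℝ)⁻¹ * ∑ j, -⟪G (Xt j), Ls (Xt j - X j)⟫_ℝ =
      -((n : ℝ)⁻¹ * ∑ j, ⟪G (Xt j), Ls (Xt j - X j)⟫_ℝ) := by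
    rw [Finset.sum_neg_distrib, mul_neg]
  rw [hneg] at hsum
  simp only [Finset.sum_add_distrib, ← Finset.mul_sum] at hsum
  have h₁ : (n : ℝ)⁻¹ * (20 / 19 * ∑ j, a j * b j + 1040 * ε * ∑ j, a j * ‖C (X j)‖) ≤
      20 / 19 * ((0.36 * l * g) * (0.36 * l * e)) +
      1040 * ε * ((0.36 * l * g) * (1.01 * l * e)) := by
    have i1 := mul_le_mul_of_nonneg_left hab (by norm_num : (0 : ℝ) ≤ 20 / 19)
    have i2 := mul_le_mul_of_nonneg_left haδ (by positivity : (0 : ℝ) ≤ 1040 * ε)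
    linarith
  have h₂ : (n : ℝ)⁻¹ * (615 * ε * ∑ j, ‖G (X j)‖ * ‖C (X j)‖) ≤
      615 * ε * ((1.01 * l * g) * (1.01 * l * e)) := by
    have i2 := mul_le_mul_of_nonneg_left hgδ (by positivity : (0 : ℝ) ≤ 615 * ε)
    linarith
  have h₃ : (n : ℝ)⁻¹ * ∑ j, ⟪G (X j), (Ls.comp W) (X j)⟫_ℝ ≤ l ^ 2 * (1 / 600) * e * g := by
    refine (le_abs_self _).trans (hWcov.trans ?_)
    rw [hl]
    exact mul_le_mul_of_nonneg_right (mul_le_mul_of_nonneg_left hWn (by positivity)) hg0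
  have h₄ : (n : ℝ)⁻¹ * (25.7 * g * ∑ j, ‖C (X j)‖ ^ 2) ≤ 25.7 * g * (1.01 * l * e) ^ 2 := by
    have i2 := mul_le_mul_of_nonneg_left hδδ (by positivity : (0 : ℝ) ≤ 25.7 * g)
    linarith
  have h₅ : Λ * (1 / 500) * hsNorm (Ls.comp D) * g ≤ l ^ 2 * (1 / 500) * (6 * e) * g := by
    rw [hl]
    exact mul_le_mul_of_nonneg_right (mul_le_mul_of_nonneg_left hDn (by positivity)) hg0
  have h₆ := neg_le_of_abs_le hDcov
  have hfin := contraction_arith (x₆ := hsInner G (Ls.comp D)) hg0 he0 hC.eq_le hC.le_eq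
    h₁ h₂ h₃ h₄ h₅ (by rw [hl]; linarith)
  rw [hl] at hfin
  exact le_of_mul_le_mul_left hfin hΛ

end

/-! ### Linear rank-preservers -/

open Matrix in
lemma exists_eq_vecMulVec {A : Matrix (Fin q) (Fin q) ℝ} (h : A.rank ≤ 1) :
    ∃ a b, A = vecMulVec a b := by
  rw [Matrix.rank, finrank_le_one_iff] at h
  obtain ⟨⟨a, _⟩, h⟩ := h
  choose c hc using fun k => h ⟨A.mulVecLin (Pi.single k 1), ⟨_, rfl⟩⟩
  refine ⟨a, c, ?_⟩
  ext i k
  have h1 := congrFun (congrArg Subtype.val (hc k)) i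
  simp at h1
  rw [vecMulVec_apply, mul_comm, h1]

open Matrix in
-- The 2 × 2 minors of a sum of two rank-one matrices factor into a minor of the columns times a
-- minor of the rows.
lemma minors_of_sum_eq {a b c e x y : Fin q → ℝ}
    (h : vecMulVec a b + vecMulVec c e = vecMulVec x y) (i j k l : Fin q) :
    (a i * c j - a j * c i) * (b k * e l - b l * e k) = 0 := by
  have h' : ∀ i k, a i * b k + c i * e k = x i * y k := fun i k => by
    simpa [vecMulVec_apply] using congrFun (congrFun h i) k
  calc _ = (a i * b k + c i * e k) * (a j * b l + c j * e l) -
        (a i * b l + c i * e l) * (a j * b k + c j * e k) := by ring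
    _ = 0 := by rw [h', h', h', h']; ring

lemma exists_smul_of_minors {a c : Fin q → ℝ} (ha : a ≠ 0)
    (h : ∀ i j, a i * c j - a j * c i = 0) : ∃ μ : ℝ, c = μ • a := by
  obtain ⟨i, hi⟩ := Function.ne_iff.mp ha
  refine ⟨c i / a i, funext fun j => ?_⟩
  have := h i j
  simp only [Pi.zero_apply] at hi
  simp only [Pi.smul_apply, smul_eq_mul]
  field_simp
  linarith

open Matrix in
lemma parallel_of_sum_eq {a b c e x y : Fin q → ℝ} (ha : a ≠ 0) (hb : b ≠ 0)
    (h : vecMulVec a b + vecMulVec c e = vecMulVec x y) :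
    (∃ μ : ℝ, c = μ • a) ∨ ∃ μ : ℝ, e = μ • b := by
  by_cases hc : ∀ i j, a i * c j - a j * c i = 0
  · exact Or.inl (exists_smul_of_minors ha hc)
  · push Not at hc
    obtain ⟨i, j, hij⟩ := hc
    exact Or.inr (exists_smul_of_minors hb fun k l =>
      (mul_eq_zero.mp (minors_of_sum_eq h i j k l)).resolve_left hij)

open Matrix in
lemma vecMulVec_parallel {a b c e : Fin q → ℝ} (h : vecMulVec a b = vecMulVec c e)
    (hne : vecMulVec a b ≠ 0) : ∃ μ : ℝ, c = μ • a := by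
  have ha : a ≠ 0 := by rintro rfl; simp at hne
  have hce : vecMulVec c e ≠ 0 := h ▸ hne
  have he : e ≠ 0 := by rintro rfl; simp at hce
  obtain ⟨k, hk⟩ := Function.ne_iff.mp he
  refine ⟨b k / e k, funext fun i => ?_⟩
  have := congrFun (congrFun h i) k
  rw [vecMulVec_apply, vecMulVec_apply] at this
  simp only [Pi.zero_apply] at hk
  simp only [Pi.smul_apply, smul_eq_mul]
  field_simp
  linarith

/-- A group is not the union of two proper subgroups. -/
lemma forall_or_forall_of_add {E : Type*} [AddCommGroup E] {P Q : E → Prop}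
    (hP : ∀ v w, P v → P w → P (v - w)) (hQ : ∀ v w, Q v → Q w → Q (v - w))
    (h : ∀ v, P v ∨ Q v) : (∀ v, P v) ∨ ∀ v, Q v := by
  by_contra hc
  push Not at hc
  obtain ⟨⟨v, hv⟩, w, hw⟩ := hc
  have hv' := (h v).resolve_left hv
  have hw' := (h w).resolve_right hw
  rcases h (v - w) with h1 | h1
  · apply hv
    have h2 : P (-w) := by
      have := hP _ _ (hP _ _ hw' hw') hw'
      simpa using this
    have := hP _ _ h1 h2
    simpa using this
  · apply hw
    have := hQ _ _ hv' h1
    simpa using this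

open Matrix in
/-- A space of matrices of rank at most one has a common column or a common row. -/
lemma common_column_or_row {E : Type*} [AddCommGroup E] [Module ℝ E] [Nontrivial E]
    (ψ : E →ₗ[ℝ] Matrix (Fin q) (Fin q) ℝ) (hψ : ∀ v, ∃ a b, ψ v = vecMulVec a b)
    (hinj : ∀ v, ψ v = 0 → v = 0) :
    (∃ a, a ≠ 0 ∧ ∀ v, ∃ b, ψ v = vecMulVec a b) ∨
      ∃ b, b ≠ 0 ∧ ∀ v, ∃ a, ψ v = vecMulVec a b := by
  obtain ⟨v₀, hv₀⟩ := exists_ne (0 : E)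
  obtain ⟨a₀, b₀, h₀⟩ := hψ v₀
  have hne : vecMulVec a₀ b₀ ≠ 0 := fun h => hv₀ (hinj _ (h₀.trans h))
  have ha : a₀ ≠ 0 := by rintro rfl; simp at hne
  have hb : b₀ ≠ 0 := by rintro rfl; simp at hne
  -- Comparing `ψ v` with `ψ v₀` through their rank-one sum shows that `ψ v` shares its column or
  -- its row with `ψ v₀`. Each alternative is closed under differences.
  have := forall_or_forall_of_add (P := fun v => ∃ b, ψ v = vecMulVec a₀ b)
    (Q := fun v => ∃ a, ψ v = vecMulVec a b₀)
    (by
      rintro v w ⟨b, hb⟩ ⟨c, hc⟩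
      exact ⟨b - c, by rw [map_sub, hb, hc, vecMulVec_sub]⟩)
    (by
      rintro v w ⟨b, hb⟩ ⟨c, hc⟩
      exact ⟨b - c, by rw [map_sub, hb, hc, sub_vecMulVec]⟩)
    (fun v => by
      obtain ⟨c, e, hv⟩ := hψ v
      obtain ⟨x, y, hxy⟩ := hψ (v₀ + v)
      rw [map_add, h₀, hv] at hxy
      rcases parallel_of_sum_eq ha hb hxy with ⟨μ, rfl⟩ | ⟨μ, rfl⟩
      · exact Or.inl ⟨μ • e, by rw [hv, smul_vecMulVec, vecMulVec_smul]⟩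
      · exact Or.inr ⟨μ • c, by rw [hv, smul_vecMulVec, vecMulVec_smul]⟩)
  exact this.imp (fun h => ⟨a₀, ha, h⟩) (fun h => ⟨b₀, hb, h⟩)

section
open Matrix

/-- A linear operator on matrices as a bilinear map of column and row vectors. -/
def bilin (M : MatOp q) : (Fin q → ℝ) →ₗ[ℝ] (Fin q → ℝ) →ₗ[ℝ] Matrix (Fin q) (Fin q) ℝ :=
  LinearMap.mk₂ ℝ (fun u v => toMat (M (ofMat (vecMulVec u v))))
    (fun u u' v => by
      have : ofMat (vecMulVec (u + u') v) = ofMat (vecMulVec u v) + ofMat (vecMulVec u' v) :=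
        toMat_injective (by simp [add_vecMulVec])
      rw [this, map_add, toMat_add])
    (fun c u v => by
      have : ofMat (vecMulVec (c • u) v) = c • ofMat (vecMulVec u v) :=
        toMat_injective (by simp [smul_vecMulVec])
      rw [this, map_smul, toMat_smul])
    (fun u v v' => by
      have : ofMat (vecMulVec u (v + v')) = ofMat (vecMulVec u v) + ofMat (vecMulVec u v') :=
        toMat_injective (by simp [vecMulVec_add])
      rw [this, map_add, toMat_add])
    (fun c u v => by
      have : ofMat (vecMulVec u (c • v)) = c • ofMat (vecMulVec u v) :=
        toMat_injective (by simp [vecMulVec_smul])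
      rw [this, map_smul, toMat_smul])

lemma bilin_apply (M : MatOp q) (u v : Fin q → ℝ) :
    bilin M u v = toMat (M (ofMat (vecMulVec u v))) := rfl

variable {M : MatOp q}

lemma IsRankPreserver.injective (hM : IsRankPreserver M) {X : Mat q} (h : M X = 0) : X = 0 := by
  have h1 := hM X
  rw [h, rank_zero, rank, eq_comm, Matrix.rank, Submodule.finrank_eq_zero,
    LinearMap.range_eq_bot] at h1
  refine toMat_eq_zero.mp (Matrix.ext_of_mulVec_single fun i => ?_)
  rw [Matrix.zero_mulVec]
  exact LinearMap.congr_fun h1 (Pi.single i 1)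

lemma IsRankPreserver.bilin_eq (hM : IsRankPreserver M) (u v : Fin q → ℝ) :
    ∃ a b, bilin M u v = vecMulVec a b := by
  refine exists_eq_vecMulVec ?_
  exact (hM (ofMat (vecMulVec u v))).trans_le (Matrix.rank_vecMulVec_le _ _)

lemma IsRankPreserver.bilin_ne_zero (hM : IsRankPreserver M) {u v : Fin q → ℝ} (hu : u ≠ 0)
    (hv : v ≠ 0) : bilin M u v ≠ 0 := by
  intro h
  have h1 := hM.injective (toMat_eq_zero.mp h)
  have h2 : vecMulVec u v = 0 := by rw [← toMat_ofMat (vecMulVec u v), h1]; rfl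
  obtain ⟨i, hi⟩ := Function.ne_iff.mp hu
  obtain ⟨j, hj⟩ := Function.ne_iff.mp hv
  have := congrFun (congrFun h2 i) j
  rw [vecMulVec_apply] at this
  exact (mul_ne_zero hi hj) this

/-- `M` maps each space `u ⊗ ℝ^q` to a space with a common column. -/
def HasColumnType (M : MatOp q) (u : Fin q → ℝ) : Prop :=
  ∃ a, a ≠ 0 ∧ ∀ v, ∃ b, bilin M u v = vecMulVec a b

/-- Two independent vectors mapped into a line have a nontrivial combination mapped to zero, against
injectivity. -/
lemma not_contained_in_line (hM : IsRankPreserver M) (hq : 2 ≤ q) {u : Fin q → ℝ} (hu : u ≠ 0)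
    (T : Matrix (Fin q) (Fin q) ℝ) : ¬ ∀ v, ∃ c : ℝ, bilin M u v = c • T := by
  intro h
  let i : Fin q := ⟨0, by omega⟩
  let j : Fin q := ⟨1, by omega⟩
  have hij : i ≠ j := by simp [i, j]
  obtain ⟨α, hα⟩ := h (Pi.single i 1)
  obtain ⟨β, hβ⟩ := h (Pi.single j 1)
  have h1 : bilin M u (β • Pi.single i 1 - α • Pi.single j 1) = 0 := by
    rw [map_sub, map_smul, map_smul, hα, hβ, smul_smul, smul_smul, mul_comm, sub_self]
  have h2 : β • (Pi.single i 1 : Fin q → ℝ) - α • Pi.single j 1 = 0 := by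
    by_contra hne
    exact hM.bilin_ne_zero hu hne h1
  have h3 : α = 0 := by
    have := congrFun h2 j
    simpa [hij.symm] using this
  refine hM.bilin_ne_zero hu (v := Pi.single i 1) (by simp) ?_
  rw [hα, h3, zero_smul]

/-- Suppose `u₀` has common column `a` and `u` common row `b`. As `u₀ + u` also gives rank-one
images, for each `v` one of the images under `u` and `u₀` is a multiple of `a ⊗ b`. By the subgroup
argument this holds for one of them throughout, which puts a whole image in a line. -/
lemma HasColumnType.all (hM : IsRankPreserver M) (hq : 2 ≤ q) {u₀ : Fin q → ℝ} (hu₀ : u₀ ≠ 0)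
    (h₀ : HasColumnType M u₀) {u : Fin q → ℝ} (hu : u ≠ 0) : HasColumnType M u := by
  have : Nonempty (Fin q) := ⟨⟨0, by omega⟩⟩
  refine (common_column_or_row (bilin M u) (hM.bilin_eq u) fun v hv => ?_).resolve_right ?_
  · by_contra hne; exact hM.bilin_ne_zero hu hne hv
  rintro ⟨b, hb, h⟩
  obtain ⟨a, ha, h₀⟩ := h₀
  have := forall_or_forall_of_add (P := fun v => ∃ c : ℝ, bilin M u v = c • vecMulVec a b)
    (Q := fun v => ∃ c : ℝ, bilin M u₀ v = c • vecMulVec a b)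
    (by
      rintro v w ⟨c, hc⟩ ⟨c', hc'⟩
      exact ⟨c - c', by rw [map_sub, hc, hc', sub_smul]⟩)
    (by
      rintro v w ⟨c, hc⟩ ⟨c', hc'⟩
      exact ⟨c - c', by rw [map_sub, hc, hc', sub_smul]⟩)
    (fun v => by
      by_cases hv : v = 0
      · exact Or.inl ⟨0, by rw [hv, map_zero, zero_smul]⟩
      obtain ⟨c, hc⟩ := h v
      obtain ⟨e, he⟩ := h₀ v
      have he0 : e ≠ 0 := by
        rintro rfl
        exact hM.bilin_ne_zero hu₀ hv (he.trans (by simp))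
      obtain ⟨x, y, hxy⟩ := hM.bilin_eq (u₀ + u) v
      rw [map_add, LinearMap.add_apply, he, hc] at hxy
      rcases parallel_of_sum_eq ha he0 hxy with ⟨μ, rfl⟩ | ⟨μ, hμ⟩
      · exact Or.inl ⟨μ, by rw [hc, smul_vecMulVec]⟩
      · have hμ0 : μ ≠ 0 := by rintro rfl; rw [zero_smul] at hμ; exact hb hμ
        refine Or.inr ⟨μ⁻¹, ?_⟩
        rw [he, hμ, vecMulVec_smul, smul_smul, inv_mul_cancel₀ hμ0, one_smul])
  rcases this with h1 | h1
  · exact not_contained_in_line hM hq hu _ h1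
  · exact not_contained_in_line hM hq hu₀ _ h1

lemma isUnit_of_mulVec_injective {A : Matrix (Fin q) (Fin q) ℝ}
    (h : ∀ v, A.mulVec v = 0 → v = 0) : IsUnit A := by
  rw [← Matrix.mulVec_injective_iff_isUnit]
  exact (injective_iff_map_eq_zero A.mulVecLin).mpr h

/-- Columns depend on `u` only and rows on `v` only, so `bilin M u v` factors as `h u ⊗ g v`;
linearity of the factors yields the two matrices. -/
lemma HasColumnType.exists_sandwich (hM : IsRankPreserver M) (hq : 2 ≤ q) {u₀ : Fin q → ℝ}
    (hu₀ : u₀ ≠ 0) (h₀ : HasColumnType M u₀) :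
    ∃ A B, IsUnit A ∧ IsUnit B ∧ M = sandwich A B := by
  have : Nonempty (Fin q) := ⟨⟨0, by omega⟩⟩
  have hcol : ∀ u, u ≠ 0 → HasColumnType M u := fun u hu => h₀.all hM hq hu₀ hu
  let i : Fin q := ⟨0, by omega⟩
  let j : Fin q := ⟨1, by omega⟩
  have hij : i ≠ j := by simp [i, j]
  set v₀ : Fin q → ℝ := Pi.single i 1 with hv₀
  have hv₀0 : v₀ ≠ 0 := by simp [hv₀]
  have hflip : ∀ u, (bilin M).flip v₀ u = bilin M u v₀ := fun u => rfl
  -- with the row vector fixed, the images have a common row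
  obtain ⟨b₀, hb₀, hrow⟩ : ∃ b, b ≠ 0 ∧ ∀ u, ∃ a, bilin M u v₀ = vecMulVec a b := by
    refine (common_column_or_row ((bilin M).flip v₀) (fun u => hM.bilin_eq u v₀)
      fun u hu => ?_).resolve_left ?_
    · by_contra hne; exact hM.bilin_ne_zero hne hv₀0 hu
    rintro ⟨a, ha, h⟩
    -- If the column were common to all `u` as well, every image would have that column and so rank
    -- at most one, although some matrices have rank two.
    have hall : ∀ u v, ∃ b, bilin M u v = vecMulVec a b := by
      intro u v
      by_cases hu : u = 0
      · exact ⟨0, by rw [hu, map_zero]; simp⟩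
      obtain ⟨c, hc, hcv⟩ := hcol u hu
      obtain ⟨e, he⟩ := hcv v₀
      obtain ⟨e', he'⟩ := h u
      rw [hflip] at he'
      obtain ⟨μ, rfl⟩ := vecMulVec_parallel (he'.symm.trans he)
        (by rw [← he']; exact hM.bilin_ne_zero hu hv₀0)
      obtain ⟨f, hf⟩ := hcv v
      exact ⟨μ • f, by rw [hf, smul_vecMulVec, vecMulVec_smul]⟩
    set w₀ : Fin q → ℝ := Pi.single j 1
    have h2 : ∀ X : Matrix (Fin q) (Fin q) ℝ, X = vecMulVec v₀ v₀ + vecMulVec w₀ w₀ →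
        ¬ X.rank ≤ 1 := by
      intro X hX hr
      obtain ⟨x, y, hxy⟩ := exists_eq_vecMulVec hr
      have := minors_of_sum_eq (hX.symm.trans hxy) i j i j
      simp [v₀, w₀, hij, hij.symm] at this
    refine h2 _ rfl ?_
    have h3 := hM (ofMat (vecMulVec v₀ v₀ + vecMulVec w₀ w₀))
    rw [rank, rank, toMat_ofMat] at h3
    rw [← h3]
    have h4 : ofMat (vecMulVec v₀ v₀ + vecMulVec w₀ w₀) =
        ofMat (vecMulVec v₀ v₀) + ofMat (vecMulVec w₀ w₀) := rfl
    obtain ⟨b1, hb1⟩ := hall v₀ v₀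
    obtain ⟨b2, hb2⟩ := hall w₀ w₀
    rw [bilin_apply] at hb1 hb2
    rw [h4, map_add, toMat_add, hb1, hb2, ← vecMulVec_add]
    exact Matrix.rank_vecMulVec_le _ _
  obtain ⟨k, hk⟩ := Function.ne_iff.mp hb₀
  simp only [Pi.zero_apply] at hk
  -- the column factor
  set h : (Fin q → ℝ) → (Fin q → ℝ) := fun u => fun l => bilin M u v₀ l k / b₀ k with hh
  have hhv : ∀ u, bilin M u v₀ = vecMulVec (h u) b₀ := by
    intro u
    obtain ⟨a, ha⟩ := hrow u
    have : h u = a := by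
      funext l
      rw [hh]; simp only [ha, vecMulVec_apply]
      field_simp
    rw [ha, this]
  have hne : ∀ u, u ≠ 0 → h u ≠ 0 := by
    intro u hu h0
    refine hM.bilin_ne_zero hu hv₀0 ?_
    rw [hhv, h0]; simp
  have hsub : ∀ u u' (c : ℝ), h (u - c • u') = h u - c • h u' := by
    intro u u' c
    funext l
    simp only [hh, map_sub, map_smul, LinearMap.sub_apply, LinearMap.smul_apply, Matrix.sub_apply,
      Matrix.smul_apply, Pi.sub_apply, Pi.smul_apply, smul_eq_mul]
    ring
  have hadd : ∀ u u', h (u + u') = h u + h u' := by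
    intro u u'
    have := hsub u u' (-1)
    simpa using this
  have hform : ∀ u v, ∃ g, bilin M u v = vecMulVec (h u) g := by
    intro u v
    by_cases hu : u = 0
    · exact ⟨0, by rw [hu, map_zero]; simp⟩
    obtain ⟨c, hc, hcv⟩ := hcol u hu
    obtain ⟨e, he⟩ := hcv v₀
    obtain ⟨μ, rfl⟩ := vecMulVec_parallel ((hhv u).symm.trans he)
      (by rw [← hhv]; exact hM.bilin_ne_zero hu hv₀0)
    obtain ⟨f, hf⟩ := hcv v
    exact ⟨μ • f, by rw [hf, smul_vecMulVec, vecMulVec_smul]⟩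
  obtain ⟨m, hm⟩ := Function.ne_iff.mp (hne v₀ hv₀0)
  simp only [Pi.zero_apply] at hm
  set g : (Fin q → ℝ) → (Fin q → ℝ) := fun v => fun l => bilin M v₀ v m l / h v₀ m with hg
  have hgv : ∀ v, bilin M v₀ v = vecMulVec (h v₀) (g v) := by
    intro v
    obtain ⟨a, ha⟩ := hform v₀ v
    have : g v = a := by
      funext l
      rw [hg]; simp only [ha, vecMulVec_apply]
      field_simp
    rw [ha, this]
  have hmain : ∀ u v, bilin M u v = vecMulVec (h u) (g v) := by
    intro u v
    -- If `h u` is parallel to `h v₀`, injectivity makes `u` parallel to `v₀`. Otherwise the columns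
    -- are independent, and comparing with `u + v₀` forces the two rows to agree.
    by_cases hpar : ∀ s t, h v₀ s * h u t - h v₀ t * h u s = 0
    · obtain ⟨μ, hμ⟩ := exists_smul_of_minors (hne v₀ hv₀0) hpar
      have h0 : u - μ • v₀ = 0 := by
        by_contra hc
        refine hne _ hc ?_
        rw [hsub, hμ, sub_self]
      have hu : u = μ • v₀ := sub_eq_zero.mp h0
      rw [hμ, hu, map_smul, LinearMap.smul_apply, hgv, smul_vecMulVec]
    · push Not at hpar
      obtain ⟨s, t, hst⟩ := hpar
      obtain ⟨x, hx⟩ := hform u v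
      obtain ⟨y, hy⟩ := hform (u + v₀) v
      have heq : vecMulVec (h u) x + vecMulVec (h v₀) (g v) = vecMulVec (h u + h v₀) y := by
        rw [← hx, ← hgv, ← hadd, ← hy, map_add, LinearMap.add_apply]
      rw [hx]
      congr 1
      funext l
      have e1 := congrFun (congrFun heq s) l
      have e2 := congrFun (congrFun heq t) l
      simp only [Matrix.add_apply, vecMulVec_apply, Pi.add_apply] at e1 e2
      have e3 : (h v₀ s * h u t - h v₀ t * h u s) * (x l - y l) = 0 := by
        linear_combination h v₀ s * e2 - h v₀ t * e1
      have e4 : (h v₀ s * h u t - h v₀ t * h u s) * (g v l - y l) = 0 := by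
        linear_combination h u t * e1 - h u s * e2
      have e5 := (mul_eq_zero.mp e3).resolve_left hst
      have e6 := (mul_eq_zero.mp e4).resolve_left hst
      linarith
  -- the two factors are linear
  set A : Matrix (Fin q) (Fin q) ℝ := Matrix.of fun a b => h (Pi.single b 1) a with hA
  set B : Matrix (Fin q) (Fin q) ℝ := Matrix.of fun a b => g (Pi.single a 1) b with hB
  have hMeq : M = sandwich A B := by
    ext X : 1
    rw [← sum_single_eq X, map_sum, map_sum]
    refine Finset.sum_congr rfl fun p _ => ?_
    rw [map_smul, map_smul]
    congr 1
    refine toMat_injective ?_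
    have e1 : EuclideanSpace.single p (1 : ℝ) =
        ofMat (vecMulVec (Pi.single p.1 1) (Pi.single p.2 1)) := by
      refine toMat_injective ?_
      ext a b
      rw [toMat_apply, toMat_ofMat]
      by_cases h : a = p.1 <;> by_cases h' : b = p.2 <;>
        simp [Matrix.vecMulVec_apply, h, h', Prod.ext_iff]
    rw [e1, ← bilin_apply, hmain, toMat_sandwich, toMat_ofMat]
    have e2 : A.mulVec (Pi.single p.1 1) = h (Pi.single p.1 1) := by
      funext a; simp [hA]
    have e3 : (Pi.single p.2 (1 : ℝ)) ᵥ* B = g (Pi.single p.2 1) := by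
      funext a; simp [hB]
    rw [Matrix.mul_vecMulVec, Matrix.vecMulVec_mul, e2, e3]
  have hb : ∀ u v, bilin M u v = vecMulVec (A.mulVec u) (v ᵥ* B) := by
    intro u v
    rw [bilin_apply, hMeq, toMat_sandwich, toMat_ofMat, Matrix.mul_vecMulVec,
      Matrix.vecMulVec_mul]
  refine ⟨A, B, ?_, ?_, hMeq⟩
  · refine isUnit_of_mulVec_injective fun u hu => ?_
    by_contra hc
    refine hM.bilin_ne_zero hc hv₀0 ?_
    rw [hb, hu]; simp
  · rw [← Matrix.isUnit_transpose]
    refine isUnit_of_mulVec_injective fun v hv => ?_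
    by_contra hc
    refine hM.bilin_ne_zero hv₀0 hc ?_
    rw [hb, ← Matrix.mulVec_transpose, hv]; simp

/-- Linear rank-preservers are two-sided multiplications, up to a transposition. -/
theorem IsRankPreserver.exists_sandwich (hM : IsRankPreserver M) (hq : 2 ≤ q) :
    ∃ A B, IsUnit A ∧ IsUnit B ∧
      (M = sandwich A B ∨ M = (sandwich A B).comp (transposeOp q)) := by
  have : Nonempty (Fin q) := ⟨⟨0, by omega⟩⟩
  let i : Fin q := ⟨0, by omega⟩
  set u₀ : Fin q → ℝ := Pi.single i 1 with hu₀
  have hu₀0 : u₀ ≠ 0 := by simp [hu₀]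
  rcases common_column_or_row (bilin M u₀) (hM.bilin_eq u₀) (fun v hv => by
    by_contra hne; exact hM.bilin_ne_zero hu₀0 hne hv) with h | ⟨b, hb, h⟩
  · obtain ⟨A, B, hA, hB, h⟩ := HasColumnType.exists_sandwich hM hq hu₀0 h
    exact ⟨A, B, hA, hB, Or.inl h⟩
  -- Transposing the output exchanges the row case with the column case.
  · set M' := (transposeOp q).comp M with hM'
    have hMr : IsRankPreserver M' := fun X => by
      rw [hM', ContinuousLinearMap.comp_apply, rank_transposeOp, hM]
    have hc : HasColumnType M' u₀ := by
      refine ⟨b, hb, fun v => ?_⟩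
      obtain ⟨a, ha⟩ := h v
      refine ⟨a, ?_⟩
      rw [bilin_apply, hM', ContinuousLinearMap.comp_apply, toMat_transposeOp, ← bilin_apply, ha,
        Matrix.transpose_vecMulVec]
    obtain ⟨A, B, hA, hB, h⟩ := HasColumnType.exists_sandwich hMr hq hu₀0 hc
    refine ⟨B.transpose, A.transpose, (Matrix.isUnit_transpose B).mpr hB,
      (Matrix.isUnit_transpose A).mpr hA, Or.inr ?_⟩
    ext X : 1
    have h1 : M X = transposeOp q (M' X) := by
      rw [hM', ContinuousLinearMap.comp_apply, transposeOp_transposeOp]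
    rw [h1, h]
    exact toMat_injective (by simp [mul_assoc])

end

/-! ### Quadratic forms of symmetric matrices -/

section
open Matrix

lemma dotProduct_self_eq (x : Fin q → ℝ) : x ⬝ᵥ x = ‖WithLp.toLp 2 x‖ ^ 2 := by
  rw [EuclideanSpace.norm_sq_eq]; simp [dotProduct, sq]

lemma dotProduct_self_nonneg' (x : Fin q → ℝ) : 0 ≤ x ⬝ᵥ x := by
  rw [dotProduct_self_eq]; positivity

lemma isHermitian_iff_transpose {A : Matrix (Fin q) (Fin q) ℝ} :
    A.IsHermitian ↔ A.transpose = A := by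
  rw [Matrix.IsHermitian, Matrix.conjTranspose_eq_transpose_of_trivial]

lemma quadratic_eq_sum {X : Matrix (Fin q) (Fin q) ℝ} (hX : X.IsHermitian) (w : Fin q → ℝ) :
    w ⬝ᵥ X *ᵥ w = ∑ k, hX.eigenvalues k * ((hX.eigenvectorBasis k).ofLp ⬝ᵥ w) ^ 2 := by
  have h1 := hX.eigenvectorBasis.sum_inner_mul_inner (WithLp.toLp 2 w) (WithLp.toLp 2 (X *ᵥ w))
  have h2 : ⟪(WithLp.toLp 2 w : EuclideanSpace ℝ (Fin q)), WithLp.toLp 2 (X *ᵥ w)⟫_ℝ =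
      w ⬝ᵥ X *ᵥ w := by
    rw [EuclideanSpace.inner_eq_star_dotProduct]; simp [dotProduct_comm]
  rw [← h2, ← h1]
  refine Finset.sum_congr rfl fun k _ => ?_
  have h3 : ⟪hX.eigenvectorBasis k, WithLp.toLp 2 (X *ᵥ w)⟫_ℝ =
      hX.eigenvalues k * ((hX.eigenvectorBasis k).ofLp ⬝ᵥ w) := by
    rw [EuclideanSpace.inner_eq_star_dotProduct]
    simp only [star_trivial]
    have e1 := hX.mulVec_eigenvectorBasis k
    rw [dotProduct_comm, Matrix.dotProduct_mulVec, ← Matrix.mulVec_transpose,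
      isHermitian_iff_transpose.mp hX, e1, smul_dotProduct, smul_eq_mul]
  have h4 : ⟪(WithLp.toLp 2 w : EuclideanSpace ℝ (Fin q)), hX.eigenvectorBasis k⟫_ℝ =
      (hX.eigenvectorBasis k).ofLp ⬝ᵥ w := by
    rw [EuclideanSpace.inner_eq_star_dotProduct]; simp
  rw [h3, h4]; ring

lemma eigenvector_dotProduct {X : Matrix (Fin q) (Fin q) ℝ} (hX : X.IsHermitian) (k : Fin q) :
    (hX.eigenvectorBasis k).ofLp ⬝ᵥ (hX.eigenvectorBasis k).ofLp = 1 := by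
  rw [dotProduct_self_eq]
  have := hX.eigenvectorBasis.norm_eq_one k
  simp [this]

lemma abs_eigenvalue_le {X : Matrix (Fin q) (Fin q) ℝ} (hX : X.IsHermitian) (k : Fin q) :
    |hX.eigenvalues k| ≤ ‖X‖ := by
  have h1 : ‖(WithLp.toLp 2 (X *ᵥ (hX.eigenvectorBasis k).ofLp) : EuclideanSpace ℝ (Fin q))‖ ≤
      ‖X‖ * ‖hX.eigenvectorBasis k‖ := Matrix.l2_opNorm_mulVec X _
  have h2 : (WithLp.toLp 2 (X *ᵥ (hX.eigenvectorBasis k).ofLp) : EuclideanSpace ℝ (Fin q)) =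
      hX.eigenvalues k • hX.eigenvectorBasis k := by
    rw [hX.mulVec_eigenvectorBasis k]; simp
  rw [h2, norm_smul, hX.eigenvectorBasis.norm_eq_one, mul_one, mul_one] at h1
  exact h1

lemma norm_le_of_quadratic {X : Matrix (Fin q) (Fin q) ℝ} (hX : X.IsHermitian) {c : ℝ}
    (hc : 0 ≤ c) (h : ∀ y : Fin q → ℝ, |y ⬝ᵥ X *ᵥ y| ≤ c * (y ⬝ᵥ y)) : ‖X‖ ≤ c := by
  have hsa : IsSelfAdjoint X := hX
  rw [← cfc_id' ℝ X]
  refine norm_cfc_le hc fun x hx => ?_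
  rw [hX.spectrum_real_eq_range_eigenvalues] at hx
  obtain ⟨k, rfl⟩ := hx
  have h1 := h (hX.eigenvectorBasis k).ofLp
  rw [hX.mulVec_eigenvectorBasis k, dotProduct_smul, eigenvector_dotProduct, mul_one, smul_eq_mul,
    mul_one] at h1
  exact h1

lemma abs_trace_le (X : Matrix (Fin q) (Fin q) ℝ) : |X.trace| ≤ q * ‖X‖ := by
  rw [Matrix.trace]
  refine (Finset.abs_sum_le_sum_abs _ _).trans ?_
  calc _ ≤ ∑ i : Fin q, ‖X‖ := Finset.sum_le_sum fun i _ => ?_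
    _ = _ := by simp
  have h1 := (Matrix.l2_opNorm_mulVec X (EuclideanSpace.single i (1 : ℝ)))
  have h2 := PiLp.norm_apply_le
    ((WithLp.toLp 2 (X.mulVec (EuclideanSpace.single i (1 : ℝ)).ofLp) : EuclideanSpace ℝ (Fin q)))
    i
  simpa using h2.trans h1

/-! ### Completely positive maps close to the depolarizing map -/

/-- The operator `X ↦ (1 / q) ∑ᵢ aᵢ X aᵢ'`. -/
def rowOp (a : Fin d → Matrix (Fin q) (Fin q) ℝ) (X : Matrix (Fin q) (Fin q) ℝ) :
    Matrix (Fin q) (Fin q) ℝ := (q : ℝ)⁻¹ • ∑ i, a i * X * (a i).transpose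

/-- The family of transposes. -/
def transposeFamily (a : Fin d → Matrix (Fin q) (Fin q) ℝ) : Fin d → Matrix (Fin q) (Fin q) ℝ :=
  fun i => (a i).transpose

/-- The operator `X ↦ (1 / q) ∑ᵢ aᵢ' X aᵢ`. -/
def colOp (a : Fin d → Matrix (Fin q) (Fin q) ℝ) : Matrix (Fin q) (Fin q) ℝ →
    Matrix (Fin q) (Fin q) ℝ := rowOp (transposeFamily a)

@[simp] lemma transposeFamily_transposeFamily (a : Fin d → Matrix (Fin q) (Fin q) ℝ) :
    transposeFamily (transposeFamily a) = a := by
  funext i; simp [transposeFamily]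

lemma colOp_transposeFamily (a : Fin d → Matrix (Fin q) (Fin q) ℝ) :
    colOp (transposeFamily a) = rowOp a := by
  rw [colOp, transposeFamily_transposeFamily]

/-- The map with components `aᵢ` is nearly isometric on rank-one matrices. -/
def IsNearIso (δ : ℝ) (a : Fin d → Matrix (Fin q) (Fin q) ℝ) : Prop :=
  ∀ x y : Fin q → ℝ, |∑ i, (y ⬝ᵥ a i *ᵥ x) ^ 2 - (y ⬝ᵥ y) * (x ⬝ᵥ x)| ≤
    δ * ((y ⬝ᵥ y) * (x ⬝ᵥ x))

lemma IsNearIso.transpose {δ : ℝ} {a : Fin d → Matrix (Fin q) (Fin q) ℝ} (h : IsNearIso δ a) :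
    IsNearIso δ (transposeFamily a) := by
  intro x y
  have := h y x
  rw [mul_comm (x ⬝ᵥ x)] at this
  convert this using 5 with i
  rw [transposeFamily, Matrix.mulVec_transpose, dotProduct_comm, Matrix.dotProduct_mulVec]

variable {a : Fin d → Matrix (Fin q) (Fin q) ℝ} {δ : ℝ}

lemma rowOp_sub (X Y : Matrix (Fin q) (Fin q) ℝ) : rowOp a (X - Y) = rowOp a X - rowOp a Y := by
  simp [rowOp, mul_sub, sub_mul, Finset.sum_sub_distrib, smul_sub]

lemma rowOp_isHermitian {X : Matrix (Fin q) (Fin q) ℝ} (hX : X.IsHermitian) :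
    (rowOp a X).IsHermitian := by
  rw [isHermitian_iff_transpose] at hX ⊢
  simp only [rowOp, Matrix.transpose_smul, Matrix.transpose_sum, Matrix.transpose_mul, hX,
    Matrix.transpose_transpose, mul_assoc]

lemma trace_rowOp_one : (rowOp a 1).trace = (colOp a 1).trace := by
  simp only [colOp, rowOp, transposeFamily, Matrix.trace_smul, Matrix.trace_sum, mul_one,
    Matrix.transpose_transpose]
  congr 1
  exact Finset.sum_congr rfl fun i _ => Matrix.trace_mul_comm _ _

lemma quadratic_rowOp (X : Matrix (Fin q) (Fin q) ℝ) (y : Fin q → ℝ) :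
    y ⬝ᵥ rowOp a X *ᵥ y =
      (q : ℝ)⁻¹ * ∑ i, ((a i).transpose *ᵥ y) ⬝ᵥ X *ᵥ ((a i).transpose *ᵥ y) := by
  rw [rowOp, Matrix.smul_mulVec, dotProduct_smul, smul_eq_mul, Matrix.sum_mulVec,
    dotProduct_sum]
  congr 1
  refine Finset.sum_congr rfl fun i _ => ?_
  rw [← Matrix.mulVec_mulVec, ← Matrix.mulVec_mulVec, Matrix.dotProduct_mulVec,
    Matrix.mulVec_transpose]

/-- Expand `X` in eigenvectors: the near-isometry hypothesis is then applied to each rank-one pair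
of `y` and an eigenvector, weighted by the eigenvalue. -/
lemma IsNearIso.abs_quadratic_le (h : IsNearIso δ a) {X : Matrix (Fin q) (Fin q) ℝ}
    (hX : X.IsHermitian) (y : Fin q → ℝ) :
    |y ⬝ᵥ (rowOp a X - (X.trace / q) • 1) *ᵥ y| ≤
      δ * ((q : ℝ)⁻¹ * ∑ k, |hX.eigenvalues k|) * (y ⬝ᵥ y) := by
  have htr : X.trace = ∑ k, hX.eigenvalues k := by
    have := hX.trace_eq_sum_eigenvalues
    simpa using this
  have h1 : y ⬝ᵥ (rowOp a X - (X.trace / q) • 1) *ᵥ y = (q : ℝ)⁻¹ * ∑ k, hX.eigenvalues k *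
      (∑ i, (y ⬝ᵥ a i *ᵥ (hX.eigenvectorBasis k).ofLp) ^ 2 - y ⬝ᵥ y) := by
    rw [Matrix.sub_mulVec, dotProduct_sub, quadratic_rowOp, Matrix.smul_mulVec, Matrix.one_mulVec,
      dotProduct_smul, smul_eq_mul, htr, div_eq_inv_mul, mul_assoc, ← mul_sub]
    congr 1
    simp only [quadratic_eq_sum hX, mul_sub, Finset.sum_sub_distrib, Finset.sum_mul]
    rw [Finset.sum_comm]
    congr 1
    refine Finset.sum_congr rfl fun k _ => ?_
    rw [Finset.mul_sum]
    refine Finset.sum_congr rfl fun i _ => ?_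
    congr 2
    rw [Matrix.mulVec_transpose, dotProduct_comm, Matrix.dotProduct_mulVec]
  rw [h1, abs_mul, abs_of_nonneg (by positivity : (0 : ℝ) ≤ (q : ℝ)⁻¹)]
  calc _ ≤ (q : ℝ)⁻¹ * ∑ k, |hX.eigenvalues k| * (δ * (y ⬝ᵥ y)) := by
        refine mul_le_mul_of_nonneg_left ((Finset.abs_sum_le_sum_abs _ _).trans
          (Finset.sum_le_sum fun k _ => ?_)) (by positivity)
        rw [abs_mul]
        refine mul_le_mul_of_nonneg_left ?_ (abs_nonneg _)
        have := h (hX.eigenvectorBasis k).ofLp y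
        rwa [eigenvector_dotProduct, mul_one] at this
    _ = _ := by rw [← Finset.sum_mul]; ring

lemma isHermitian_smul_one (c : ℝ) : (c • (1 : Matrix (Fin q) (Fin q) ℝ)).IsHermitian := by
  rw [isHermitian_iff_transpose]; simp

/-- The operator is close to complete depolarization on symmetric matrices. Hence it nearly
annihilates traceless ones, the source of all contraction in the normalization step. -/
lemma IsNearIso.norm_rowOp_sub_le (h : IsNearIso δ a) (hδ : 0 ≤ δ) {X : Matrix (Fin q) (Fin q) ℝ}
    (hX : X.IsHermitian) : ‖rowOp a X - (X.trace / q) • 1‖ ≤ δ * ‖X‖ := by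
  refine norm_le_of_quadratic ((rowOp_isHermitian hX).sub (isHermitian_smul_one _))
    (by positivity) fun y => (h.abs_quadratic_le hX y).trans ?_
  refine mul_le_mul_of_nonneg_right (mul_le_mul_of_nonneg_left ?_ hδ) (dotProduct_self_nonneg' y)
  rcases Nat.eq_zero_or_pos q with h0 | h0
  · subst h0; simp
  calc (q : ℝ)⁻¹ * ∑ k, |hX.eigenvalues k| ≤ (q : ℝ)⁻¹ * ∑ k : Fin q, ‖X‖ :=
        mul_le_mul_of_nonneg_left (Finset.sum_le_sum fun k _ => abs_eigenvalue_le hX k)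
          (by positivity)
    _ = ‖X‖ := by simp; field_simp

/-- For positive semidefinite `X` the eigenvalues sum absolutely to the trace, so the error is
controlled by the trace alone, without any bound on `‖X‖`. -/
lemma IsNearIso.norm_rowOp_sub_le_of_posSemidef (h : IsNearIso δ a) (hδ : 0 ≤ δ)
    {X : Matrix (Fin q) (Fin q) ℝ} (hX : X.PosSemidef) :
    ‖rowOp a X - (X.trace / q) • 1‖ ≤ δ * (X.trace / q) := by
  have htr : X.trace = ∑ k, hX.isHermitian.eigenvalues k := by
    have := hX.isHermitian.trace_eq_sum_eigenvalues
    simpa using this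
  have h0 : 0 ≤ X.trace := by
    rw [htr]; exact Finset.sum_nonneg fun k _ => hX.eigenvalues_nonneg k
  refine norm_le_of_quadratic ((rowOp_isHermitian hX.isHermitian).sub (isHermitian_smul_one _))
    (by positivity) fun y => (h.abs_quadratic_le hX.isHermitian y).trans_eq ?_
  simp only [abs_of_nonneg (hX.eigenvalues_nonneg _)]
  rw [htr, div_eq_inv_mul]

lemma IsNearIso.norm_rowOp_le_of_trace (h : IsNearIso δ a) (hδ : 0 ≤ δ)
    {X : Matrix (Fin q) (Fin q) ℝ} (hX : X.IsHermitian) (htr : X.trace = 0) :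
    ‖rowOp a X‖ ≤ δ * ‖X‖ := by
  have := h.norm_rowOp_sub_le hδ hX
  rwa [htr, zero_div, zero_smul, sub_zero] at this

lemma IsNearIso.norm_rowOp_le (h : IsNearIso δ a) (hδ : 0 ≤ δ)
    {X : Matrix (Fin q) (Fin q) ℝ} (hX : X.IsHermitian) : ‖rowOp a X‖ ≤ (1 + δ) * ‖X‖ := by
  have h1 := h.norm_rowOp_sub_le hδ hX
  have h2 : ‖(X.trace / q) • (1 : Matrix (Fin q) (Fin q) ℝ)‖ ≤ ‖X‖ := by
    rw [norm_smul, Real.norm_eq_abs, abs_div, Nat.abs_cast]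
    rcases Nat.eq_zero_or_pos q with h0 | h0
    · subst h0; simp
    have h3 : |X.trace| / q ≤ ‖X‖ := by
      rw [div_le_iff₀ (by exact_mod_cast h0), mul_comm]
      exact abs_trace_le X
    calc _ ≤ ‖X‖ * 1 := mul_le_mul h3 norm_one_le (norm_nonneg _) (norm_nonneg _)
      _ = _ := mul_one _
  have h3 := norm_add_le (rowOp a X - (X.trace / q) • 1) ((X.trace / q) • 1)
  rw [sub_add_cancel] at h3
  linarith

lemma norm_sub_one_le_of_mul_eq_one {P R : Matrix (Fin q) (Fin q) ℝ} (h : P * R = 1) {β : ℝ}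
    (hR : ‖R - 1‖ ≤ β) (hβ : β < 1) : ‖P - 1‖ ≤ β / (1 - β) := by
  have h1 : P - 1 = -((P - 1) * (R - 1)) - (R - 1) := by
    calc P - 1 = -(P * R) + P + R - R := by rw [h]; abel
      _ = _ := by noncomm_ring
  have h2 : ‖P - 1‖ ≤ ‖P - 1‖ * β + β := by
    conv_lhs => rw [h1]
    refine (norm_sub_le _ _).trans (add_le_add ?_ hR)
    rw [norm_neg]
    exact (norm_mul_le _ _).trans (mul_le_mul_of_nonneg_left hR (norm_nonneg _))
  rw [le_div_iff₀ (by linarith)]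
  linarith

lemma transpose_sub_one {A : Matrix (Fin q) (Fin q) ℝ} (hA : A.IsHermitian) :
    (A - 1).IsHermitian := hA.sub Matrix.isHermitian_one

lemma rowOp_sandwich (b : Fin d → Matrix (Fin q) (Fin q) ℝ) (U V X : Matrix (Fin q) (Fin q) ℝ) :
    rowOp (fun i => U * b i * V) X = U * rowOp b (V * X * V.transpose) * U.transpose := by
  simp only [rowOp, Matrix.transpose_mul]
  rw [Matrix.mul_smul, Matrix.smul_mul, Finset.mul_sum, Finset.sum_mul]
  congr 1
  exact Finset.sum_congr rfl fun i _ => by simp only [mul_assoc]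

lemma colOp_sandwich (b : Fin d → Matrix (Fin q) (Fin q) ℝ) (U V X : Matrix (Fin q) (Fin q) ℝ) :
    colOp (fun i => U * b i * V) X = V.transpose * colOp b (U.transpose * X * U) * V := by
  have : transposeFamily (fun i => U * b i * V) =
      fun i => V.transpose * transposeFamily b i * U.transpose := by
    funext i; simp [transposeFamily, mul_assoc]
  rw [colOp, this, rowOp_sandwich]
  simp [colOp]

lemma rowOp_smul (k : ℝ) (X : Matrix (Fin q) (Fin q) ℝ) : rowOp a (k • X) = k • rowOp a X := by
  simp only [rowOp, Matrix.mul_smul, Matrix.smul_mul, ← Finset.smul_sum, smul_comm k]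

/-- If both a family and its two-sided multiple are (nearly) normalized, then the factors are nearly
orthogonal after a rescaling. -/
lemma exists_nearly_orthogonal {b : Fin d → Matrix (Fin q) (Fin q) ℝ} {η : ℝ} (hq : 1 ≤ q)
    (hb : IsNearIso 0.06 b) (hη : η ≤ 1 / 1000) (hrow : ‖rowOp b 1 - 1‖ ≤ η)
    (hcol : ‖colOp b 1 - 1‖ ≤ η) {U V : Matrix (Fin q) (Fin q) ℝ} (hV : IsUnit V)
    (hrow' : rowOp (fun i => U.transpose * b i * V.transpose) 1 = 1)
    (hcol' : colOp (fun i => U.transpose * b i * V.transpose) 1 = 1) :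
    ∃ c : ℝ, 0 < c ∧ ‖(c⁻¹ • U) * (c⁻¹ • U).transpose - 1‖ ≤ 3 * η ∧
      ‖(c • V).transpose * (c • V) - 1‖ ≤ 3 * η := by
  have hq0 : (0 : ℝ) < q := by exact_mod_cast hq
  have : Nonempty (Fin q) := ⟨⟨0, hq⟩⟩
  set t := (V.transpose * V).trace with ht
  have ht0 : 0 < t := by
    have hps : (V.transpose * V).PosDef := by
      rw [← Matrix.conjTranspose_eq_transpose_of_trivial]
      exact Matrix.PosDef.conjTranspose_mul_self V (Matrix.mulVec_injective_of_isUnit hV)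
    exact hps.trace_pos
  -- The scalar is chosen so that `A = c² Vᵀ V` has trace `q`; then `A - 1` is traceless.
  set c := √(q / t) with hc
  have hc0 : 0 < c := Real.sqrt_pos.mpr (by positivity)
  have hc2 : c ^ 2 = q / t := Real.sq_sqrt (by positivity)
  set A := (c • V).transpose * (c • V) with hA
  set P := (c⁻¹ • U) * (c⁻¹ • U).transpose with hP
  have hA' : A = c ^ 2 • (V.transpose * V) := by
    rw [hA, Matrix.transpose_smul, smul_mul_smul_comm, ← sq]
  have hP' : P = (c⁻¹) ^ 2 • (U * U.transpose) := by
    rw [hP, Matrix.transpose_smul, smul_mul_smul_comm, ← sq]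
  have hAtr : A.trace = q := by
    rw [hA', Matrix.trace_smul, smul_eq_mul, ← ht, hc2]; field_simp
  have hAh : A.IsHermitian := by rw [isHermitian_iff_transpose, hA]; simp
  have hPh : P.IsHermitian := by rw [isHermitian_iff_transpose, hP]; simp
  have hAps : A.PosSemidef := by
    rw [hA, ← Matrix.conjTranspose_eq_transpose_of_trivial]
    exact Matrix.posSemidef_conjTranspose_mul_self _
  have hcc : (c⁻¹) ^ 2 * c ^ 2 = 1 := by field_simp
  have hPR : P * rowOp b A = 1 := by
    rw [hA', hP', rowOp_smul, smul_mul_smul_comm, hcc, one_smul]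
    rw [rowOp_sandwich, mul_one, Matrix.transpose_transpose, Matrix.transpose_transpose] at hrow'
    have h1 := mul_eq_one_comm.mp hrow'
    rw [mul_assoc]
    calc _ = U * (U.transpose * rowOp b (V.transpose * V)) := rfl
      _ = 1 := h1
  have hAQ : A * colOp b P = 1 := by
    rw [hA', hP', colOp, rowOp_smul, smul_mul_smul_comm, mul_comm, hcc, one_smul]
    rw [colOp_sandwich, mul_one, Matrix.transpose_transpose, Matrix.transpose_transpose] at hcol'
    have h1 : V.transpose * (V * colOp b (U * U.transpose)) = 1 := mul_eq_one_comm.mp hcol'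
    rw [mul_assoc]; exact h1
  -- coarse bounds
  have hA1 : (A - 1).trace = 0 := by rw [Matrix.trace_sub, hAtr]; simp
  -- Nothing is known about the closeness of `A` to 1 yet; positivity and the trace suffice to start
  -- the argument.
  have hR0 : ‖rowOp b A - 1‖ ≤ 0.06 := by
    have := hb.norm_rowOp_sub_le_of_posSemidef (by norm_num) hAps
    rwa [hAtr, div_self hq0.ne', one_smul, mul_one] at this
  have hP0 := norm_sub_one_le_of_mul_eq_one hPR hR0 (by norm_num)
  have hη0 : 0 ≤ η := (norm_nonneg _).trans hrow
  have hQ : ‖colOp b P - 1‖ ≤ η + 1.06 * ‖P - 1‖ := by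
    have h1 : colOp b P - 1 = (colOp b 1 - 1) + colOp b (P - 1) := by
      rw [colOp, rowOp_sub]; abel
    rw [h1]
    refine (norm_add_le _ _).trans (add_le_add hcol ?_)
    have := hb.transpose.norm_rowOp_le (by norm_num) (transpose_sub_one hPh)
    norm_num at this ⊢
    exact this
  have hQ0 : ‖colOp b P - 1‖ ≤ 0.07 := by
    refine hQ.trans ?_
    norm_num at hP0 ⊢
    linarith
  have hR1 : ‖rowOp b A - 1‖ ≤ η + 0.06 * ‖A - 1‖ := by
    have h1 : rowOp b A - 1 = (rowOp b 1 - 1) + rowOp b (A - 1) := by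
      rw [rowOp_sub]; abel
    rw [h1]
    exact (norm_add_le _ _).trans (add_le_add hrow
      (hb.norm_rowOp_le_of_trace (by norm_num) (transpose_sub_one hAh) hA1))
  -- refined bounds
  have hP1 : ‖P - 1‖ ≤ 1.07 * ‖rowOp b A - 1‖ := by
    refine (norm_sub_one_le_of_mul_eq_one hPR le_rfl (by linarith)).trans ?_
    rw [div_le_iff₀ (by linarith)]
    nlinarith [norm_nonneg (rowOp b A - 1)]
  have hA2 : ‖A - 1‖ ≤ 1.08 * ‖colOp b P - 1‖ := by
    refine (norm_sub_one_le_of_mul_eq_one hAQ le_rfl (by linarith)).trans ?_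
    rw [div_le_iff₀ (by linarith)]
    nlinarith [norm_nonneg (colOp b P - 1)]
  -- The bounds close up: the error of `A` is at most `1.08 (η + 1.06 * 1.07 (η + 0.06 ‖A - 1‖))`,
  -- where the coefficient of `‖A - 1‖` is well below 1.
  refine ⟨c, hc0, ?_, ?_⟩ <;> linarith

end

/-! ### Operator Sinkhorn iteration -/

section
open Matrix

lemma abs_sub_one_le_of_mem_spectrum {R : Matrix (Fin q) (Fin q) ℝ} (hR : R.IsHermitian) {x : ℝ}
    (hx : x ∈ spectrum ℝ R) : |x - 1| ≤ ‖R - 1‖ := by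
  rw [hR.spectrum_real_eq_range_eigenvalues] at hx
  obtain ⟨k, rfl⟩ := hx
  have h1 : ‖(WithLp.toLp 2 ((R - 1) *ᵥ (hR.eigenvectorBasis k).ofLp) : EuclideanSpace ℝ (Fin q))‖ ≤
      ‖R - 1‖ * ‖hR.eigenvectorBasis k‖ := Matrix.l2_opNorm_mulVec _ _
  have h2 : (WithLp.toLp 2 ((R - 1) *ᵥ (hR.eigenvectorBasis k).ofLp) : EuclideanSpace ℝ (Fin q)) =
      (hR.eigenvalues k - 1) • hR.eigenvectorBasis k := by
    rw [Matrix.sub_mulVec, hR.mulVec_eigenvectorBasis k, Matrix.one_mulVec, sub_smul, one_smul]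
    rfl
  rw [h2, norm_smul, hR.eigenvectorBasis.norm_eq_one, mul_one, mul_one] at h1
  exact h1

/-- `x^(-1/2) - 1 = (1 - x) / (√x + x)`, and the denominator is at least 1 in this range. -/
lemma abs_inv_sqrt_sub_one_le {x κ : ℝ} (hx : |x - 1| ≤ κ) (hκ : κ ≤ 1 / 2) :
    |(√x)⁻¹ - 1| ≤ κ := by
  have hx0 : 1 / 2 ≤ x := by linarith [(abs_le.mp hx).1]
  have hs : 1 / 2 < √x := by
    rw [Real.lt_sqrt (by norm_num)]; linarith
  have hs2 : √x * √x = x := Real.mul_self_sqrt (by linarith)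
  have h1 : ((√x)⁻¹ - 1) * (√x + x) = 1 - x := by
    have : (√x)⁻¹ * √x = 1 := inv_mul_cancel₀ (by positivity)
    calc _ = (√x)⁻¹ * √x + (√x)⁻¹ * √x * √x - √x - x := by rw [mul_assoc _ √x √x, hs2]; ring
      _ = _ := by rw [this]; ring
  have h2 : |(√x)⁻¹ - 1| * (√x + x) = |x - 1| := by
    rw [← abs_of_pos (by linarith : 0 < √x + x), ← abs_mul, h1, abs_sub_comm]
  nlinarith [abs_nonneg ((√x)⁻¹ - 1)]

lemma invSqrt_isHermitian (R : Matrix (Fin q) (Fin q) ℝ) : (invSqrt R).IsHermitian :=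
  cfc_predicate _ R

lemma invSqrt_mul_self_mul {R : Matrix (Fin q) (Fin q) ℝ} (hR : R.IsHermitian)
    (h : ‖R - 1‖ ≤ 1 / 2) : invSqrt R * invSqrt R * R = 1 := by
  have hsa : IsSelfAdjoint R := hR
  have e : ∀ f : ℝ → ℝ, cfc f R * R = cfc (fun x => f x * x) R := fun f => by
    rw [cfc_mul_finite, cfc_id' ℝ R]
  rw [invSqrt, ← cfc_mul_finite, e, ← cfc_const_one ℝ R]
  refine cfc_congr fun x hx => ?_
  have h1 := (abs_le.mp ((abs_sub_one_le_of_mem_spectrum hR hx).trans h)).1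
  have h2 : √x * √x = x := Real.mul_self_sqrt (by linarith)
  have h3 : 0 < √x := Real.sqrt_pos.mpr (by linarith)
  show (√x)⁻¹ * (√x)⁻¹ * x = 1
  nth_rw 3 [← h2]
  field_simp

lemma norm_invSqrt_sub_one_le {R : Matrix (Fin q) (Fin q) ℝ} (hR : R.IsHermitian)
    (h : ‖R - 1‖ ≤ 1 / 2) : ‖invSqrt R - 1‖ ≤ ‖R - 1‖ := by
  have hsa : IsSelfAdjoint R := hR
  rw [invSqrt, ← cfc_const_one ℝ R,
    ← cfc_sub _ _ R (continuousOn_spectrum _ _) (continuousOn_spectrum _ _)]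
  refine norm_cfc_le (norm_nonneg _) fun x hx => ?_
  rw [cfc_const_one ℝ R]
  exact abs_inv_sqrt_sub_one_le (abs_sub_one_le_of_mem_spectrum hR hx) h

lemma sqrt_smul_invSqrt_smul {k : ℝ} (hk : 0 < k) {R : Matrix (Fin q) (Fin q) ℝ}
    (hR : R.IsHermitian) : √k • invSqrt (k • R) = invSqrt R := by
  have hsa : IsSelfAdjoint R := hR
  have hf : ((fun x => k • x) '' spectrum ℝ R).Finite := Matrix.finite_real_spectrum.image _
  rw [invSqrt, invSqrt, ← cfc_comp_smul k _ R (hf.continuousOn _),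
    ← cfc_smul _ _ R (continuousOn_spectrum _ _)]
  refine cfc_congr fun x _ => ?_
  have : 0 < √k := Real.sqrt_pos.mpr hk
  simp only [smul_eq_mul]
  rw [Real.sqrt_mul hk.le, mul_inv, ← mul_assoc, mul_inv_cancel₀ this.ne', one_mul]

/-- The factor by which a pass of row normalization multiplies a family. -/
def rowFactor (a : Fin d → Matrix (Fin q) (Fin q) ℝ) : Matrix (Fin q) (Fin q) ℝ :=
  invSqrt (rowOp a 1)

/-- The factor by which a pass of column normalization multiplies a family. -/
def colFactor (a : Fin d → Matrix (Fin q) (Fin q) ℝ) : Matrix (Fin q) (Fin q) ℝ :=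
  invSqrt (colOp a 1)

lemma sinkhornRow_eq (hq : 1 ≤ q) (a : Fin d → Matrix (Fin q) (Fin q) ℝ) :
    sinkhornRow a = fun i => rowFactor a * a i := by
  have hq0 : (0 : ℝ) < q := by exact_mod_cast hq
  have h1 : ∑ k, a k * (a k).transpose = (q : ℝ) • rowOp a 1 := by
    simp [rowOp, smul_smul, hq0.ne']
  funext i
  rw [sinkhornRow, h1, ← smul_mul_assoc,
    sqrt_smul_invSqrt_smul hq0 (rowOp_isHermitian Matrix.isHermitian_one), rowFactor]

lemma sinkhornCol_eq (hq : 1 ≤ q) (a : Fin d → Matrix (Fin q) (Fin q) ℝ) :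
    sinkhornCol a = fun i => a i * colFactor a := by
  have hq0 : (0 : ℝ) < q := by exact_mod_cast hq
  have h1 : ∑ k, (a k).transpose * a k = (q : ℝ) • colOp a 1 := by
    simp [colOp, transposeFamily, rowOp, smul_smul, hq0.ne']
  funext i
  have h2 : (colOp a 1).IsHermitian := rowOp_isHermitian Matrix.isHermitian_one
  rw [sinkhornCol, h1, ← mul_smul_comm, sqrt_smul_invSqrt_smul hq0 h2, colFactor]

variable {a : Fin d → Matrix (Fin q) (Fin q) ℝ} {κ δ : ℝ}

lemma rowFactor_transpose (a : Fin d → Matrix (Fin q) (Fin q) ℝ) :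
    (rowFactor a).transpose = rowFactor a :=
  isHermitian_iff_transpose.mp (invSqrt_isHermitian _)

lemma rowOp_rowFactor (h : ‖rowOp a 1 - 1‖ ≤ 1 / 2) :
    rowOp (fun i => rowFactor a * a i) 1 = 1 := by
  have hR : (rowOp a 1).IsHermitian := rowOp_isHermitian Matrix.isHermitian_one
  have h0 := rowOp_sandwich a (rowFactor a) 1 1
  simp only [mul_one, Matrix.transpose_one] at h0
  rw [h0, rowFactor_transpose]
  have h1 := invSqrt_mul_self_mul hR h
  rw [mul_assoc, mul_eq_one_comm] at h1
  exact h1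

lemma norm_rowFactor_sub_one_le (h : ‖rowOp a 1 - 1‖ ≤ 1 / 2) :
    ‖rowFactor a - 1‖ ≤ ‖rowOp a 1 - 1‖ :=
  norm_invSqrt_sub_one_le (rowOp_isHermitian Matrix.isHermitian_one) h

lemma norm_rowFactor_sq_sub_one_le (h : ‖rowOp a 1 - 1‖ ≤ κ) (hκ : κ ≤ 1 / 100) :
    ‖rowFactor a * rowFactor a - 1‖ ≤ 1.02 * κ := by
  have hκ0 : 0 ≤ κ := (norm_nonneg _).trans h
  refine (norm_sub_one_le_of_mul_eq_one (invSqrt_mul_self_mul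
    (rowOp_isHermitian Matrix.isHermitian_one) (by linarith)) h (by linarith)).trans ?_
  rw [div_le_iff₀ (by linarith)]
  nlinarith

lemma colOp_rowFactor : colOp (fun i => rowFactor a * a i) 1 =
    colOp a (rowFactor a * rowFactor a) := by
  have h0 := colOp_sandwich a (rowFactor a) 1 1
  simp only [mul_one, Matrix.transpose_one, one_mul] at h0
  rw [h0, rowFactor_transpose]

lemma rowFactor_sq_isHermitian : (rowFactor a * rowFactor a).IsHermitian := by
  rw [isHermitian_iff_transpose, Matrix.transpose_mul,
    rowFactor_transpose]

lemma colOp_eq_add (X : Matrix (Fin q) (Fin q) ℝ) : colOp a X - 1 =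
    (colOp a 1 - 1) + colOp a (X - 1) := by
  rw [colOp, rowOp_sub]; abel

lemma norm_colOp_rowFactor_le (ha : IsNearIso 0.11 a) (h : ‖rowOp a 1 - 1‖ ≤ κ)
    (hκ : κ ≤ 1 / 100) (h' : ‖colOp a 1 - 1‖ ≤ κ) :
    ‖colOp (fun i => rowFactor a * a i) 1 - 1‖ ≤ 2.2 * κ := by
  have hκ0 : 0 ≤ κ := (norm_nonneg _).trans h
  rw [colOp_rowFactor, colOp_eq_add]
  have h1 : ‖colOp a (rowFactor a * rowFactor a - 1)‖ ≤ _ :=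
    ha.transpose.norm_rowOp_le (by norm_num) (transpose_sub_one rowFactor_sq_isHermitian)
  have h2 := norm_rowFactor_sq_sub_one_le h hκ
  have h3 := norm_add_le (colOp a 1 - 1) (colOp a (rowFactor a * rowFactor a - 1))
  linarith

/-- Row and column sums have the same trace, so once the columns are normalized the row defect `ρ`
is traceless. The squared row factor differs from 1 by `-ρ` up to a quadratic term, and `colOp`
contracts the traceless part. -/
lemma norm_colOp_rowFactor_le_of_eq (ha : IsNearIso 0.11 a) (h : ‖rowOp a 1 - 1‖ ≤ κ)
    (hκ : κ ≤ 1 / 100) (h' : colOp a 1 = 1) :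
    ‖colOp (fun i => rowFactor a * a i) 1 - 1‖ ≤ 0.15 * κ := by
  have hκ0 : 0 ≤ κ := (norm_nonneg _).trans h
  have hR : (rowOp a 1).IsHermitian := rowOp_isHermitian Matrix.isHermitian_one
  have h1 := invSqrt_mul_self_mul hR (h.trans (by linarith))
  set P := rowFactor a * rowFactor a with hP
  have hPh : P.IsHermitian := rowFactor_sq_isHermitian
  set ρ := rowOp a 1 - 1 with hρ
  set Q := (P - 1) * ρ with hQ
  have e1 : P - 1 = -ρ - Q := by
    have : P * rowOp a 1 = 1 := h1
    rw [hQ, hρ]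
    calc P - 1 = -(P * rowOp a 1) + P + rowOp a 1 - rowOp a 1 := by rw [this]; abel
      _ = _ := by noncomm_ring
  have hρh : ρ.IsHermitian := transpose_sub_one hR
  have hQh : Q.IsHermitian := by
    have : Q = -ρ - (P - 1) := by rw [e1]; abel
    rw [this]; exact hρh.neg.sub (transpose_sub_one hPh)
  have hρt : ρ.trace = 0 := by
    rw [hρ, Matrix.trace_sub, trace_rowOp_one, h', sub_self]
  have hn : colOp a (P - 1) = -colOp a ρ - colOp a Q := by
    rw [e1, colOp, rowOp_sub]
    congr 1
    have := rowOp_smul (a := transposeFamily a) (-1) ρ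
    simpa using this
  have b1 : ‖colOp a ρ‖ ≤ 0.11 * ‖ρ‖ :=
    ha.transpose.norm_rowOp_le_of_trace (by norm_num) hρh hρt
  have b2 : ‖colOp a Q‖ ≤ (1 + 0.11) * ‖Q‖ := ha.transpose.norm_rowOp_le (by norm_num) hQh
  have b3 : ‖Q‖ ≤ 1.02 * κ * κ :=
    (norm_mul_le _ _).trans (mul_le_mul (norm_rowFactor_sq_sub_one_le h hκ) h (norm_nonneg _)
      (by positivity))
  rw [colOp_rowFactor, colOp_eq_add, h', sub_self, zero_add, hn]
  have b4 := norm_sub_le (-colOp a ρ) (colOp a Q)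
  rw [norm_neg] at b4
  nlinarith

lemma norm_transpose_sub_one (G : Matrix (Fin q) (Fin q) ℝ) : ‖G.transpose - 1‖ = ‖G - 1‖ := by
  rw [← Matrix.l2_opNorm_conjTranspose (G - 1), Matrix.conjTranspose_eq_transpose_of_trivial]
  simp

lemma abs_dotProduct_mulVec_sub_le {H : Matrix (Fin q) (Fin q) ℝ} (h : ‖H - 1‖ ≤ 1 / 100)
    (x : Fin q → ℝ) : |(H *ᵥ x) ⬝ᵥ (H *ᵥ x) - x ⬝ᵥ x| ≤ 0.0201 * (x ⬝ᵥ x) := by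
  simp only [dotProduct_self_eq]
  have h1 : ‖(WithLp.toLp 2 ((H - 1) *ᵥ x) : EuclideanSpace ℝ (Fin q))‖ ≤
      ‖H - 1‖ * ‖(WithLp.toLp 2 x : EuclideanSpace ℝ (Fin q))‖ :=
    Matrix.l2_opNorm_mulVec _ (WithLp.toLp 2 x)
  have h2 : (WithLp.toLp 2 ((H - 1) *ᵥ x) : EuclideanSpace ℝ (Fin q)) =
      WithLp.toLp 2 (H *ᵥ x) - WithLp.toLp 2 x := by
    rw [Matrix.sub_mulVec, Matrix.one_mulVec]; rfl
  rw [h2] at h1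
  set u := ‖(WithLp.toLp 2 (H *ᵥ x) : EuclideanSpace ℝ (Fin q))‖
  set v := ‖(WithLp.toLp 2 x : EuclideanSpace ℝ (Fin q))‖
  have hv : 0 ≤ v := norm_nonneg _
  have hu : 0 ≤ u := norm_nonneg _
  have h3 : |u - v| ≤ 1 / 100 * v :=
    (abs_norm_sub_norm_le _ _).trans (h1.trans (mul_le_mul_of_nonneg_right h hv))
  obtain ⟨h4, h5⟩ := abs_le.mp h3
  rw [abs_le]
  constructor <;> nlinarith

lemma IsNearIso.mul_mul (ha : IsNearIso 0.06 a) {G H : Matrix (Fin q) (Fin q) ℝ}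
    (hG : ‖G - 1‖ ≤ 1 / 100) (hH : ‖H - 1‖ ≤ 1 / 100) :
    IsNearIso 0.11 (fun i => G * a i * H) := by
  intro x y
  have h1 := ha (H *ᵥ x) (G.transpose *ᵥ y)
  have h2 := abs_dotProduct_mulVec_sub_le hH x
  have h3 := abs_dotProduct_mulVec_sub_le ((norm_transpose_sub_one G).trans_le hG) y
  have e : ∀ i, y ⬝ᵥ (G * a i * H) *ᵥ x = (G.transpose *ᵥ y) ⬝ᵥ a i *ᵥ (H *ᵥ x) := by
    intro i
    rw [← Matrix.mulVec_mulVec, ← Matrix.mulVec_mulVec, Matrix.dotProduct_mulVec,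
      Matrix.mulVec_transpose]
  simp only [e]
  have hx := dotProduct_self_nonneg' x
  have hy := dotProduct_self_nonneg' y
  have hx' := dotProduct_self_nonneg' (H *ᵥ x)
  have hy' := dotProduct_self_nonneg' (G.transpose *ᵥ y)
  set X := x ⬝ᵥ x
  set Y := y ⬝ᵥ y
  set X' := (H *ᵥ x) ⬝ᵥ (H *ᵥ x)
  set Y' := (G.transpose *ᵥ y) ⬝ᵥ (G.transpose *ᵥ y)
  obtain ⟨x1, x2⟩ := abs_le.mp h2
  obtain ⟨y1, y2⟩ := abs_le.mp h3
  have u1 : Y' * X' ≤ (1.0201 * Y) * (1.0201 * X) :=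
    mul_le_mul (by linarith) (by linarith) hx' (by linarith)
  have u2 : (0.9799 * Y) * (0.9799 * X) ≤ Y' * X' :=
    mul_le_mul (by linarith) (by linarith) (by linarith) hy'
  have hXY : 0 ≤ Y * X := mul_nonneg hy hx
  obtain ⟨z1, z2⟩ := abs_le.mp h1
  rw [abs_le]
  constructor <;> nlinarith

/-- One pass of the iteration on a slightly scaled nearly isometric family. -/
lemma sinkhorn_pass (hq : 1 ≤ q) (ha : IsNearIso 0.06 a) {G H : Matrix (Fin q) (Fin q) ℝ}
    (hG : ‖G - 1‖ ≤ 1 / 200) (hH : ‖H - 1‖ ≤ 1 / 200) (hκ : κ ≤ 1 / 2000)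
    (hrow : ‖rowOp (fun i => G * a i * H) 1 - 1‖ ≤ κ)
    (hcol : ‖colOp (fun i => G * a i * H) 1 - 1‖ ≤ κ) :
    ∃ S T : Matrix (Fin q) (Fin q) ℝ, ‖S - 1‖ ≤ κ ∧ ‖T - 1‖ ≤ 3 * κ ∧
      sinkhornCol (sinkhornRow (fun i => G * a i * H)) =
        (fun i => (S * G) * a i * (H * T)) ∧
      ‖rowOp (fun i => (S * G) * a i * (H * T)) 1 - 1‖ ≤ κ / 2 ∧
      ‖colOp (fun i => (S * G) * a i * (H * T)) 1 - 1‖ ≤ κ / 2 ∧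
      ‖colOp (sinkhornRow fun i => G * a i * H) 1 - 1‖ ≤ 1 / 2 := by
  have hκ0 : 0 ≤ κ := (norm_nonneg _).trans hrow
  set c : Fin d → Matrix (Fin q) (Fin q) ℝ := fun i => G * a i * H with hc
  set S := rowFactor c with hS
  have hS1 : ‖S - 1‖ ≤ κ := (norm_rowFactor_sub_one_le (by linarith)).trans hrow
  set b : Fin d → Matrix (Fin q) (Fin q) ℝ := fun i => S * c i with hb
  have hbrow : rowOp b 1 = 1 := rowOp_rowFactor (by linarith)
  have hcn : IsNearIso 0.11 c := ha.mul_mul (by linarith) (by linarith)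
  have hbcol : ‖colOp b 1 - 1‖ ≤ 2.2 * κ := norm_colOp_rowFactor_le hcn hrow (by linarith) hcol
  have hSG : ‖S * G - 1‖ ≤ 1 / 100 := by
    have h1 : S * G - 1 = (S - 1) * (G - 1) + (S - 1) + (G - 1) := by noncomm_ring
    have h2 : ‖(S - 1) * (G - 1)‖ ≤ κ * (1 / 200) :=
      (norm_mul_le _ _).trans (mul_le_mul hS1 hG (norm_nonneg _) hκ0)
    have h3 := norm_add₃_le (a := (S - 1) * (G - 1)) (b := S - 1) (c := G - 1)
    rw [h1]; linarith
  have hbe : b = fun i => (S * G) * a i * H := by funext i; simp only [hb, hc, mul_assoc]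
  have hbn : IsNearIso 0.11 b := by rw [hbe]; exact ha.mul_mul hSG (by linarith)
  set T := colFactor b with hT
  have hTe : T = rowFactor (transposeFamily b) := rfl
  have hTt : T.transpose = T := isHermitian_iff_transpose.mp (invSqrt_isHermitian _)
  have hrt : ‖rowOp (transposeFamily b) 1 - 1‖ ≤ 2.2 * κ := hbcol
  have e : (fun i => (S * G) * a i * (H * T)) = fun i => b i * T := by
    funext i; simp only [hbe, mul_assoc]
  have e' : (fun i => b i * T) = transposeFamily (fun i => T * transposeFamily b i) := by
    funext i; simp [transposeFamily, hTt]
  refine ⟨S, T, hS1, ?_, ?_, ?_, ?_, ?_⟩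
  · rw [hTe]
    exact (norm_rowFactor_sub_one_le (by linarith)).trans (by linarith)
  · rw [sinkhornRow_eq hq, sinkhornCol_eq hq, e]
  · rw [e, e', ← colOp_transposeFamily, transposeFamily_transposeFamily, hTe]
    -- Transposition turns the column half-step into a row half-step. The surviving row defect is
    -- `0.15 * 2.2 κ`, below `κ / 2`.
    have h1 : colOp (transposeFamily b) 1 = 1 := by rw [colOp_transposeFamily]; exact hbrow
    have := norm_colOp_rowFactor_le_of_eq hbn.transpose hrt (by linarith) h1
    linarith
  · rw [e, e', colOp, transposeFamily_transposeFamily, hTe, rowOp_rowFactor (by linarith),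
      sub_self, norm_zero]
    positivity
  · rw [sinkhornRow_eq hq]; linarith

/-- Defects halve, while `G` and `H` move by at most `4 κ / 2 ^ k` and so stay within `8 κ` of the
identity. Near isometry is always deduced from the original family, so its constant does not
deteriorate along the iteration. -/
lemma sinkhorn_iterate_bounds (hq : 1 ≤ q) (ha : IsNearIso 0.06 a) (hκ : κ ≤ 1 / 2000)
    (hrow : ‖rowOp a 1 - 1‖ ≤ κ) (hcol : ‖colOp a 1 - 1‖ ≤ κ) :
    ∃ G H : ℕ → Matrix (Fin q) (Fin q) ℝ, G 0 = 1 ∧ H 0 = 1 ∧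
      (∀ k, (fun A => sinkhornCol (sinkhornRow A))^[k] a = fun i => G k * a i * H k) ∧
      (∀ k, ‖G k - G (k + 1)‖ ≤ 8 * κ / 2 / 2 ^ k) ∧
      (∀ k, ‖H k - H (k + 1)‖ ≤ 8 * κ / 2 / 2 ^ k) ∧
      (∀ k, ‖rowOp (fun i => G k * a i * H k) 1 - 1‖ ≤ κ / 2 ^ k) ∧
      (∀ k, ‖colOp (fun i => G k * a i * H k) 1 - 1‖ ≤ κ / 2 ^ k) ∧
      ∀ k, ‖colOp (sinkhornRow fun i => G k * a i * H k) 1 - 1‖ ≤ 1 / 2 := by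
  have hκ0 : 0 ≤ κ := (norm_nonneg _).trans hrow
  let Inv : ℕ → Matrix (Fin q) (Fin q) ℝ × Matrix (Fin q) (Fin q) ℝ → Prop := fun k p =>
    (fun A => sinkhornCol (sinkhornRow A))^[k] a = (fun i => p.1 * a i * p.2) ∧
    ‖p.1 - 1‖ ≤ 8 * κ * (1 - (1 / 2) ^ k) ∧ ‖p.2 - 1‖ ≤ 8 * κ * (1 - (1 / 2) ^ k) ∧
    ‖rowOp (fun i => p.1 * a i * p.2) 1 - 1‖ ≤ κ / 2 ^ k ∧
    ‖colOp (fun i => p.1 * a i * p.2) 1 - 1‖ ≤ κ / 2 ^ k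
  have h0 : Inv 0 (1, 1) := by
    refine ⟨?_, ?_, ?_, ?_, ?_⟩ <;> simp [hrow, hcol]
  have hstep : ∀ k p, Inv k p → ∃ p', Inv (k + 1) p' ∧ ‖p.1 - p'.1‖ ≤ 8 * κ / 2 / 2 ^ k ∧
      ‖p.2 - p'.2‖ ≤ 8 * κ / 2 / 2 ^ k ∧
      ‖colOp (sinkhornRow fun i => p.1 * a i * p.2) 1 - 1‖ ≤ 1 / 2 := by
    rintro k ⟨G, H⟩ ⟨h1, h2, h3, h4, h5⟩
    simp only at h1 h2 h3 h4 h5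
    have hp : (0 : ℝ) < (1 / 2) ^ k := by positivity
    have hp1 : (1 / 2 : ℝ) ^ k ≤ 1 := pow_le_one₀ (by norm_num) (by norm_num)
    have hdiv : ∀ x : ℝ, x / 2 ^ k = x * (1 / 2) ^ k := by
      intro x; rw [div_eq_mul_inv, one_div, inv_pow]
    rw [hdiv] at h4 h5
    have hκk : κ * (1 / 2) ^ k ≤ 1 / 2000 := by nlinarith
    have hκk0 : 0 ≤ κ * (1 / 2) ^ k := by positivity
    have hG : ‖G - 1‖ ≤ 1 / 200 := by nlinarith
    have hH : ‖H - 1‖ ≤ 1 / 200 := by nlinarith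
    obtain ⟨S, T, hS, hT, e, h6, h7, h8⟩ := sinkhorn_pass hq ha hG hH hκk h4 h5
    have dG : ‖S * G - G‖ ≤ 4 * (κ * (1 / 2) ^ k) := by
      have e1 : S * G - G = (S - 1) * (G - 1) + (S - 1) := by noncomm_ring
      rw [e1]
      have := (norm_mul_le (S - 1) (G - 1)).trans
        (mul_le_mul hS hG (norm_nonneg _) hκk0)
      have := norm_add_le ((S - 1) * (G - 1)) (S - 1)
      linarith
    have dH : ‖H * T - H‖ ≤ 4 * (κ * (1 / 2) ^ k) := by
      have e1 : H * T - H = (H - 1) * (T - 1) + (T - 1) := by noncomm_ring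
      rw [e1]
      have := (norm_mul_le (H - 1) (T - 1)).trans
        (mul_le_mul hH hT (norm_nonneg _) (by norm_num))
      have := norm_add_le ((H - 1) * (T - 1)) (T - 1)
      linarith
    refine ⟨(S * G, H * T), ⟨?_, ?_, ?_, ?_, ?_⟩, ?_, ?_, h8⟩
    · rw [Function.iterate_succ_apply', h1]; exact e
    · have := norm_sub_le_norm_sub_add_norm_sub (S * G) G 1
      rw [pow_succ]; simp only; linarith
    · have := norm_sub_le_norm_sub_add_norm_sub (H * T) H 1
      rw [pow_succ]; simp only; linarith
    · rw [pow_succ, ← div_div, hdiv]; exact h6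
    · rw [pow_succ, ← div_div, hdiv]; exact h7
    · rw [norm_sub_rev, hdiv]; simp only; linarith
    · rw [norm_sub_rev, hdiv]; simp only; linarith
  choose f hf using hstep
  let p : (k : ℕ) → {p : Matrix (Fin q) (Fin q) ℝ × Matrix (Fin q) (Fin q) ℝ // Inv k p} :=
    fun k => Nat.rec ⟨(1, 1), h0⟩ (fun k p => ⟨f k p.1 p.2, (hf k p.1 p.2).1⟩) k
  refine ⟨fun k => (p k).1.1, fun k => (p k).1.2, rfl, rfl, fun k => (p k).2.1, fun k => ?_,
    fun k => ?_, fun k => (p k).2.2.2.2.1, fun k => (p k).2.2.2.2.2, fun k => ?_⟩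
  · exact (hf k (p k).1 (p k).2).2.1
  · exact (hf k (p k).1 (p k).2).2.2.1
  · exact (hf k (p k).1 (p k).2).2.2.2

lemma continuous_rowOp (X : Matrix (Fin q) (Fin q) ℝ) :
    Continuous fun a : Fin d → Matrix (Fin q) (Fin q) ℝ => rowOp a X := by
  unfold rowOp
  fun_prop

lemma continuous_colOp (X : Matrix (Fin q) (Fin q) ℝ) :
    Continuous fun a : Fin d → Matrix (Fin q) (Fin q) ℝ => colOp a X := by
  unfold colOp
  refine (continuous_rowOp X).comp ?_
  unfold transposeFamily
  fun_prop

/-- Convergence of the iteration at a geometric rate. -/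
lemma sinkhorn_converges (hq : 1 ≤ q) (ha : IsNearIso 0.06 a) (hκ : κ ≤ 1 / 2000)
    (hrow : ‖rowOp a 1 - 1‖ ≤ κ) (hcol : ‖colOp a 1 - 1‖ ≤ κ) :
    ∃ G H : Matrix (Fin q) (Fin q) ℝ, ‖G - 1‖ ≤ 8 * κ ∧ ‖H - 1‖ ≤ 8 * κ ∧
      rowOp (fun i => G * a i * H) 1 = 1 ∧ colOp (fun i => G * a i * H) 1 = 1 ∧
      (∀ k, ‖rowOp ((fun A => sinkhornCol (sinkhornRow A))^[k] a) 1 - 1‖ ≤ 1 / 2) ∧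
      (∀ k, ‖colOp (sinkhornRow ((fun A => sinkhornCol (sinkhornRow A))^[k] a)) 1 - 1‖ ≤ 1 / 2) ∧
      ∀ k, ‖(fun A => sinkhornCol (sinkhornRow A))^[k] a - fun i => G * a i * H‖ ≤
        (1 / 2) ^ k * ‖a‖ := by
  have hκ0 : 0 ≤ κ := (norm_nonneg _).trans hrow
  obtain ⟨G, H, hG0, hH0, hit, hG, hH, h4, h5, h6⟩ := sinkhorn_iterate_bounds hq ha hκ hrow hcol
  simp only [← dist_eq_norm] at hG hH
  obtain ⟨Gl, hGl⟩ := cauchySeq_tendsto_of_complete (cauchySeq_of_le_geometric_two hG)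
  obtain ⟨Hl, hHl⟩ := cauchySeq_tendsto_of_complete (cauchySeq_of_le_geometric_two hH)
  have dG := dist_le_of_le_geometric_two_of_tendsto hG hGl
  have dH := dist_le_of_le_geometric_two_of_tendsto hH hHl
  simp only [dist_eq_norm] at dG dH
  have hG1 : ‖Gl - 1‖ ≤ 8 * κ := by
    have := dG 0; rwa [hG0, pow_zero, div_one, norm_sub_rev] at this
  have hH1 : ‖Hl - 1‖ ≤ 8 * κ := by
    have := dH 0; rwa [hH0, pow_zero, div_one, norm_sub_rev] at this
  have hdiv : ∀ (x : ℝ) (k : ℕ), x / 2 ^ k = x * (1 / 2) ^ k := by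
    intro x k; rw [div_eq_mul_inv, one_div, inv_pow]
  have hbound : ∀ k, ‖(fun A => sinkhornCol (sinkhornRow A))^[k] a - fun i => Gl * a i * Hl‖ ≤
      (1 / 2) ^ k * ‖a‖ := by
    intro k
    have hp : (0 : ℝ) < (1 / 2) ^ k := by positivity
    have hp1 : (1 / 2 : ℝ) ^ k ≤ 1 := pow_le_one₀ (by norm_num) (by norm_num)
    rw [hit k, pi_norm_le_iff_of_nonneg (by positivity)]
    intro i
    have e : G k * a i * H k - Gl * a i * Hl =
        (G k - Gl) * (a i * H k) + Gl * (a i * (H k - Hl)) := by noncomm_ring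
    have n1 : ‖Gl‖ ≤ 1.01 := by
      have := norm_add_le (Gl - 1) 1
      rw [sub_add_cancel] at this
      have := norm_one_le (q := q)
      linarith
    have dH' := dH k
    have dG' := dG k
    rw [hdiv] at dH' dG'
    have n2 : ‖H k‖ ≤ 1.01 := by
      have h1 := norm_add₃_le (a := H k - Hl) (b := Hl - 1) (c := 1)
      rw [sub_add_sub_cancel, sub_add_cancel] at h1
      have := norm_one_le (q := q)
      nlinarith
    have hai : ‖a i‖ ≤ ‖a‖ := norm_le_pi_norm a i
    have t1 : ‖(G k - Gl) * (a i * H k)‖ ≤ (8 * κ * (1 / 2) ^ k) * (‖a‖ * 1.01) :=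
      (norm_mul_le _ _).trans (mul_le_mul dG' ((norm_mul_le _ _).trans
        (mul_le_mul hai n2 (norm_nonneg _) (norm_nonneg _))) (norm_nonneg _) (by positivity))
    have t2 : ‖Gl * (a i * (H k - Hl))‖ ≤ 1.01 * (‖a‖ * (8 * κ * (1 / 2) ^ k)) :=
      (norm_mul_le _ _).trans (mul_le_mul n1 ((norm_mul_le _ _).trans
        (mul_le_mul hai dH' (norm_nonneg _) (norm_nonneg _))) (norm_nonneg _) (by norm_num))
    show ‖G k * a i * H k - Gl * a i * Hl‖ ≤ _
    rw [e]
    refine (norm_add_le _ _).trans ((add_le_add t1 t2).trans ?_)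
    have : 0 ≤ (1 / 2) ^ k * ‖a‖ := by positivity
    nlinarith
  have hlim : Tendsto (fun k => (fun A => sinkhornCol (sinkhornRow A))^[k] a) atTop
      (𝓝 fun i => Gl * a i * Hl) := by
    rw [tendsto_iff_norm_sub_tendsto_zero]
    refine squeeze_zero (fun _ => norm_nonneg _) hbound ?_
    simpa using (tendsto_pow_atTop_nhds_zero_of_lt_one (r := (1 / 2 : ℝ)) (by norm_num)
      (by norm_num)).mul_const ‖a‖
  have hz : Tendsto (fun k : ℕ => κ / 2 ^ k) atTop (𝓝 0) := by
    simp only [hdiv]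
    simpa using (tendsto_pow_atTop_nhds_zero_of_lt_one (r := (1 / 2 : ℝ)) (by norm_num)
      (by norm_num)).const_mul κ
  refine ⟨Gl, Hl, hG1, hH1, ?_, ?_, ?_, ?_, hbound⟩
  · refine tendsto_nhds_unique (((continuous_rowOp 1).tendsto _).comp hlim) ?_
    rw [tendsto_iff_norm_sub_tendsto_zero]
    refine squeeze_zero (fun _ => norm_nonneg _) (fun k => ?_) hz
    simp only [Function.comp_apply]
    rw [hit k]; exact h4 k
  · refine tendsto_nhds_unique (((continuous_colOp 1).tendsto _).comp hlim) ?_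
    rw [tendsto_iff_norm_sub_tendsto_zero]
    refine squeeze_zero (fun _ => norm_nonneg _) (fun k => ?_) hz
    simp only [Function.comp_apply]
    rw [hit k]; exact h5 k
  · intro k
    rw [hit k]
    refine (h4 k).trans ?_
    have : κ / 2 ^ k ≤ κ := div_le_self hκ0 (one_le_pow₀ (by norm_num))
    linarith
  · intro k
    rw [hit k]; exact h6 k

/-! ### Continuity of the Operator Sinkhorn limit -/

lemma tendsto_invSqrt {ι : Type*} {l : Filter ι} {R : ι → Matrix (Fin q) (Fin q) ℝ}
    {R₀ : Matrix (Fin q) (Fin q) ℝ} (h : Tendsto R l (𝓝 R₀)) (hR : ∀ i, (R i).IsHermitian)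
    (hR₀ : R₀.IsHermitian) (h1 : ∀ i, ‖R i - 1‖ ≤ 1 / 2) (h2 : ‖R₀ - 1‖ ≤ 1 / 2) :
    Tendsto (fun i => invSqrt (R i)) l (𝓝 (invSqrt R₀)) := by
  have hs : ∀ S : Matrix (Fin q) (Fin q) ℝ, S.IsHermitian → ‖S - 1‖ ≤ 1 / 2 →
      spectrum ℝ S ⊆ Set.Icc (1 / 2) (3 / 2) := by
    intro S hS h x hx
    obtain ⟨h3, h4⟩ := abs_le.mp ((abs_sub_one_le_of_mem_spectrum hS hx).trans h)
    exact ⟨by linarith, by linarith⟩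
  refine Filter.Tendsto.cfc (s := Set.Icc (1 / 2) (3 / 2)) isCompact_Icc _ h
    (.of_forall fun i => hs _ (hR i) (h1 i)) (.of_forall fun i => hR i) (hs _ hR₀ h2) hR₀ ?_
  refine ContinuousOn.inv₀ (by fun_prop) fun x hx => ?_
  exact (Real.sqrt_pos.mpr (by linarith [hx.1])).ne'

lemma tendsto_sinkhornRow (hq : 1 ≤ q) {ι : Type*} {l : Filter ι}
    {b : ι → Fin d → Matrix (Fin q) (Fin q) ℝ}
    (h : Tendsto b l (𝓝 a)) (h1 : ∀ i, ‖rowOp (b i) 1 - 1‖ ≤ 1 / 2)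
    (h2 : ‖rowOp a 1 - 1‖ ≤ 1 / 2) :
    Tendsto (fun i => sinkhornRow (b i)) l (𝓝 (sinkhornRow a)) := by
  simp only [sinkhornRow_eq hq]
  have h3 := tendsto_invSqrt (((continuous_rowOp 1).tendsto _).comp h)
    (fun i => rowOp_isHermitian Matrix.isHermitian_one)
    (rowOp_isHermitian Matrix.isHermitian_one) h1 h2
  rw [tendsto_pi_nhds] at h ⊢
  exact fun k => h3.mul (h k)

lemma tendsto_sinkhornCol (hq : 1 ≤ q) {ι : Type*} {l : Filter ι}
    {b : ι → Fin d → Matrix (Fin q) (Fin q) ℝ}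
    (h : Tendsto b l (𝓝 a)) (h1 : ∀ i, ‖colOp (b i) 1 - 1‖ ≤ 1 / 2)
    (h2 : ‖colOp a 1 - 1‖ ≤ 1 / 2) :
    Tendsto (fun i => sinkhornCol (b i)) l (𝓝 (sinkhornCol a)) := by
  simp only [sinkhornCol_eq hq]
  have h3 := tendsto_invSqrt (((continuous_colOp 1).tendsto _).comp h)
    (fun i => rowOp_isHermitian Matrix.isHermitian_one)
    (rowOp_isHermitian Matrix.isHermitian_one) h1 h2
  rw [tendsto_pi_nhds] at h ⊢
  exact fun k => (h k).mul h3

/-- The limit of the iteration depends continuously on its starting point. -/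
lemma tendsto_sinkhorn_limit (hq : 1 ≤ q) {ι : Type*} {l : Filter ι}
    {b b' : ι → Fin d → Matrix (Fin q) (Fin q) ℝ} {a' : Fin d → Matrix (Fin q) (Fin q) ℝ}
    (h : Tendsto b l (𝓝 a)) (hbn : ∀ i, IsNearIso 0.06 (b i)) (han : IsNearIso 0.06 a)
    (hbr : ∀ i, ‖rowOp (b i) 1 - 1‖ ≤ 1 / 2000) (har : ‖rowOp a 1 - 1‖ ≤ 1 / 2000)
    (hbc : ∀ i, ‖colOp (b i) 1 - 1‖ ≤ 1 / 2000) (hac : ‖colOp a 1 - 1‖ ≤ 1 / 2000)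
    (hb' : ∀ i, Tendsto (fun k => (fun A => sinkhornCol (sinkhornRow A))^[k] (b i)) atTop
      (𝓝 (b' i)))
    (ha' : Tendsto (fun k => (fun A => sinkhornCol (sinkhornRow A))^[k] a) atTop (𝓝 a')) :
    Tendsto b' l (𝓝 a') := by
  -- The geometric rate is uniform over starting families satisfying these bounds; finitely many
  -- passes are continuous, and the two limits may be exchanged.
  have key : ∀ (c c' : Fin d → Matrix (Fin q) (Fin q) ℝ), IsNearIso 0.06 c →
      ‖rowOp c 1 - 1‖ ≤ 1 / 2000 → ‖colOp c 1 - 1‖ ≤ 1 / 2000 →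
      Tendsto (fun k => (fun A => sinkhornCol (sinkhornRow A))^[k] c) atTop (𝓝 c') →
      (∀ k, ‖rowOp ((fun A => sinkhornCol (sinkhornRow A))^[k] c) 1 - 1‖ ≤ 1 / 2) ∧
      (∀ k, ‖colOp (sinkhornRow ((fun A => sinkhornCol (sinkhornRow A))^[k] c)) 1 - 1‖ ≤ 1 / 2) ∧
      ∀ k, ‖(fun A => sinkhornCol (sinkhornRow A))^[k] c - c'‖ ≤ (1 / 2) ^ k * ‖c‖ := by
    intro c c' h1 h2 h3 h4
    obtain ⟨G, H, -, -, -, -, h5, h6, h7⟩ := sinkhorn_converges hq h1 le_rfl h2 h3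
    have : Tendsto (fun k => (fun A => sinkhornCol (sinkhornRow A))^[k] c) atTop
        (𝓝 fun i => G * c i * H) := by
      rw [tendsto_iff_norm_sub_tendsto_zero]
      refine squeeze_zero (fun _ => norm_nonneg _) h7 ?_
      simpa using (tendsto_pow_atTop_nhds_zero_of_lt_one (r := (1 / 2 : ℝ)) (by norm_num)
        (by norm_num)).mul_const ‖c‖
    rw [tendsto_nhds_unique h4 this]
    exact ⟨h5, h6, h7⟩
  have hk : ∀ k, Tendsto (fun i => (fun A => sinkhornCol (sinkhornRow A))^[k] (b i)) l
      (𝓝 ((fun A => sinkhornCol (sinkhornRow A))^[k] a)) := by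
    intro k
    induction k with
    | zero => exact h
    | succ k ih =>
      simp only [Function.iterate_succ_apply']
      refine tendsto_sinkhornCol hq (tendsto_sinkhornRow hq ih
        (fun i => (key _ _ (hbn i) (hbr i) (hbc i) (hb' i)).1 k) ((key _ _ han har hac ha').1 k))
        (fun i => (key _ _ (hbn i) (hbr i) (hbc i) (hb' i)).2.1 k)
        ((key _ _ han har hac ha').2.1 k)
  rw [Metric.tendsto_nhds]
  intro ε hε
  obtain ⟨k, hkε⟩ : ∃ k : ℕ, (1 / 2 : ℝ) ^ k * (‖a‖ + 1) < ε / 3 := by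
    have h0 : Tendsto (fun k : ℕ => (1 / 2 : ℝ) ^ k * (‖a‖ + 1)) atTop (𝓝 0) := by
      simpa using (tendsto_pow_atTop_nhds_zero_of_lt_one (r := (1 / 2 : ℝ)) (by norm_num)
        (by norm_num)).mul_const (‖a‖ + 1)
    exact (h0.eventually (gt_mem_nhds (by linarith))).exists
  have hp : (0 : ℝ) < (1 / 2) ^ k := by positivity
  have hn : ∀ᶠ i in l, ‖b i‖ < ‖a‖ + 1 := h.norm.eventually (gt_mem_nhds (by linarith))
  filter_upwards [hn, Metric.tendsto_nhds.mp (hk k) (ε / 3) (by linarith)] with i h1 h2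
  have h3 := (key _ _ (hbn i) (hbr i) (hbc i) (hb' i)).2.2 k
  have h4 := (key _ _ han har hac ha').2.2 k
  rw [← dist_eq_norm] at h3 h4
  have h5 := dist_triangle4 (b' i) ((fun A => sinkhornCol (sinkhornRow A))^[k] (b i))
    ((fun A => sinkhornCol (sinkhornRow A))^[k] a) a'
  rw [dist_comm (b' i) ((fun A => sinkhornCol (sinkhornRow A))^[k] (b i))] at h5
  have m1 := mul_le_mul_of_nonneg_left h1.le hp.le
  have m2 := mul_le_mul_of_nonneg_left (by linarith : ‖a‖ ≤ ‖a‖ + 1) hp.le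
  linarith

end

/-! ### Components -/

section
open Matrix

lemma apply_eq_sum_component (L : LMap q d) (X : Mat q) (i : Fin d) :
    L X i = ∑ a, ∑ b, component L i a b * X (a, b) := by
  have h : X = ∑ p, X p • EuclideanSpace.single p (1 : ℝ) := (sum_single_eq X).symm
  conv_lhs => rw [h]
  rw [map_sum, Fintype.sum_prod_type]
  simp [component, mul_comm]

@[simp] lemma ofComponents_apply (A : Fin d → Matrix (Fin q) (Fin q) ℝ) (X : Mat q) (i : Fin d) :
    ofComponents A X i = ∑ a, ∑ b, A i a b * X (a, b) := rfl

@[simp] lemma component_ofComponents (A : Fin d → Matrix (Fin q) (Fin q) ℝ) :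
    component (ofComponents A) = A := by
  funext i
  ext a b
  simp [component, Prod.ext_iff, ite_and]

@[simp] lemma ofComponents_component (L : LMap q d) : ofComponents (component L) = L := by
  ext X i
  rw [ofComponents_apply, apply_eq_sum_component]

lemma continuous_component : Continuous (component : LMap q d → _) := by
  refine continuous_pi fun i => continuous_matrix fun a b => ?_
  simp only [component, Matrix.of_apply]
  fun_prop

lemma continuous_ofComponents :
    Continuous (ofComponents : (Fin d → Matrix (Fin q) (Fin q) ℝ) → LMap q d) := by
  let f : (Fin d → Matrix (Fin q) (Fin q) ℝ) →ₗ[ℝ] LMap q d :=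
    { toFun := ofComponents
      map_add' := fun A B => by
        ext X i; simp [add_mul, Finset.sum_add_distrib]
      map_smul' := fun c A => by
        ext X i; simp [mul_assoc, Finset.mul_sum] }
  exact f.continuous_of_finiteDimensional

lemma apply_vecMulVec (L : LMap q d) (x y : Fin q → ℝ) (i : Fin d) :
    L (ofMat (vecMulVec y x)) i = y ⬝ᵥ component L i *ᵥ x := by
  rw [apply_eq_sum_component]
  simp only [ofMat, vecMulVec_apply, dotProduct, mulVec, Finset.mul_sum]
  exact Finset.sum_congr rfl fun a _ => Finset.sum_congr rfl fun b _ => by ring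

lemma sum_sq_eq_norm_apply (L : LMap q d) (x y : Fin q → ℝ) :
    ∑ i, (y ⬝ᵥ component L i *ᵥ x) ^ 2 = ‖L (ofMat (vecMulVec y x))‖ ^ 2 := by
  rw [EuclideanSpace.norm_sq_eq]
  simp [← apply_vecMulVec]

lemma norm_ofMat_vecMulVec (x y : Fin q → ℝ) :
    ‖ofMat (vecMulVec y x)‖ ^ 2 = (y ⬝ᵥ y) * (x ⬝ᵥ x) := by
  rw [norm_sq_eq_sum, toMat_ofMat]
  simp only [vecMulVec_apply, dotProduct]
  rw [Finset.sum_mul_sum, Finset.sum_comm]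
  exact Finset.sum_congr rfl fun a _ => Finset.sum_congr rfl fun b _ => by ring

lemma rank_ofMat_vecMulVec_le (x y : Fin q → ℝ) : rank (ofMat (vecMulVec y x)) ≤ 1 :=
  Matrix.rank_vecMulVec_le _ _

lemma component_ext {L : LMap q d} {i : Fin d} {A : Matrix (Fin q) (Fin q) ℝ}
    (h : ∀ x y : Fin q → ℝ, L (ofMat (vecMulVec y x)) i = y ⬝ᵥ A *ᵥ x) : component L i = A := by
  ext a b
  have := h (Pi.single b 1) (Pi.single a 1)
  rw [apply_vecMulVec] at this
  simpa using this

lemma component_comp_sandwich (L : LMap q d) (U V : Matrix (Fin q) (Fin q) ℝ) :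
    component (L.comp (sandwich U V)) = fun i => U.transpose * component L i * V.transpose := by
  funext i
  refine component_ext fun x y => ?_
  have : sandwich U V (ofMat (vecMulVec y x)) =
      ofMat (vecMulVec (U *ᵥ y) (V.transpose *ᵥ x)) := by
    refine toMat_injective ?_
    rw [toMat_sandwich, toMat_ofMat, toMat_ofMat, Matrix.mul_vecMulVec, Matrix.vecMulVec_mul,
      Matrix.mulVec_transpose]
  rw [ContinuousLinearMap.comp_apply, this, apply_vecMulVec, ← Matrix.mulVec_mulVec,
    ← Matrix.mulVec_mulVec, Matrix.dotProduct_mulVec y, Matrix.vecMul_transpose]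

lemma component_comp_transposeOp (L : LMap q d) :
    component (L.comp (transposeOp q)) = transposeFamily (component L) := by
  funext i
  refine component_ext fun x y => ?_
  have : transposeOp q (ofMat (vecMulVec y x)) = ofMat (vecMulVec x y) := by
    refine toMat_injective ?_
    rw [toMat_transposeOp, toMat_ofMat, toMat_ofMat, Matrix.transpose_vecMulVec]
  rw [ContinuousLinearMap.comp_apply, this, apply_vecMulVec, transposeFamily,
    Matrix.mulVec_transpose, dotProduct_comm y, ← Matrix.dotProduct_mulVec]

lemma isNormalized_iff (hq : 1 ≤ q) (L : LMap q d) :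
    IsNormalized L ↔ rowOp (component L) 1 = 1 ∧ colOp (component L) 1 = 1 := by
  have hq0 : (q : ℝ) ≠ 0 := by positivity
  simp only [IsNormalized, colOp, rowOp, transposeFamily, mul_one, Matrix.transpose_transpose]
  rw [inv_smul_eq_iff₀ hq0, inv_smul_eq_iff₀ hq0]

lemma IsNormalized.comp_transposeOp {L : LMap q d} (h : IsNormalized L) :
    IsNormalized (L.comp (transposeOp q)) := by
  rw [IsNormalized, component_comp_transposeOp]
  simp only [transposeFamily, Matrix.transpose_transpose]
  exact ⟨h.2, h.1⟩

/-! ### Near isometries -/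

lemma quadratic_rowOp_one (L : LMap q d) (y : Fin q → ℝ) :
    y ⬝ᵥ rowOp (component L) 1 *ᵥ y =
      (q : ℝ)⁻¹ * ∑ k, ‖L (ofMat (vecMulVec y (Pi.single k 1)))‖ ^ 2 := by
  rw [quadratic_rowOp]
  congr 1
  simp only [← sum_sq_eq_norm_apply]
  rw [Finset.sum_comm]
  refine Finset.sum_congr rfl fun i _ => ?_
  rw [Matrix.one_mulVec, dotProduct]
  refine Finset.sum_congr rfl fun k _ => ?_
  rw [← sq, Matrix.mulVec_transpose, Matrix.dotProduct_mulVec, dotProduct_single, mul_one]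

/-- The quadratic form of `rowOp` at 1 is an average of squared norms of `L` on rank-one matrices,
so bounds on rank one suffice. -/
lemma norm_rowOp_component_sub_le {L₁ L₂ : LMap q d} {ε : ℝ} (hε : ε ≤ 1 / 1000)
    (h₁ : ∀ Z : Mat q, rank Z ≤ 1 → ‖L₁ Z‖ ≤ 1.04 * ‖Z‖)
    (h₂ : ∀ Z : Mat q, rank Z ≤ 1 → ‖(L₂ - L₁) Z‖ ≤ ε * ‖Z‖) (hε0 : 0 ≤ ε) :
    ‖rowOp (component L₂) 1 - rowOp (component L₁) 1‖ ≤ 2.1 * ε := by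
  refine norm_le_of_quadratic ((rowOp_isHermitian Matrix.isHermitian_one).sub
    (rowOp_isHermitian Matrix.isHermitian_one)) (by positivity) fun y => ?_
  rw [Matrix.sub_mulVec, dotProduct_sub, quadratic_rowOp_one, quadratic_rowOp_one, ← mul_sub,
    ← Finset.sum_sub_distrib]
  have hy := dotProduct_self_nonneg' y
  have hterm : ∀ k : Fin q, |‖L₂ (ofMat (vecMulVec y (Pi.single k 1)))‖ ^ 2 -
      ‖L₁ (ofMat (vecMulVec y (Pi.single k 1)))‖ ^ 2| ≤ 2.1 * ε * (y ⬝ᵥ y) := by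
    intro k
    set Z := ofMat (vecMulVec y (Pi.single k 1)) with hZ
    have hr : rank Z ≤ 1 := rank_ofMat_vecMulVec_le _ _
    have hn : ‖Z‖ ^ 2 = y ⬝ᵥ y := by rw [hZ, norm_ofMat_vecMulVec]; simp
    have a1 := h₁ Z hr
    have a2 := h₂ Z hr
    have a3 := abs_norm_sub_norm_le (L₂ Z) (L₁ Z)
    rw [← hn]
    rw [_root_.sub_apply] at a2
    have hz := norm_nonneg Z
    have hl1 := norm_nonneg (L₁ Z)
    have hl2 := norm_nonneg (L₂ Z)
    have a4 : |‖L₂ Z‖ - ‖L₁ Z‖| ≤ ε * ‖Z‖ := a3.trans a2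
    have a5 : |‖L₂ Z‖ + ‖L₁ Z‖| ≤ 2.1 * ‖Z‖ := by
      rw [abs_of_nonneg (by positivity)]
      have := (abs_le.mp a4).2
      nlinarith
    have e : ‖L₂ Z‖ ^ 2 - ‖L₁ Z‖ ^ 2 = (‖L₂ Z‖ - ‖L₁ Z‖) * (‖L₂ Z‖ + ‖L₁ Z‖) := by ring
    rw [e, abs_mul]
    calc _ ≤ (ε * ‖Z‖) * (2.1 * ‖Z‖) := mul_le_mul a4 a5 (abs_nonneg _) (by positivity)
      _ = _ := by ring
  rcases Nat.eq_zero_or_pos q with h0 | h0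
  · subst h0; simp
  have hq0 : (0 : ℝ) < q := by exact_mod_cast h0
  rw [abs_mul, abs_of_nonneg (by positivity : (0 : ℝ) ≤ (q : ℝ)⁻¹), inv_mul_le_iff₀ hq0]
  refine (Finset.abs_sum_le_sum_abs _ _).trans ((Finset.sum_le_sum fun k _ => hterm k).trans_eq ?_)
  simp

lemma norm_colOp_component_sub_le {L₁ L₂ : LMap q d} {ε : ℝ} (hε : ε ≤ 1 / 1000)
    (h₁ : ∀ Z : Mat q, rank Z ≤ 1 → ‖L₁ Z‖ ≤ 1.04 * ‖Z‖)
    (h₂ : ∀ Z : Mat q, rank Z ≤ 1 → ‖(L₂ - L₁) Z‖ ≤ ε * ‖Z‖) (hε0 : 0 ≤ ε) :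
    ‖colOp (component L₂) 1 - colOp (component L₁) 1‖ ≤ 2.1 * ε := by
  have := norm_rowOp_component_sub_le (L₁ := L₁.comp (transposeOp q))
    (L₂ := L₂.comp (transposeOp q)) hε (fun Z hZ => ?_) (fun Z hZ => ?_) hε0
  · rwa [component_comp_transposeOp, component_comp_transposeOp] at this
  · rw [ContinuousLinearMap.comp_apply, ← norm_transposeOp Z]
    exact h₁ _ ((rank_transposeOp Z).trans_le hZ)
  · rw [← ContinuousLinearMap.sub_comp, ContinuousLinearMap.comp_apply, ← norm_transposeOp Z]
    exact h₂ _ ((rank_transposeOp Z).trans_le hZ)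

/-- `M` is invertible with `‖M‖` and `‖M⁻¹‖` at most `1 + β`. -/
structure IsNearUnitary (β : ℝ) (M : MatOp q) : Prop where
  rank_le : ∀ X, rank (M X) ≤ rank X
  norm_le : ‖M‖ ≤ 1 + β
  exists_inverse : ∃ M' : MatOp q, (∀ X, rank (M' X) ≤ rank X) ∧ (∀ X, M (M' X) = X) ∧
    (∀ X, M' (M X) = X) ∧ ‖M'‖ ≤ 1 + β

lemma IsNearUnitary.le {β : ℝ} {M : MatOp q} (hM : IsNearUnitary β M) (Z : Mat q) :
    ‖M Z‖ ≤ (1 + β) * ‖Z‖ :=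
  (M.le_opNorm Z).trans (mul_le_mul_of_nonneg_right hM.norm_le (norm_nonneg _))

lemma IsNearUnitary.ge {β : ℝ} {M : MatOp q} (hM : IsNearUnitary β M) (Z : Mat q) :
    ‖Z‖ ≤ (1 + β) * ‖M Z‖ := by
  obtain ⟨M', -, -, h, hn⟩ := hM.exists_inverse
  conv_lhs => rw [← h Z]
  exact (M'.le_opNorm _).trans (mul_le_mul_of_nonneg_right hn (norm_nonneg _))

variable {r : ℕ} {Ls C : LMap q d} {e : ℝ}

lemma isNearIso_component {M : MatOp q} {β ε : ℝ} (hr : 1 ≤ r) (hL : HasRIP r Ls)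
    (hM : IsNearUnitary β M) (hβ : β ≤ 1 / 1000) (hε : ε ≤ 1 / 10000)
    (hC : ∀ Z, ‖C Z‖ ≤ ε * ‖Z‖) : IsNearIso 0.06 (component ((Ls + C).comp M)) := by
  intro x y
  rw [sum_sq_eq_norm_apply, ← norm_ofMat_vecMulVec]
  set Z := ofMat (vecMulVec y x) with hZ
  have h1 : rank (M Z) ≤ 4 * r :=
    (hM.rank_le Z).trans ((rank_ofMat_vecMulVec_le _ _).trans (by omega))
  have h2 := hL.le h1
  have h3 := hL.ge h1
  have h4 := hC (M Z)
  have h5 := hM.le Z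
  have h6 := hM.ge Z
  rw [ContinuousLinearMap.comp_apply, _root_.add_apply]
  have h7 := norm_add_le (Ls (M Z)) (C (M Z))
  have h8 := norm_sub_norm_le (Ls (M Z)) (-(C (M Z)))
  rw [norm_neg, sub_neg_eq_add] at h8
  have hw := norm_nonneg (M Z)
  have hz := norm_nonneg Z
  set w := ‖M Z‖
  set z := ‖Z‖
  set u := ‖Ls (M Z) + C (M Z)‖
  have b1 : w ≤ 1.001 * z := by nlinarith
  have b2 : z ≤ 1.001 * w := by nlinarith
  have u1 : u ≤ 1.027 * z := by nlinarith
  have u2 : 0.972 * z ≤ u := by nlinarith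
  have u0 : 0 ≤ u := norm_nonneg _
  rw [abs_le]
  constructor <;> nlinarith

/-! ### Two-sided multiplication by nearly orthogonal matrices -/

lemma norm_mul_transpose_self (U : Matrix (Fin q) (Fin q) ℝ) :
    ‖U * U.transpose‖ = ‖U‖ * ‖U‖ := by
  have := Matrix.l2_opNorm_conjTranspose_mul_self U.transpose
  rwa [Matrix.conjTranspose_eq_transpose_of_trivial, Matrix.transpose_transpose,
    norm_transpose] at this

lemma norm_le_of_mul_transpose {U : Matrix (Fin q) (Fin q) ℝ} {β : ℝ} (hβ : 0 ≤ β)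
    (h : ‖U * U.transpose - 1‖ ≤ β) : ‖U‖ ≤ 1 + β / 2 := by
  have h1 := norm_add_le (U * U.transpose - 1) 1
  rw [sub_add_cancel, norm_mul_transpose_self] at h1
  have h2 := norm_one_le (q := q)
  nlinarith [norm_nonneg U, sq_nonneg β]

lemma exists_inverse_of_mul_transpose {U : Matrix (Fin q) (Fin q) ℝ} {β : ℝ} (hβ : β ≤ 1 / 10)
    (h : ‖U * U.transpose - 1‖ ≤ β) :
    ∃ U' : Matrix (Fin q) (Fin q) ℝ, U * U' = 1 ∧ U' * U = 1 ∧ ‖U'‖ ≤ 1 + 0.6 * β := by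
  have hβ0 : 0 ≤ β := (norm_nonneg _).trans h
  have hu : IsUnit (U * U.transpose) := by
    have := (Units.oneSub (1 - U * U.transpose) (by rw [norm_sub_rev]; linarith)).isUnit
    simpa using this
  have hU : IsUnit U := by
    rw [Matrix.isUnit_iff_isUnit_det, Matrix.det_mul] at hu
    exact (Matrix.isUnit_iff_isUnit_det U).mpr (isUnit_of_mul_isUnit_left hu)
  obtain ⟨u, rfl⟩ := hU
  have i1 : (u : Matrix (Fin q) (Fin q) ℝ) * (u⁻¹ : _) = 1 := u.mul_inv
  have i2 : ((u⁻¹ : _) : Matrix (Fin q) (Fin q) ℝ) * u = 1 := u.inv_mul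
  refine ⟨(u⁻¹ : _), i1, i2, ?_⟩
  generalize ((u⁻¹ : (Matrix (Fin q) (Fin q) ℝ)ˣ) : Matrix (Fin q) (Fin q) ℝ) = W at *
  generalize (u : Matrix (Fin q) (Fin q) ℝ) = U at *
  have i3 : U.transpose * W.transpose = 1 := by
    rw [← Matrix.transpose_mul, i2, Matrix.transpose_one]
  have h1 : W.transpose * W * (U * U.transpose) = 1 := by
    calc _ = W.transpose * (W * U) * U.transpose := by noncomm_ring
      _ = W.transpose * U.transpose := by rw [i2, mul_one]
      _ = 1 := by rw [← Matrix.transpose_mul, i1, Matrix.transpose_one]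
  have h2 := norm_sub_one_le_of_mul_eq_one h1 h (by linarith)
  have h3 : ‖W.transpose * W - 1‖ ≤ 1.12 * β := by
    refine h2.trans ?_
    rw [div_le_iff₀ (by linarith)]
    nlinarith
  have h4 := norm_le_of_mul_transpose (U := W.transpose) (β := 1.12 * β) (by positivity)
    (by rwa [Matrix.transpose_transpose])
  rw [norm_transpose] at h4
  linarith

lemma rank_sandwich_le (A B : Matrix (Fin q) (Fin q) ℝ) (X : Mat q) :
    rank (sandwich A B X) ≤ rank X :=
  (rank_lmul_le A _).trans (rank_rmul_le B X)

lemma sandwich_sandwich (A B A' B' : Matrix (Fin q) (Fin q) ℝ) (X : Mat q) :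
    sandwich A B (sandwich A' B' X) = sandwich (A * A') (B' * B) X :=
  toMat_injective (by simp [mul_assoc])

@[simp] lemma sandwich_one_one (X : Mat q) : sandwich 1 1 X = X :=
  toMat_injective (by simp)

lemma isNearUnitary_sandwich {U V : Matrix (Fin q) (Fin q) ℝ} {β : ℝ} (hβ : β ≤ 1 / 100)
    (hU : ‖U * U.transpose - 1‖ ≤ β) (hV : ‖V.transpose * V - 1‖ ≤ β) :
    IsNearUnitary (1.3 * β) (sandwich U V) := by
  have hβ0 : 0 ≤ β := (norm_nonneg _).trans hU
  have hV' : ‖V.transpose * V.transpose.transpose - 1‖ ≤ β := by rwa [Matrix.transpose_transpose]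
  obtain ⟨U', h1, h2, h3⟩ := exists_inverse_of_mul_transpose (by linarith) hU
  obtain ⟨W, h4, h5, h6⟩ := exists_inverse_of_mul_transpose (by linarith) hV'
  have e1 : W.transpose * V = 1 := by
    rw [← Matrix.transpose_transpose V, ← Matrix.transpose_mul, h4, Matrix.transpose_one]
  have e2 : V * W.transpose = 1 := mul_eq_one_comm.mp e1
  have n1 := norm_le_of_mul_transpose hβ0 hU
  have n2 := norm_le_of_mul_transpose hβ0 hV'
  rw [norm_transpose] at n2
  refine ⟨rank_sandwich_le _ _, ?_, sandwich U' W.transpose, rank_sandwich_le _ _,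
    fun X => ?_, fun X => ?_, ?_⟩
  · refine (norm_sandwich_le _ _).trans ((mul_le_mul n1 n2 (norm_nonneg _) (by positivity)).trans ?_)
    nlinarith
  · rw [sandwich_sandwich, h1, e1, sandwich_one_one]
  · rw [sandwich_sandwich, h2, e2, sandwich_one_one]
  · refine (norm_sandwich_le _ _).trans ?_
    rw [norm_transpose]
    refine (mul_le_mul h3 h6 (norm_nonneg _) (by positivity)).trans ?_
    nlinarith

lemma IsNearUnitary.comp_transposeOp {β : ℝ} {M : MatOp q} (h : IsNearUnitary β M) (hβ : 0 ≤ β) :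
    IsNearUnitary β (M.comp (transposeOp q)) := by
  obtain ⟨M', h0, h1, h2, h3⟩ := h.exists_inverse
  refine ⟨fun X => (h.rank_le _).trans_eq (rank_transposeOp X), ?_,
    (transposeOp q).comp M', fun X => ?_, fun X => ?_, fun X => ?_, ?_⟩
  · refine ContinuousLinearMap.opNorm_le_bound _ (by linarith) fun X => ?_
    have := h.le (transposeOp q X)
    rwa [norm_transposeOp] at this
  · exact (rank_transposeOp _).trans_le (h0 X)
  · simp [transposeOp_transposeOp, h1]
  · simp [transposeOp_transposeOp, h2]
  · refine ContinuousLinearMap.opNorm_le_bound _ (by linarith) fun X => ?_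
    rw [ContinuousLinearMap.comp_apply, norm_transposeOp]
    exact (M'.le_opNorm _).trans (mul_le_mul_of_nonneg_right h3 (norm_nonneg _))

/-- `M` is a two-sided multiplication by nearly orthogonal matrices, possibly after a
transposition. -/
def IsNearOrthogonal (β : ℝ) (M : MatOp q) : Prop :=
  ∃ U V : Matrix (Fin q) (Fin q) ℝ, ‖U * U.transpose - 1‖ ≤ β ∧ ‖V.transpose * V - 1‖ ≤ β ∧
    (M = sandwich U V ∨ M = (sandwich U V).comp (transposeOp q))

lemma IsNearOrthogonal.isNearUnitary {β : ℝ} {M : MatOp q} (h : IsNearOrthogonal β M)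
    (hβ : β ≤ 1 / 100) : IsNearUnitary (1.3 * β) M := by
  obtain ⟨U, V, hU, hV, h1⟩ := h
  have hβ0 : 0 ≤ β := (norm_nonneg _).trans hU
  rcases h1 with rfl | rfl
  · exact isNearUnitary_sandwich hβ hU hV
  · exact (isNearUnitary_sandwich hβ hU hV).comp_transposeOp (by positivity)

lemma sandwich_smul_inv_smul {c : ℝ} (hc : c ≠ 0) (U V : Matrix (Fin q) (Fin q) ℝ) :
    sandwich (c⁻¹ • U) (c • V) = sandwich U V := by
  ext X : 1
  refine toMat_injective ?_
  simp [smul_smul, hc]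

/-- The components of `Ls + C` are nearly isometric and normalized up to `2.1 e`, while their
two-sided multiple is exactly normalized; `exists_nearly_orthogonal` then loses a factor 3. -/
lemma exists_nearOrthogonal_sandwich (hr : 1 ≤ r) (hL : HasRIP r Ls) (hC : IsSmall e C)
    (hLs : IsNormalized Ls) {U V : Matrix (Fin q) (Fin q) ℝ} (hV : IsUnit V)
    (hn : IsNormalized ((Ls + C).comp (sandwich U V))) :
    ∃ c : ℝ, 0 < c ∧ ‖(c⁻¹ • U) * (c⁻¹ • U).transpose - 1‖ ≤ 7 * e ∧
      ‖(c • V).transpose * (c • V) - 1‖ ≤ 7 * e := by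
  have hq := hC.pos_dim
  have he := hC.e_le
  have he0 := hC.nonneg
  rw [isNormalized_iff hq] at hLs hn
  rw [component_comp_sandwich] at hn
  have h1 : IsNearIso 0.06 (component (Ls + C)) := by
    have hid : IsNearUnitary 0 (ContinuousLinearMap.id ℝ (Mat q)) :=
      ⟨fun X => le_rfl, by simpa using ContinuousLinearMap.norm_id_le,
        ContinuousLinearMap.id ℝ _, fun X => le_rfl, fun X => rfl, fun X => rfl,
        by simpa using ContinuousLinearMap.norm_id_le⟩
    have := isNearIso_component (C := C) (ε := e) hr hL hid (by norm_num) (by linarith)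
      hC.le_mul
    rwa [ContinuousLinearMap.comp_id] at this
  have a1 : ∀ Z : Mat q, rank Z ≤ 1 → ‖Ls Z‖ ≤ 1.04 * ‖Z‖ := fun Z hZ =>
    (hL.le (hZ.trans (by omega))).trans
      (mul_le_mul_of_nonneg_right (by norm_num) (norm_nonneg _))
  have a2 : ∀ Z : Mat q, rank Z ≤ 1 → ‖(Ls + C - Ls) Z‖ ≤ e * ‖Z‖ := fun Z _ => by
    rw [add_sub_cancel_left]; exact hC.le_mul Z
  have h2 := norm_rowOp_component_sub_le (by linarith) a1 a2 he0
  have h3 := norm_colOp_component_sub_le (by linarith) a1 a2 he0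
  rw [hLs.1] at h2
  rw [hLs.2] at h3
  obtain ⟨c, hc, h4, h5⟩ := exists_nearly_orthogonal hq h1 (by linarith) h2 h3 hV hn.1 hn.2
  exact ⟨c, hc, h4.trans (by linarith), h5.trans (by linarith)⟩

/-- A rank-preserver relating two normalized maps, up to a small error, is nearly orthogonal. -/
theorem IsRankPreserver.isNearOrthogonal {M : MatOp q} (hM : IsRankPreserver M) (hr : 1 ≤ r)
    (hL : HasRIP r Ls) (hC : IsSmall e C) (hLs : IsNormalized Ls)
    (hn : IsNormalized ((Ls + C).comp M)) : IsNearOrthogonal (7 * e) M := by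
  obtain ⟨U, V, -, hV, h | h⟩ := hM.exists_sandwich hC.dim_two
  · rw [h] at hn
    obtain ⟨c, hc, h1, h2⟩ := exists_nearOrthogonal_sandwich hr hL hC hLs hV hn
    exact ⟨_, _, h1, h2, Or.inl (by rw [sandwich_smul_inv_smul hc.ne', h])⟩
  · have h3 := hn.comp_transposeOp
    have h4 : ((Ls + C).comp M).comp (transposeOp q) = (Ls + C).comp (sandwich U V) := by
      rw [h]; ext X : 1; simp [transposeOp_transposeOp]
    rw [h4] at h3
    obtain ⟨c, hc, h1, h2⟩ := exists_nearOrthogonal_sandwich hr hL hC hLs hV h3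
    exact ⟨_, _, h1, h2, Or.inr (by rw [sandwich_smul_inv_smul hc.ne', h])⟩

end

/-! ### One pass of the algorithm -/

section
variable {r : ℕ} {s Λ e κ : ℝ} {Ls C L : LMap q d} {M : MatOp q} {X : Fin n → Mat q}
  {Y : Fin n → Matrix (Fin q) (Fin q) ℝ}

lemma IsRankPreserver.comp {M N : MatOp q} (hM : IsRankPreserver M) (hN : IsRankPreserver N) :
    IsRankPreserver (M.comp N) := fun X => (hM (N X)).trans (hN X)

lemma isRankPreserver_sandwich {A B A' B' : Matrix (Fin q) (Fin q) ℝ} (hA : A' * A = 1)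
    (hB : B * B' = 1) : IsRankPreserver (sandwich A B) := fun X => by
  refine le_antisymm (rank_sandwich_le A B X) ?_
  have h := rank_sandwich_le A' B' (sandwich A B X)
  rwa [sandwich_sandwich, hA, hB, sandwich_one_one] at h

/-- `L` is, up to a rank-preserver, a perturbation of `Ls` of size `e`. -/
def IsPerturbation (Ls : LMap q d) (e : ℝ) (L : LMap q d) : Prop :=
  IsNormalized L ∧ ∃ (C : LMap q d) (M : MatOp q), IsRankPreserver M ∧ IsSmall e C ∧
    L = (Ls + C).comp M

lemma exists_inverse_near_one {A : Matrix (Fin q) (Fin q) ℝ} {β : ℝ} (h : ‖A - 1‖ ≤ β)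
    (hβ : β ≤ 1 / 100) : ∃ A' : Matrix (Fin q) (Fin q) ℝ, A * A' = 1 ∧ A' * A = 1 ∧
      ‖A'‖ ≤ 1 + 1.02 * β := by
  have hβ0 : 0 ≤ β := (norm_nonneg _).trans h
  have hu : IsUnit A := by
    have := (Units.oneSub (1 - A) (by rw [norm_sub_rev]; linarith)).isUnit
    simpa using this
  obtain ⟨u, rfl⟩ := hu
  refine ⟨(u⁻¹ : (Matrix (Fin q) (Fin q) ℝ)ˣ), u.mul_inv, u.inv_mul, ?_⟩
  have h2 := norm_sub_one_le_of_mul_eq_one u.inv_mul h (by linarith)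
  have h3 := norm_add_le (((u⁻¹ : (Matrix (Fin q) (Fin q) ℝ)ˣ) : Matrix (Fin q) (Fin q) ℝ) - 1) 1
  rw [sub_add_cancel] at h3
  have h4 := norm_one_le (q := q)
  have h5 : β / (1 - β) ≤ 1.02 * β := by
    rw [div_le_iff₀ (by linarith)]; nlinarith
  linarith

/-- The low-rank updates. -/
lemma exists_lowRankUpdate (h : IsEnsemble r s Λ Ls X Y) (hM : IsRankPreserver M)
    (hC : IsSmall e C) (hMu : IsNearUnitary (10 * e) M) (j : Fin n) :
    ∃ Z, IsRankConstrainedMin ((Ls + C).comp M) (Ls (X j)) r Z ∧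
      (∀ Z', IsStat ((Ls + C).comp M) (Ls (X j)) r (4 / 3) Z' → Z' = Z) ∧
      (∀ Z', IsLowRankUpdate ((Ls + C).comp M) (Ls (X j)) r Z' → Z' = Z) ∧
      IsStat (Ls + C) (Ls (X j)) r 1.4 (M Z) ∧ ‖Z‖ ≤ 2 * (‖X j‖ + s) := by
  have he := hC.e_le
  have he0 := hC.nonneg
  obtain ⟨M', -, hMM', hM'M, hM'⟩ := hMu.exists_inverse
  have hM'' : ∀ Z, ‖M' Z‖ ≤ 1.001 * ‖Z‖ := fun Z =>
    (M'.le_opNorm Z).trans (mul_le_mul_of_nonneg_right (by linarith) (norm_nonneg _))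
  have hup : ∀ Z : Mat q, rank Z ≤ 2 * r → ‖((Ls + C).comp M) Z‖ ^ 2 ≤ 4 / 3 * ‖Z‖ ^ 2 := by
    intro Z hZ
    have h1 : ‖(Ls + C) (M Z)‖ ≤ 1.03 * ‖M Z‖ :=
      perturbed_le h.rip hC ((hM Z).trans_le (by omega))
    have h2 := hMu.le Z
    have h3 : ‖((Ls + C).comp M) Z‖ ≤ 1.04 * ‖Z‖ := by
      rw [ContinuousLinearMap.comp_apply]
      nlinarith [norm_nonneg Z]
    have := pow_le_pow_left₀ (norm_nonneg _) h3 2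
    nlinarith [sq_nonneg ‖Z‖]
  have hlow : ∀ Z : Mat q, rank Z ≤ r → ‖Z‖ ≤ 2 * ‖((Ls + C).comp M) Z‖ := by
    intro Z hZ
    have h1 : 0.97 * ‖M Z‖ ≤ ‖(Ls + C) (M Z)‖ :=
      perturbed_ge h.rip hC ((hM Z).trans_le (by omega))
    have h2 := hMu.ge Z
    rw [ContinuousLinearMap.comp_apply]
    nlinarith [norm_nonneg (M Z)]
  obtain ⟨Z, hZ⟩ := exists_isRankConstrainedMin hlow (Ls (X j))
  -- Transport costs `1.001 ^ 2`, and `4 / 3 * 1.001 ^ 2 ≤ 1.4`.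
  have htr : ∀ {Z' : Mat q}, IsStat ((Ls + C).comp M) (Ls (X j)) r (4 / 3) Z' →
      IsStat (Ls + C) (Ls (X j)) r 1.4 (M Z') := by
    intro Z' hZ'
    have h1 := hZ'.transport hM hMM' hM'M (by norm_num) hM''
    refine ⟨h1.1, fun W hW => (h1.2 W hW).trans ?_⟩
    exact mul_le_mul_of_nonneg_right (by norm_num) (by positivity)
  have hZs := hZ.isStat hup
  have huniq : ∀ Z', IsStat ((Ls + C).comp M) (Ls (X j)) r (4 / 3) Z' → Z' = Z := by
    intro Z' hZ'
    have h1 := IsStat.unique h.rip hC (h.cond j) le_rfl le_rfl (htr hZ') (htr hZs)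
    rw [← hM'M Z', h1, hM'M]
  refine ⟨Z, hZ, huniq, ?_, htr hZs, ?_⟩
  · rintro Z' (h1 | ⟨ν, hν, h1⟩)
    · exact huniq Z' (h1.isStat hup)
    · exact huniq Z' (h1.isStat hν.1)
  · have h1 := (htr hZs).norm_sub_le' h.rip hC (h.cond j) le_rfl
    have h2 := hC.eq_le
    have h3 := (h.cond j).pos
    have h4 := norm_sub_le_norm_sub_add_norm_sub (M Z) (X j) 0
    rw [sub_zero, sub_zero] at h4
    have h5 := hMu.ge Z
    have h6 : 5 * (e * q) * s ≤ s := by nlinarith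
    nlinarith [norm_nonneg (M Z), norm_nonneg (X j)]

/-- The solution of the least-squares problem. -/
lemma isLeastSquares_iff_of_covariance (hn : 1 ≤ n) {Xh : Fin n → Mat q} (hΛ : 0 < Λ)
    (hcov : ∀ Z, ‖covariance (fun j => M (Xh j)) Z - Λ • Z‖ ≤ Λ * (1 / 500) * ‖Z‖)
    {M' : MatOp q} (hM'M : ∀ Z, M' (M Z) = Z) {D : MatOp q}
    (hD : D.comp (covariance fun j => M (Xh j)) = updateRhs X (fun j => M (Xh j)))
    (L' : LMap q d) : IsLeastSquares (fun j => Ls (X j)) Xh L' ↔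
      L' = (Ls + Ls.comp D).comp M := by
  have hn0 : (n : ℝ)⁻¹ ≠ 0 := by positivity
  have hH : ∀ (H : LMap q d) j, H (Xh j) = (H.comp M') (M (Xh j)) := fun H j => by
    rw [ContinuousLinearMap.comp_apply, hM'M]
  refine isLeastSquares_iff (fun H => ?_) (fun H h0 => ?_) L'
  -- After the change of variables by `M`, the normal equations in `H` are the equation for `D`
  -- paired with `H ∘ M'`.
  · have h1 := hsInner_comp_updateRhs (H.comp M') Ls X (fun j => M (Xh j))
    rw [← hD, ← ContinuousLinearMap.comp_assoc, hsInner_comp_covariance, ← mul_neg] at h1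
    have h2 := mul_left_cancel₀ hn0 h1
    have h3 : ∑ j, ⟪Ls (X j) - ((Ls + Ls.comp D).comp M) (Xh j), H (Xh j)⟫_ℝ =
        -(∑ j, ⟪(H.comp M') (M (Xh j)), Ls (M (Xh j) - X j)⟫_ℝ) -
          ∑ j, ⟪(H.comp M') (M (Xh j)), (Ls.comp D) (M (Xh j))⟫_ℝ := by
      rw [← Finset.sum_neg_distrib, ← Finset.sum_sub_distrib]
      refine Finset.sum_congr rfl fun j _ => ?_
      rw [hH H j, ← inner_neg_right, ← inner_sub_right, real_inner_comm]
      congr 1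
      rw [map_sub]
      simp only [ContinuousLinearMap.comp_apply, add_apply]
      abel
    rw [h3, h2, sub_self]
  · have h1 : hsInner (H.comp M') ((H.comp M').comp (covariance fun j => M (Xh j))) = 0 := by
      rw [hsInner_comp_covariance]
      simp only [← hH, h0]
      simp
    have h2 := hsInner_comp_covariance_sub (H.comp M') (H.comp M') (fun j => M (Xh j)) Λ hΛ.le
      (by norm_num) hcov
    rw [h1, zero_sub, abs_neg, hsInner_self] at h2
    have h3 : Λ * hsNorm (H.comp M') ^ 2 ≤ Λ * (hsNorm (H.comp M') ^ 2 * (1 / 500)) := by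
      refine (le_abs_self _).trans (h2.trans_eq ?_); ring
    have h4 := le_of_mul_le_mul_left h3 hΛ
    have h5 : hsNorm (H.comp M') = 0 := by
      have : hsNorm (H.comp M') ^ 2 ≤ 0 := by linarith
      exact pow_eq_zero_iff (two_ne_zero) |>.mp (le_antisymm this (sq_nonneg _))
    ext1 Z
    have h6 := norm_apply_le_hsNorm (H.comp M') (M Z)
    rw [h5, zero_mul, ContinuousLinearMap.comp_apply, hM'M] at h6
    exact norm_le_zero_iff.mp h6

lemma rank_tangentOp_le (A B : Matrix (Fin q) (Fin q) ℝ) (X : Mat q) :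
    rank (tangentOp A B X) ≤ 2 * rank X := by
  have h1 := rank_add_le (lmul A X) (rmul B X)
  have h2 := rank_lmul_le A X
  have h3 := rank_rmul_le B X
  rw [tangentOp, add_apply]
  omega

lemma hsNorm_sandwich_le (A B : Matrix (Fin q) (Fin q) ℝ) :
    hsNorm (sandwich A B) ≤ ‖A‖ * ‖B‖ * q :=
  (hsNorm_le_of_op _).trans (mul_le_mul_of_nonneg_right (norm_sandwich_le A B) (Nat.cast_nonneg _))

/-- The part of an update tangent to the rank-preservers is absorbed in a rank-preserver. -/
lemma exists_absorbed_update (hr : 1 ≤ r) (hL : HasRIP r Ls) (hC : IsSmall e C) {D : MatOp q}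
    (h1 : hsNorm (Ls.comp D) ≤ 6 * e)
    (h2 : ∀ G : LMap q d, IsNormalTo Ls G → hsInner G (Ls.comp D) ≤ e / 4 * hsNorm G) :
    ∃ (C' : LMap q d) (N : MatOp q), IsRankPreserver N ∧ IsSmall (e / 2) C' ∧
      Ls + Ls.comp D = (Ls + C').comp N := by
  have he := hC.eq_le
  have he0 := hC.nonneg
  have he1 := hC.e_le
  obtain ⟨Cp, A₀, B₀, e1, hCp, -, hT⟩ := exists_normal_decomposition Ls (Ls.comp D)
  have hCpn : hsNorm Cp ≤ e / 4 := by
    -- Testing the contraction bound with `Cp` itself isolates its norm, the tangential part being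
    -- orthogonal to it.
    have h3 : hsNorm Cp * hsNorm Cp ≤ e / 4 * hsNorm Cp := by
      refine le_trans (le_of_eq ?_) (h2 Cp hCp)
      rw [e1, hsInner_add_right, hCp, add_zero, hsInner_self, sq]
    rcases (hsNorm_nonneg Cp).eq_or_lt with h0 | h0
    · rw [← h0]; linarith
    · exact le_of_mul_le_mul_right h3 h0
  obtain ⟨A, B, hAB, hA, hB⟩ := exists_small_coefficients hC.pos_dim A₀ B₀
  rw [← hAB] at e1 hT hA hB
  set w := hsNorm (tangentOp A B) with hw
  have hwe : w ≤ 6.2 * e := by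
    have h3 := (hsNorm_comp_le_of_rank hL (tangentOp A B) fun p =>
      (rank_tangentOp_le A B _).trans (by have := rank_single_le p; omega)).2
    have h4 := h3.trans (hT.trans h1)
    linarith
  have hw0 : 0 ≤ w := hsNorm_nonneg _
  obtain ⟨A', a1, a2, a3⟩ := exists_inverse_near_one (A := 1 + A) (β := w)
    (by rw [add_sub_cancel_left]; exact hA) (by linarith)
  obtain ⟨B', b1, b2, b3⟩ := exists_inverse_near_one (A := 1 + B) (β := 2 * w)
    (by rw [add_sub_cancel_left]; exact hB) (by linarith)
  -- Since `(1 + A) Z (1 + B) = Z + T Z + A Z B`, the error left after factoring out this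
  -- rank-preserver is `Cp` minus the quadratic term, composed with the inverse.
  refine ⟨(Cp - Ls.comp (sandwich A B)).comp (sandwich A' B'), sandwich (1 + A) (1 + B),
    isRankPreserver_sandwich a2 b1, ?_, ?_⟩
  · refine ⟨by positivity, hC.pos_dim, ?_, hC.dim_two, ?_⟩
    · have := hC.small
      have : 0 ≤ e * (q : ℝ) ^ 2 := by positivity
      linarith
    · have h3 : hsNorm (Ls.comp (sandwich A B)) ≤ 1.025 * hsNorm (sandwich A B) :=
        (hsNorm_comp_le_of_rank hL _ fun p =>
          (rank_sandwich_le A B _).trans ((rank_single_le p).trans (by omega))).1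
      have h4 : hsNorm (sandwich A B) ≤ (6.2 * e) * (12.4 * e) * q := by
        refine (hsNorm_sandwich_le A B).trans (mul_le_mul_of_nonneg_right ?_ (Nat.cast_nonneg _))
        exact mul_le_mul (hA.trans hwe) (hB.trans (by linarith)) (norm_nonneg _) (by positivity)
      have h5 : hsNorm (sandwich A B) ≤ 0.001 * e := by
        refine h4.trans ?_
        have : (6.2 * e) * (12.4 * e) * q = 76.88 * (e * q) * e := by ring
        rw [this]
        exact mul_le_mul_of_nonneg_right (by linarith) he0
      have h6 : ‖sandwich A' B'‖ ≤ 1.01 := by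
        refine (norm_sandwich_le _ _).trans ((mul_le_mul a3 b3 (norm_nonneg _)
          (by positivity)).trans ?_)
        nlinarith
      have h7 := hsNorm_sub_le Cp (Ls.comp (sandwich A B))
      refine (hsNorm_comp_right_le _ _).trans ?_
      have h8 : hsNorm (Cp - Ls.comp (sandwich A B)) ≤ 0.26 * e := by linarith
      exact (mul_le_mul h8 h6 (norm_nonneg _) (by positivity)).trans (by linarith)
  · have e2 : ∀ Z, sandwich (1 + A) (1 + B) Z = Z + tangentOp A B Z + sandwich A B Z := by
      intro Z
      refine toMat_injective ?_
      simp only [toMat_sandwich, toMat_add, tangentOp, add_apply, toMat_lmul, toMat_rmul]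
      noncomm_ring
    rw [e1]
    ext1 Z
    simp only [ContinuousLinearMap.comp_apply, add_apply, sub_apply, sandwich_sandwich]
    rw [a2, b1, mul_one, one_mul, sandwich_one_one, e2]
    simp only [map_add]
    abel

/-! ### Normalization and assembly of a complete pass -/

lemma isSinkhornOutput_of_tendsto {L : LMap q d} {b : Fin d → Matrix (Fin q) (Fin q) ℝ}
    (h : Tendsto (fun k => (fun A => sinkhornCol (sinkhornRow A))^[k] (component L)) atTop
      (𝓝 b)) : IsSinkhornOutput L (ofComponents b) :=
  (continuous_ofComponents.tendsto b).comp h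

lemma IsSinkhornOutput.tendsto {L L' : LMap q d} (h : IsSinkhornOutput L L') :
    Tendsto (fun k => (fun A => sinkhornCol (sinkhornRow A))^[k] (component L)) atTop
      (𝓝 (component L')) := by
  have := (continuous_component.tendsto L').comp h
  simpa [Function.comp_def] using this

lemma norm_sandwich_apply_sub_le {G H : Matrix (Fin q) (Fin q) ℝ} {β : ℝ} (hG : ‖G - 1‖ ≤ β)
    (hH : ‖H - 1‖ ≤ β) (hβ : β ≤ 1 / 10) :
    ‖sandwich G H - ContinuousLinearMap.id ℝ (Mat q)‖ ≤ 2.1 * β := by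
  have hβ0 : 0 ≤ β := (norm_nonneg _).trans hG
  have e : sandwich G H - ContinuousLinearMap.id ℝ (Mat q) =
      sandwich (G - 1) H + sandwich 1 (H - 1) := by
    ext1 Z
    refine toMat_injective ?_
    simp only [sub_apply, add_apply, toMat_sub, toMat_add, toMat_sandwich,
      ContinuousLinearMap.id_apply]
    noncomm_ring
  rw [e]
  have h1 := norm_one_le (q := q)
  have h2 := norm_add_le (H - 1) 1
  rw [sub_add_cancel] at h2
  have h3 : ‖sandwich (G - 1) H‖ ≤ β * (1 + β) := (norm_sandwich_le _ _).trans
    (mul_le_mul hG (by linarith) (norm_nonneg _) hβ0)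
  have h4 : ‖sandwich 1 (H - 1)‖ ≤ 1 * β := (norm_sandwich_le _ _).trans
    (mul_le_mul h1 hH (norm_nonneg _) zero_le_one)
  refine (norm_add_le _ _).trans ((add_le_add h3 h4).trans ?_)
  nlinarith

/-- Normalization of a map close to a normalized one. -/
lemma exists_sinkhornOutput (hq : 1 ≤ q) {Lt : LMap q d} {κ : ℝ} (hκ : κ ≤ 1 / 2000)
    (hn : IsNearIso 0.06 (component Lt)) (hrow : ‖rowOp (component Lt) 1 - 1‖ ≤ κ)
    (hcol : ‖colOp (component Lt) 1 - 1‖ ≤ κ) :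
    ∃ N : MatOp q, IsRankPreserver N ∧ ‖N - ContinuousLinearMap.id ℝ (Mat q)‖ ≤ 17 * κ ∧
      IsSinkhornOutput Lt (Lt.comp N) ∧ IsNormalized (Lt.comp N) := by
  have hκ0 : 0 ≤ κ := (norm_nonneg _).trans hrow
  obtain ⟨G, H, hG, hH, h1, h2, -, -, h3⟩ := sinkhorn_converges hq hn hκ hrow hcol
  have e : component (Lt.comp (sandwich G.transpose H.transpose)) =
      fun i => G * component Lt i * H := by
    rw [component_comp_sandwich]; simp
  have hG' := hG
  have hH' := hH
  rw [← norm_transpose_sub_one] at hG' hH'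
  obtain ⟨A, -, a2, -⟩ := exists_inverse_near_one hG' (by linarith)
  obtain ⟨B, b1, -, -⟩ := exists_inverse_near_one hH' (by linarith)
  refine ⟨sandwich G.transpose H.transpose, isRankPreserver_sandwich a2 b1,
    (norm_sandwich_apply_sub_le hG' hH' (by linarith)).trans (by linarith), ?_, ?_⟩
  · rw [← ofComponents_component (Lt.comp _), e]
    refine isSinkhornOutput_of_tendsto ?_
    rw [tendsto_iff_norm_sub_tendsto_zero]
    refine squeeze_zero (fun _ => norm_nonneg _) h3 ?_
    simpa using (tendsto_pow_atTop_nhds_zero_of_lt_one (r := (1 / 2 : ℝ)) (by norm_num)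
      (by norm_num)).mul_const ‖component Lt‖
  · rw [isNormalized_iff hq, e]; exact ⟨h1, h2⟩

/-- The data of one pass of the algorithm started at `L`. -/
structure IsPass (Ls : LMap q d) (r : ℕ) (s : ℝ) (X : Fin n → Mat q) (e : ℝ) (L : LMap q d)
    (Xh : Fin n → Mat q) (Lt L' : LMap q d) : Prop where
  isMin : ∀ j, IsRankConstrainedMin L (Ls (X j)) r (Xh j)
  stat_unique : ∀ j Z, IsStat L (Ls (X j)) r (4 / 3) Z → Z = Xh j
  isStat : ∀ j, IsStat L (Ls (X j)) r (4 / 3) (Xh j)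
  update_unique : ∀ j Z, IsLowRankUpdate L (Ls (X j)) r Z → Z = Xh j
  norm_le : ∀ j, ‖Xh j‖ ≤ 2 * (‖X j‖ + s)
  leastSquares_iff : ∀ L'', IsLeastSquares (fun j => Ls (X j)) Xh L'' ↔ L'' = Lt
  norm_le' : ‖Lt‖ ≤ 2 * (‖Ls‖ + 1)
  nearIso : IsNearIso 0.06 (component Lt)
  row : ‖rowOp (component Lt) 1 - 1‖ ≤ 1 / 2000
  col : ‖colOp (component Lt) 1 - 1‖ ≤ 1 / 2000
  output : IsSinkhornOutput Lt L'
  isPerturbation : IsPerturbation Ls (e / 2) L'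
  norm_sub_le : ‖L' - L‖ ≤ 600 * (‖Ls‖ + 1) * e

/-- The new map is `(Ls + C') ∘ N ∘ M ∘ N'`: `M` comes from the old map, `N` absorbs the tangential
part of the least-squares update, and `N'` is the normalization. -/
theorem IsPerturbation.exists_pass (hn : 1 ≤ n) (h : IsEnsemble r s Λ Ls X Y)
    (hLs : IsNormalized Ls) (hL : IsPerturbation Ls e L) :
    ∃ Xh Lt L', IsPass Ls r s X e L Xh Lt L' := by
  obtain ⟨hLn, C, M, hM, hC, hLe⟩ := hL
  have he := hC.e_le
  have he0 := hC.nonneg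
  have hMo := hM.isNearOrthogonal h.one_le h.rip hC hLs (hLe ▸ hLn)
  have hMu : IsNearUnitary (10 * e) M := by
    obtain ⟨h1, h2, M', h3, h4, h5, h6⟩ := hMo.isNearUnitary (by linarith)
    exact ⟨h1, h2.trans (by linarith), M', h3, h4, h5, h6.trans (by linarith)⟩
  choose Xh hmin hstat hup hXt hbd using exists_lowRankUpdate h hM hC hMu
  rw [← hLe] at hmin hstat hup
  have hcov := h.covariance_update hC le_rfl hXt
  obtain ⟨D, hD⟩ := exists_solution_of_covariance h.pos hcov (updateRhs X fun j => M (Xh j))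
  have hD1 := h.hsNorm_update_le hC le_rfl hXt hD
  have hD2 := fun G hG => h.hsInner_update_le hC le_rfl hXt hD (G := G) hG
  obtain ⟨M', -, hMM', hM'M, -⟩ := hMu.exists_inverse
  have hls := isLeastSquares_iff_of_covariance (Ls := Ls) hn h.pos hcov hM'M hD
  obtain ⟨C', N, hN, hC', hDe⟩ := exists_absorbed_update h.one_le h.rip hC hD1 hD2
  set Lt := (Ls + Ls.comp D).comp M with hLt
  have hDle : ∀ Z, ‖(Ls.comp D) Z‖ ≤ 6 * e * ‖Z‖ := fun Z =>
    (norm_apply_le_hsNorm _ Z).trans (mul_le_mul_of_nonneg_right hD1 (norm_nonneg _))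
  have hiso : IsNearIso 0.06 (component Lt) :=
    isNearIso_component h.one_le h.rip hMu (by linarith) (by linarith) hDle
  have hdiff : ∀ Z, ‖(Lt - L) Z‖ ≤ 7.1 * e * ‖Z‖ := by
    intro Z
    have e1 : (Lt - L) Z = (Ls.comp D) (M Z) - C (M Z) := by
      rw [hLt, hLe]
      simp only [sub_apply, ContinuousLinearMap.comp_apply, add_apply]
      abel
    rw [e1]
    have h1 := norm_sub_le ((Ls.comp D) (M Z)) (C (M Z))
    have h2 := hDle (M Z)
    have h3 := hC.le_mul (M Z)
    have h4 := hMu.le Z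
    have h5 : 7 * e * ‖M Z‖ ≤ 7 * e * ((1 + 10 * e) * ‖Z‖) :=
      mul_le_mul_of_nonneg_left h4 (by positivity)
    have h6 : 0 ≤ e * ‖Z‖ := by positivity
    nlinarith
  have hL1 : ∀ Z : Mat q, rank Z ≤ 1 → ‖L Z‖ ≤ 1.04 * ‖Z‖ := by
    intro Z hZ
    have h1 : ‖(Ls + C) (M Z)‖ ≤ 1.03 * ‖M Z‖ :=
      perturbed_le h.rip hC ((hM Z).trans_le (by have := h.one_le; omega))
    have h2 := hMu.le Z
    rw [hLe, ContinuousLinearMap.comp_apply]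
    nlinarith [norm_nonneg Z]
  have hLn' := (isNormalized_iff hC.pos_dim L).mp hLn
  have hrow := norm_rowOp_component_sub_le (by linarith) hL1 (fun Z _ => hdiff Z) (by positivity)
  have hcol := norm_colOp_component_sub_le (by linarith) hL1 (fun Z _ => hdiff Z) (by positivity)
  rw [hLn'.1] at hrow
  rw [hLn'.2] at hcol
  -- `L` is exactly normalized and `Lt` differs from it by `7.1 e`; the defect is at most `2.1 * 7.1
  -- e < 15 e`.
  obtain ⟨N', hN', hN'1, hout, hnorm⟩ := exists_sinkhornOutput hC.pos_dim (κ := 15 * e)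
    (by linarith) hiso (hrow.trans (by linarith)) (hcol.trans (by linarith))
  have hLtn : ‖Lt‖ ≤ 2 * (‖Ls‖ + 1) := by
    have h1 : ‖Ls.comp D‖ ≤ 6 * e := (norm_le_hsNorm _).trans hD1
    have h2 := norm_add_le Ls (Ls.comp D)
    have h3 := hMu.norm_le
    calc ‖Lt‖ ≤ ‖Ls + Ls.comp D‖ * ‖M‖ := ContinuousLinearMap.opNorm_comp_le _ _
      _ ≤ (‖Ls‖ + 1) * 2 := mul_le_mul (by linarith) (by linarith) (norm_nonneg _) (by positivity)
      _ = _ := by ring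
  refine ⟨Xh, Lt, Lt.comp N', ⟨hmin, hstat, fun j => ?_, hup, hbd, hls, hLtn, hiso,
    hrow.trans (by linarith), hcol.trans (by linarith), hout, ⟨hnorm, C', (N.comp M).comp N',
      (hN.comp hM).comp hN', hC', ?_⟩, ?_⟩⟩
  · refine (hmin j).isStat fun Z hZ => ?_
    have h1 : ‖(Ls + C) (M Z)‖ ≤ 1.03 * ‖M Z‖ :=
      perturbed_le h.rip hC ((hM Z).trans_le (by omega))
    have h2 := hMu.le Z
    have h3 : ‖L Z‖ ≤ 1.04 * ‖Z‖ := by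
      rw [hLe, ContinuousLinearMap.comp_apply]
      nlinarith [norm_nonneg Z]
    have := pow_le_pow_left₀ (norm_nonneg _) h3 2
    nlinarith [sq_nonneg ‖Z‖]
  · rw [hLt, hDe]; rfl
  · have e1 : Lt.comp N' - L = Lt.comp (N' - ContinuousLinearMap.id ℝ (Mat q)) + (Lt - L) := by
      rw [ContinuousLinearMap.comp_sub, ContinuousLinearMap.comp_id]; abel
    rw [e1]
    have h1 : ‖Lt.comp (N' - ContinuousLinearMap.id ℝ (Mat q))‖ ≤ (2 * (‖Ls‖ + 1)) * (255 * e) :=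
      (ContinuousLinearMap.opNorm_comp_le _ _).trans
        (mul_le_mul hLtn (hN'1.trans (by linarith)) (norm_nonneg _) (by positivity))
    have h2 : ‖Lt - L‖ ≤ 7.1 * e :=
      ContinuousLinearMap.opNorm_le_bound _ (by positivity) hdiff
    refine (norm_add_le _ _).trans ((add_le_add h1 h2).trans ?_)
    have : 0 ≤ ‖Ls‖ * e := by positivity
    nlinarith

lemma IsPass.isUpdate_iff {Xh : Fin n → Mat q} {Lt L' : LMap q d}
    (h : IsPass Ls r s X e L Xh Lt L') (L'' : LMap q d) :
    IsUpdate (fun j => Ls (X j)) r L L'' ↔ L'' = L' := by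
  constructor
  · rintro ⟨Xh', Lt', h1, h2, h3⟩
    have e1 : Xh' = Xh := funext fun j => h.update_unique j _ (h1 j)
    rw [e1, h.leastSquares_iff] at h2
    rw [h2] at h3
    exact tendsto_nhds_unique h3 h.output
  · rintro rfl
    exact ⟨Xh, Lt, fun j => Or.inl (h.isMin j), (h.leastSquares_iff _).mpr rfl, h.output⟩

end

/-! ### Orthogonal operators and the regularizer -/

section
variable {M : MatOp q}

lemma charpoly_toEuclideanLin (A : Matrix (Fin q) (Fin q) ℝ) :
    (Matrix.toEuclideanLin A).charpoly = A.charpoly := by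
  rw [Matrix.toEuclideanLin_eq_toLin_orthonormal, Matrix.charpoly_toLin]

/-- Singular values are determined by the characteristic polynomial of the Gram matrix, which makes
their orthogonal invariance pure algebra. -/
lemma sigma_eq_of_charpoly {X Z : Mat q}
    (h : ((toMat X).transpose * toMat X).charpoly = ((toMat Z).transpose * toMat Z).charpoly)
    (k : ℕ) : sigma k X = sigma k Z := by
  have hf := finrank_euclideanSpace_fin (𝕜 := ℝ) (n := q)
  rw [sigma, sigma]
  by_cases hk : k - 1 < q
  · rw [LinearMap.singularValues_of_lt _ hf hk, LinearMap.singularValues_of_lt _ hf hk]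
    congr 1
    refine congrFun ?_ _
    rw [LinearMap.IsSymmetric.eigenvalues_eq_eigenvalues_iff, toEuclideanLin_transpose_mul_self,
      toEuclideanLin_transpose_mul_self, charpoly_toEuclideanLin, charpoly_toEuclideanLin, h]
  · rw [LinearMap.singularValues_of_finrank_le _ (by rw [hf]; omega),
      LinearMap.singularValues_of_finrank_le _ (by rw [hf]; omega)]

lemma eq_one_of_norm_sub_le {A : Matrix (Fin q) (Fin q) ℝ} (h : ‖A - 1‖ ≤ 0) : A = 1 :=
  sub_eq_zero.mp (norm_le_zero_iff.mp h)

lemma sigma_sandwich {U V : Matrix (Fin q) (Fin q) ℝ} (hU : U * U.transpose = 1)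
    (hV : V.transpose * V = 1) (k : ℕ) (X : Mat q) : sigma k (sandwich U V X) = sigma k X := by
  refine sigma_eq_of_charpoly ?_ k
  have hU' : U.transpose * U = 1 := mul_eq_one_comm.mp hU
  have hV' : V * V.transpose = 1 := mul_eq_one_comm.mp hV
  rw [toMat_sandwich, Matrix.transpose_mul, Matrix.transpose_mul]
  have : V.transpose * ((toMat X).transpose * U.transpose) * (U * toMat X * V) =
      V.transpose * ((toMat X).transpose * (U.transpose * U) * toMat X * V) := by noncomm_ring
  rw [this, hU', mul_one, Matrix.charpoly_mul_comm, mul_assoc, hV', mul_one]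

lemma sigma_transposeOp (k : ℕ) (X : Mat q) : sigma k (transposeOp q X) = sigma k X := by
  refine sigma_eq_of_charpoly ?_ k
  rw [toMat_transposeOp, Matrix.transpose_transpose, Matrix.charpoly_mul_comm]

lemma IsNearOrthogonal.sigma_eq (h : IsNearOrthogonal 0 M) (k : ℕ) (X : Mat q) :
    sigma k (M X) = sigma k X := by
  obtain ⟨U, V, hU, hV, rfl | rfl⟩ := h
  · exact sigma_sandwich (eq_one_of_norm_sub_le hU) (eq_one_of_norm_sub_le hV) k X
  · rw [ContinuousLinearMap.comp_apply, sigma_sandwich (eq_one_of_norm_sub_le hU)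
      (eq_one_of_norm_sub_le hV), sigma_transposeOp]

lemma IsNearOrthogonal.nuclearNorm_eq (h : IsNearOrthogonal 0 M) (X : Mat q) :
    nuclearNorm (M X) = nuclearNorm X :=
  Finset.sum_congr rfl fun k _ => h.sigma_eq k X

lemma IsNearOrthogonal.regularizerBall_comp (h : IsNearOrthogonal 0 M) (L : LMap q d) :
    regularizerBall (L.comp M) = regularizerBall L := by
  obtain ⟨M', -, h1, -, -⟩ := (h.isNearUnitary (by norm_num)).exists_inverse
  ext z
  constructor
  · rintro ⟨X, hX, rfl⟩
    exact ⟨M X, (h.nuclearNorm_eq X).trans_le hX, rfl⟩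
  · rintro ⟨X, hX, rfl⟩
    refine ⟨M' X, ?_, by rw [ContinuousLinearMap.comp_apply, h1]⟩
    show nuclearNorm (M' X) ≤ 1
    rw [← h.nuclearNorm_eq, h1]
    exact hX

lemma continuous_sandwich : Continuous fun p : Matrix (Fin q) (Fin q) ℝ ×
    Matrix (Fin q) (Fin q) ℝ => sandwich p.1 p.2 := by
  rw [continuous_clm_apply]
  intro Z
  have : (fun p : Matrix (Fin q) (Fin q) ℝ × Matrix (Fin q) (Fin q) ℝ => sandwich p.1 p.2 Z) =
      fun p => ofMat (p.1 * toMat Z * p.2) := by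
    funext p
    exact toMat_injective (by rw [toMat_sandwich, toMat_ofMat])
  rw [this]
  exact continuous_ofMat.comp (by fun_prop)

/-- Sequential compactness of the set of nearly orthogonal operators. -/
lemma exists_subseq_nearOrthogonal {M : ℕ → MatOp q} {β : ℕ → ℝ}
    (h : ∀ k, IsNearOrthogonal (β k) (M k)) (hβ : Tendsto β atTop (𝓝 0)) (hβ1 : ∀ k, β k ≤ 1) :
    ∃ (M₀ : MatOp q) (φ : ℕ → ℕ), StrictMono φ ∧ IsNearOrthogonal 0 M₀ ∧
      Tendsto (M ∘ φ) atTop (𝓝 M₀) := by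
  -- The `Bool` records whether a transposition occurs, so that both types of operators form one
  -- compactly parametrized family.
  let op : (Matrix (Fin q) (Fin q) ℝ × Matrix (Fin q) (Fin q) ℝ) × Bool → MatOp q :=
    fun p => bif p.2 then sandwich p.1.1 p.1.2 else (sandwich p.1.1 p.1.2).comp (transposeOp q)
  have hop : Continuous op := by
    rw [continuous_prod_of_discrete_right]
    rintro (_ | _)
    · exact continuous_sandwich.clm_comp continuous_const
    · exact continuous_sandwich
  have hex : ∀ k, ∃ p : (Matrix (Fin q) (Fin q) ℝ × Matrix (Fin q) (Fin q) ℝ) × Bool,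
      ‖p.1.1 * p.1.1.transpose - 1‖ ≤ β k ∧ ‖p.1.2.transpose * p.1.2 - 1‖ ≤ β k ∧
        M k = op p := by
    intro k
    obtain ⟨U, V, hU, hV, h1 | h1⟩ := h k
    · exact ⟨((U, V), true), hU, hV, h1⟩
    · exact ⟨((U, V), false), hU, hV, h1⟩
  choose p hU hV hM using hex
  have hcomp : IsCompact ((Metric.closedBall (0 : Matrix (Fin q) (Fin q) ℝ) 2 ×ˢ
      Metric.closedBall (0 : Matrix (Fin q) (Fin q) ℝ) 2) ×ˢ (Set.univ : Set Bool)) :=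
    ((isCompact_closedBall _ _).prod (isCompact_closedBall _ _)).prod isCompact_univ
  obtain ⟨p₀, -, φ, hφ, hlim⟩ := hcomp.tendsto_subseq (x := p) fun k => by
    refine ⟨⟨?_, ?_⟩, trivial⟩
    · rw [mem_closedBall_zero_iff]
      have := norm_le_of_mul_transpose zero_le_one ((hU k).trans (hβ1 k))
      linarith
    · rw [mem_closedBall_zero_iff, ← norm_transpose]
      have := norm_le_of_mul_transpose (U := (p k).1.2.transpose) zero_le_one
        (by rw [Matrix.transpose_transpose]; exact (hV k).trans (hβ1 k))
      linarith
  refine ⟨op p₀, φ, hφ, ⟨p₀.1.1, p₀.1.2, ?_, ?_, ?_⟩, ?_⟩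
  · refine le_of_tendsto_of_tendsto ?_ (hβ.comp hφ.tendsto_atTop) (.of_forall fun k => hU (φ k))
    have : Continuous fun p : (Matrix (Fin q) (Fin q) ℝ × Matrix (Fin q) (Fin q) ℝ) × Bool =>
      ‖p.1.1 * p.1.1.transpose - 1‖ := by fun_prop
    exact (this.tendsto p₀).comp hlim
  · refine le_of_tendsto_of_tendsto ?_ (hβ.comp hφ.tendsto_atTop) (.of_forall fun k => hV (φ k))
    have : Continuous fun p : (Matrix (Fin q) (Fin q) ℝ × Matrix (Fin q) (Fin q) ℝ) × Bool =>
      ‖p.1.2.transpose * p.1.2 - 1‖ := by fun_prop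
    exact (this.tendsto p₀).comp hlim
  · obtain ⟨⟨U, V⟩, _ | _⟩ := p₀
    · exact Or.inr rfl
    · exact Or.inl rfl
  · have : M ∘ φ = op ∘ (p ∘ φ) := funext fun k => hM (φ k)
    rw [this]
    exact (hop.tendsto p₀).comp hlim

end

/-! ### Convergence of the algorithm -/

section
variable {r : ℕ} {s Λ e : ℝ} {Ls L L₀ : LMap q d} {X : Fin n → Mat q}
  {Y : Fin n → Matrix (Fin q) (Fin q) ℝ}

/-- The iterates and the data of all passes of the algorithm. -/
structure IsTrace (Ls : LMap q d) (r : ℕ) (s : ℝ) (X : Fin n → Mat q) (e : ℝ)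
    (L : ℕ → LMap q d) : Prop where
  isPerturbation : ∀ t, IsPerturbation Ls (e / 2 ^ t) (L t)
  exists_pass : ∀ t, ∃ Xh Lt, IsPass Ls r s X (e / 2 ^ t) (L t) Xh Lt (L (t + 1))

theorem IsPerturbation.exists_trace (hn : 1 ≤ n) (h : IsEnsemble r s Λ Ls X Y)
    (hLs : IsNormalized Ls) (hL : IsPerturbation Ls e L₀) :
    ∃ L : ℕ → LMap q d, L 0 = L₀ ∧ IsTrace Ls r s X e L := by
  have hstep : ∀ (t : ℕ) (L : LMap q d), IsPerturbation Ls (e / 2 ^ t) L →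
      ∃ L' : LMap q d, IsPerturbation Ls (e / 2 ^ (t + 1)) L' ∧
        ∃ Xh Lt, IsPass Ls r s X (e / 2 ^ t) L Xh Lt L' := by
    intro t L hL
    obtain ⟨Xh, Lt, L', h1⟩ := hL.exists_pass hn h hLs
    refine ⟨L', ?_, Xh, Lt, h1⟩
    rw [pow_succ, ← div_div]; exact h1.isPerturbation
  choose f hf hf' using hstep
  let p : (t : ℕ) → {L : LMap q d // IsPerturbation Ls (e / 2 ^ t) L} :=
    fun t => Nat.rec ⟨L₀, by simpa using hL⟩ (fun t p => ⟨f t p.1 p.2, hf t p.1 p.2⟩) t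
  exact ⟨fun t => (p t).1, rfl, fun t => (p t).2, fun t => hf' t (p t).1 (p t).2⟩

lemma IsTrace.isRun {L : ℕ → LMap q d} (h : IsTrace Ls r s X e L) :
    IsRun (fun j => Ls (X j)) r (L 0) L := by
  refine ⟨rfl, fun t => ?_⟩
  obtain ⟨Xh, Lt, h1⟩ := h.exists_pass t
  exact (h1.isUpdate_iff _).mpr rfl

lemma IsTrace.eq_of_isRun {L L' : ℕ → LMap q d} (h : IsTrace Ls r s X e L)
    (h' : IsRun (fun j => Ls (X j)) r (L 0) L') : L' = L := by
  funext t
  induction t with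
  | zero => exact h'.1
  | succ t ih =>
    obtain ⟨Xh, Lt, h1⟩ := h.exists_pass t
    have h2 := h'.2 t
    rw [ih, h1.isUpdate_iff] at h2
    exact h2

lemma IsTrace.dist_succ_le {L : ℕ → LMap q d} (h : IsTrace Ls r s X e L) (t : ℕ) :
    dist (L t) (L (t + 1)) ≤ 1200 * (‖Ls‖ + 1) * e / 2 / 2 ^ t := by
  obtain ⟨Xh, Lt, h1⟩ := h.exists_pass t
  rw [dist_eq_norm, norm_sub_rev]
  exact h1.norm_sub_le.trans_eq (by ring)

lemma IsTrace.cauchySeq {L : ℕ → LMap q d} (h : IsTrace Ls r s X e L) : CauchySeq L :=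
  cauchySeq_of_le_geometric_two h.dist_succ_le

/-- The iterates are Cauchy, so the limit may be identified along a subsequence on which the
rank-preservers converge. The perturbations vanish, and the orthogonality defects `7 e / 2 ^ t` tend
to zero. -/
theorem IsTrace.exists_limit {L : ℕ → LMap q d} (h : IsTrace Ls r s X e L) (hr : 1 ≤ r)
    (hL : HasRIP r Ls) (hLs : IsNormalized Ls) :
    ∃ M : MatOp q, IsNearOrthogonal 0 M ∧ Tendsto L atTop (𝓝 (Ls.comp M)) := by
  obtain ⟨Lhat, hlim⟩ := cauchySeq_tendsto_of_complete h.cauchySeq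
  choose hn C M hM hC hLe using h.isPerturbation
  have hMo := fun t => (hM t).isNearOrthogonal hr hL (hC t) hLs (hLe t ▸ hn t)
  have hz : Tendsto (fun t : ℕ => e / 2 ^ t) atTop (𝓝 0) := by
    have := (tendsto_pow_atTop_nhds_zero_of_lt_one (r := (1 / 2 : ℝ)) (by norm_num)
      (by norm_num)).const_mul e
    simpa [div_eq_mul_inv] using this
  have hz' : Tendsto (fun t : ℕ => 7 * (e / 2 ^ t)) atTop (𝓝 0) := by
    simpa using hz.const_mul 7
  obtain ⟨M₀, φ, hφ, hM₀, hMlim⟩ := exists_subseq_nearOrthogonal hMo hz' fun t => by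
    have := (hC t).e_le; linarith
  refine ⟨M₀, hM₀, ?_⟩
  have hC0 : Tendsto C atTop (𝓝 0) := by
    rw [tendsto_zero_iff_norm_tendsto_zero]
    exact squeeze_zero (fun _ => norm_nonneg _)
      (fun t => (norm_le_hsNorm _).trans (hC t).hs_le) hz
  have h1 : Tendsto (L ∘ φ) atTop (𝓝 ((Ls + 0).comp M₀)) := by
    have h2 : L ∘ φ = fun k => (Ls + C (φ k)).comp (M (φ k)) := funext fun k => hLe (φ k)
    rw [h2]
    have h3 : Continuous fun p : LMap q d × MatOp q => p.1.comp p.2 :=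
      continuous_fst.clm_comp continuous_snd
    exact (h3.tendsto (Ls + 0, M₀)).comp
      (((hC0.comp hφ.tendsto_atTop).const_add Ls).prodMk_nhds hMlim)
  rw [add_zero] at h1
  rwa [← tendsto_nhds_unique (hlim.comp hφ.tendsto_atTop) h1]

end

/-! ### Continuity of the limit in the initial guess -/

/-- A family in a compact set with a single possible cluster point converges. Continuity of the
update steps thus follows from uniqueness of their solutions. -/
lemma tendsto_of_isCompact_of_unique {ι E : Type*} [TopologicalSpace E] {l : Filter ι} {f : ι → E}
    {x : E} {K : Set E} (hK : IsCompact K) (hf : ∀ i, f i ∈ K)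
    (h : ∀ (u : Filter ι) [NeBot u], u ≤ l → ∀ y, Tendsto f u (𝓝 y) → y = x) :
    Tendsto f l (𝓝 x) := by
  rw [tendsto_iff_ultrafilter]
  intro g hg
  obtain ⟨y, -, hy⟩ := hK.ultrafilter_le_nhds (g.map f)
    (le_principal_iff.mpr (Eventually.of_forall (f := (g : Filter ι)) hf))
  have hy' : Tendsto f g (𝓝 y) := hy
  rwa [← h g hg y hy']

section
variable {r : ℕ} {s Λ e : ℝ} {Ls L L₀ : LMap q d} {X : Fin n → Mat q}
  {Y : Fin n → Matrix (Fin q) (Fin q) ℝ} {ι : Type*} {l : Filter ι}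

lemma IsStat.of_tendsto {u : Filter ι} [NeBot u] {K : ι → LMap q d} {Z : ι → Mat q} {κ : ℝ}
    {Z₀ : Mat q} {y : EuclideanSpace ℝ (Fin d)} (h : ∀ i, IsStat (K i) y r κ (Z i))
    (hK : Tendsto K u (𝓝 L)) (hZ : Tendsto Z u (𝓝 Z₀)) : IsStat L y r κ Z₀ := by
  refine ⟨(isClosed_rank_le r).mem_of_tendsto hZ (.of_forall fun i => (h i).1), fun W hW => ?_⟩
  have hc : Continuous fun p : LMap q d × Mat q =>
      2 * ⟪p.1 (W - p.2), y - p.1 p.2⟫_ℝ := by fun_prop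
  have hc' : Continuous fun z : Mat q => κ * ‖W - z‖ ^ 2 := by fun_prop
  exact le_of_tendsto_of_tendsto ((hc.tendsto (L, Z₀)).comp (hK.prodMk_nhds hZ))
    ((hc'.tendsto Z₀).comp hZ) (.of_forall fun i => (h i).2 W hW)

lemma IsLeastSquares.of_tendsto {u : Filter ι} [NeBot u] {K : ι → LMap q d}
    {Z : ι → Fin n → Mat q} {Z₀ : Fin n → Mat q} {y : Fin n → EuclideanSpace ℝ (Fin d)}
    (h : ∀ i, IsLeastSquares y (Z i) (K i))
    (hK : Tendsto K u (𝓝 L)) (hZ : Tendsto Z u (𝓝 Z₀)) : IsLeastSquares y Z₀ L := by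
  intro L'
  have hc : Continuous fun p : LMap q d × (Fin n → Mat q) =>
      ∑ j, ‖y j - p.1 (p.2 j)‖ ^ 2 := by fun_prop
  have hc' : Continuous fun z : Fin n → Mat q => ∑ j, ‖y j - L' (z j)‖ ^ 2 := by fun_prop
  exact le_of_tendsto_of_tendsto ((hc.tendsto (L, Z₀)).comp (hK.prodMk_nhds hZ))
    ((hc'.tendsto Z₀).comp hZ) (.of_forall fun i => h i L')

/-- Low-rank updates and least-squares solutions are bounded, and their limits solve the limiting
problems, whose solutions are unique. Normalization is continuous by `tendsto_sinkhorn_limit`. -/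
lemma IsPass.tendsto (hq : 1 ≤ q) {K : ι → LMap q d} {Xh : ι → Fin n → Mat q}
    {Lt K' : ι → LMap q d} {Xh₀ : Fin n → Mat q} {Lt₀ L' : LMap q d}
    (h : ∀ i, IsPass Ls r s X e (K i) (Xh i) (Lt i) (K' i))
    (h₀ : IsPass Ls r s X e L Xh₀ Lt₀ L') (hK : Tendsto K l (𝓝 L)) : Tendsto K' l (𝓝 L') := by
  have hX : Tendsto Xh l (𝓝 Xh₀) := by
    rw [tendsto_pi_nhds]
    intro j
    refine tendsto_of_isCompact_of_unique (isCompact_closedBall (0 : Mat q) (2 * (‖X j‖ + s)))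
      (fun i => mem_closedBall_zero_iff.mpr ((h i).norm_le j)) fun u _ hu Z hZ => ?_
    exact h₀.stat_unique j Z (IsStat.of_tendsto (fun i => (h i).isStat j) (hK.mono_left hu) hZ)
  have hLt : Tendsto Lt l (𝓝 Lt₀) := by
    refine tendsto_of_isCompact_of_unique (isCompact_closedBall (0 : LMap q d) (2 * (‖Ls‖ + 1)))
      (fun i => mem_closedBall_zero_iff.mpr (h i).norm_le') fun u _ hu Z hZ => ?_
    exact (h₀.leastSquares_iff Z).mp (IsLeastSquares.of_tendsto
      (fun i => ((h i).leastSquares_iff _).mpr rfl) hZ (hX.mono_left hu))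
  have h1 := tendsto_sinkhorn_limit hq ((continuous_component.tendsto Lt₀).comp hLt)
    (fun i => (h i).nearIso) h₀.nearIso (fun i => (h i).row) h₀.row (fun i => (h i).col) h₀.col
    (fun i => (h i).output.tendsto) h₀.output.tendsto
  have h2 := (continuous_ofComponents.tendsto _).comp h1
  simpa [Function.comp_def] using h2

lemma IsTrace.tendsto (hq : 1 ≤ q) {K : ι → ℕ → LMap q d} {L : ℕ → LMap q d}
    (h : ∀ i, IsTrace Ls r s X e (K i)) (h₀ : IsTrace Ls r s X e L)
    (h0 : Tendsto (fun i => K i 0) l (𝓝 (L 0))) (t : ℕ) :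
    Tendsto (fun i => K i t) l (𝓝 (L t)) := by
  induction t with
  | zero => exact h0
  | succ t ih =>
    choose Xh Lt hp using fun i => (h i).exists_pass t
    obtain ⟨Xh₀, Lt₀, hp₀⟩ := h₀.exists_pass t
    exact IsPass.tendsto hq hp hp₀ ih

/-- Each iterate is continuous in the initial guess and the geometric rate does not depend on the
guess, so the limit is continuous too. -/
lemma IsTrace.tendsto_limit (hq : 1 ≤ q) {K : ι → ℕ → LMap q d} {L : ℕ → LMap q d}
    (h : ∀ i, IsTrace Ls r s X e (K i)) (h₀ : IsTrace Ls r s X e L)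
    (h0 : Tendsto (fun i => K i 0) l (𝓝 (L 0))) {F : ι → LMap q d} {F₀ : LMap q d}
    (hF : ∀ i, Tendsto (K i) atTop (𝓝 (F i))) (hF₀ : Tendsto L atTop (𝓝 F₀)) :
    Tendsto F l (𝓝 F₀) := by
  rw [Metric.tendsto_nhds]
  intro ε hε
  obtain ⟨t, ht⟩ : ∃ t : ℕ, 1200 * (‖Ls‖ + 1) * e / 2 ^ t < ε / 3 := by
    have hz : Tendsto (fun t : ℕ => 1200 * (‖Ls‖ + 1) * e / 2 ^ t) atTop (𝓝 0) := by
      have := (tendsto_pow_atTop_nhds_zero_of_lt_one (r := (1 / 2 : ℝ)) (by norm_num)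
        (by norm_num)).const_mul (1200 * (‖Ls‖ + 1) * e)
      simpa [div_eq_mul_inv] using this
    exact (hz.eventually (gt_mem_nhds (by linarith))).exists
  filter_upwards [Metric.tendsto_nhds.mp (IsTrace.tendsto hq h h₀ h0 t) (ε / 3) (by linarith)]
    with i hi
  have h1 := dist_le_of_le_geometric_two_of_tendsto (h i).dist_succ_le (hF i) t
  have h2 := dist_le_of_le_geometric_two_of_tendsto h₀.dist_succ_le hF₀ t
  have h3 := dist_triangle4 (F i) (K i t) (L t) F₀
  rw [dist_comm (F i) (K i t)] at h3
  linarith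

/-! ### Equivariance under left multiplication by orthogonal matrices -/

/-- Functional calculus commutes with conjugation by an orthogonal matrix, which is a star-algebra
automorphism. -/
lemma invSqrt_conj {U : Matrix (Fin q) (Fin q) ℝ} (hU : U * U.transpose = 1)
    {R : Matrix (Fin q) (Fin q) ℝ} (hR : R.IsHermitian) :
    invSqrt (U.transpose * R * U) = U.transpose * invSqrt R * U := by
  have hU' : U.transpose * U = 1 := mul_eq_one_comm.mp hU
  let u : unitary (Matrix (Fin q) (Fin q) ℝ) := ⟨U.transpose, by
    rw [Unitary.mem_iff, star_eq_transpose, Matrix.transpose_transpose]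
    exact ⟨hU, hU'⟩⟩
  have e : ∀ A, Unitary.conjStarAlgAut ℝ (Matrix (Fin q) (Fin q) ℝ) u A =
      U.transpose * A * U := by
    intro A
    rw [Unitary.conjStarAlgAut_apply]
    have : star (u : Matrix (Fin q) (Fin q) ℝ) = U := by
      rw [star_eq_transpose]; exact Matrix.transpose_transpose U
    rw [this]
  have hsa : IsSelfAdjoint R := hR
  have h := StarAlgHomClass.map_cfc (Unitary.conjStarAlgAut ℝ (Matrix (Fin q) (Fin q) ℝ) u)
    (fun x : ℝ => (√x)⁻¹) R (continuousOn_spectrum _ _)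
    (by
      have : (Unitary.conjStarAlgAut ℝ (Matrix (Fin q) (Fin q) ℝ) u : _ → _) =
        fun A => U.transpose * A * U := funext e
      rw [this]; fun_prop) hsa
    (by rw [e]; exact isHermitian_iff_transpose.mpr (by
      simp [isHermitian_iff_transpose.mp hR, mul_assoc]))
  rw [e, e] at h
  exact h.symm

lemma sinkhornRow_mul {U : Matrix (Fin q) (Fin q) ℝ} (hU : U * U.transpose = 1)
    (a : Fin d → Matrix (Fin q) (Fin q) ℝ) :
    sinkhornRow (fun i => U.transpose * a i) = fun i => U.transpose * sinkhornRow a i := by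
  have h1 : ∑ k, (U.transpose * a k) * (U.transpose * a k).transpose =
      U.transpose * (∑ k, a k * (a k).transpose) * U := by
    rw [Finset.mul_sum, Finset.sum_mul]
    refine Finset.sum_congr rfl fun k _ => ?_
    simp [mul_assoc]
  have h2 : (∑ k, a k * (a k).transpose).IsHermitian := by
    rw [isHermitian_iff_transpose, Matrix.transpose_sum]
    simp
  funext i
  rw [sinkhornRow, h1, invSqrt_conj hU h2, sinkhornRow, Matrix.mul_smul]
  congr 1
  calc _ = U.transpose * invSqrt (∑ k, a k * (a k).transpose) * (U * U.transpose) * a i := by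
        simp only [mul_assoc]
    _ = _ := by rw [hU, mul_one, mul_assoc]

lemma sinkhornCol_mul {U : Matrix (Fin q) (Fin q) ℝ} (hU : U * U.transpose = 1)
    (a : Fin d → Matrix (Fin q) (Fin q) ℝ) :
    sinkhornCol (fun i => U.transpose * a i) = fun i => U.transpose * sinkhornCol a i := by
  have h1 : ∑ k, (U.transpose * a k).transpose * (U.transpose * a k) =
      ∑ k, (a k).transpose * a k := by
    refine Finset.sum_congr rfl fun k _ => ?_
    rw [Matrix.transpose_mul, Matrix.transpose_transpose]
    calc _ = (a k).transpose * (U * U.transpose) * a k := by simp only [mul_assoc]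
      _ = _ := by rw [hU, mul_one]
  funext i
  rw [sinkhornCol, h1, sinkhornCol, Matrix.mul_smul, mul_assoc]

lemma lmul_eq_sandwich (U : Matrix (Fin q) (Fin q) ℝ) : lmul U = sandwich U 1 := by
  ext1 Z
  exact toMat_injective (by simp)

lemma component_comp_lmul (L : LMap q d) (U : Matrix (Fin q) (Fin q) ℝ) :
    component (L.comp (lmul U)) = fun i => U.transpose * component L i := by
  rw [lmul_eq_sandwich, component_comp_sandwich]
  simp

lemma IsSinkhornOutput.comp_lmul {U : Matrix (Fin q) (Fin q) ℝ} (hU : U * U.transpose = 1)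
    {L L' : LMap q d} (h : IsSinkhornOutput L L') :
    IsSinkhornOutput (L.comp (lmul U)) (L'.comp (lmul U)) := by
  have h1 : ∀ k, (fun A => sinkhornCol (sinkhornRow A))^[k] (component (L.comp (lmul U))) =
      fun i => U.transpose * (fun A => sinkhornCol (sinkhornRow A))^[k] (component L) i := by
    intro k
    induction k with
    | zero => exact component_comp_lmul L U
    | succ k ih =>
      rw [Function.iterate_succ_apply', ih, sinkhornRow_mul hU, sinkhornCol_mul hU,
        Function.iterate_succ_apply']
  rw [← ofComponents_component (L'.comp (lmul U)), component_comp_lmul]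
  refine isSinkhornOutput_of_tendsto ?_
  simp only [h1]
  rw [tendsto_pi_nhds]
  intro i
  exact ((tendsto_pi_nhds.mp h.tendsto) i).const_mul U.transpose

lemma lmul_lmul_of_mul_eq_one {A B : Matrix (Fin q) (Fin q) ℝ} (h : A * B = 1) (Z : Mat q) :
    lmul A (lmul B Z) = Z :=
  toMat_injective (by rw [toMat_lmul, toMat_lmul, ← mul_assoc, h, one_mul])

lemma IsRankConstrainedMin.comp_lmul {U : Matrix (Fin q) (Fin q) ℝ} (hU : U * U.transpose = 1)
    {y : EuclideanSpace ℝ (Fin d)} {Z : Mat q} (h : IsRankConstrainedMin L y r Z) :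
    IsRankConstrainedMin (L.comp (lmul U)) y r (lmul U.transpose Z) := by
  refine ⟨(rank_lmul_le _ _).trans h.1, fun W hW => ?_⟩
  rw [ContinuousLinearMap.comp_apply, lmul_lmul_of_mul_eq_one hU]
  exact h.2 (lmul U W) ((rank_lmul_le _ _).trans hW)

lemma IsLeastSquares.comp_lmul {U : Matrix (Fin q) (Fin q) ℝ} (hU : U * U.transpose = 1)
    {y : Fin n → EuclideanSpace ℝ (Fin d)} {Z : Fin n → Mat q} (h : IsLeastSquares y Z L) :
    IsLeastSquares y (fun j => lmul U.transpose (Z j)) (L.comp (lmul U)) := by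
  intro L'
  simp only [ContinuousLinearMap.comp_apply, lmul_lmul_of_mul_eq_one hU]
  exact h (L'.comp (lmul U.transpose))

lemma IsTrace.isRun_comp_lmul {U : Matrix (Fin q) (Fin q) ℝ} (hU : U * U.transpose = 1)
    {L : ℕ → LMap q d} (h : IsTrace Ls r s X e L) :
    IsRun (fun j => Ls (X j)) r ((L 0).comp (lmul U)) fun t => (L t).comp (lmul U) := by
  refine ⟨rfl, fun t => ?_⟩
  obtain ⟨Xh, Lt, h1⟩ := h.exists_pass t
  exact ⟨fun j => lmul U.transpose (Xh j), Lt.comp (lmul U),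
    fun j => Or.inl ((h1.isMin j).comp_lmul hU),
    ((h1.leastSquares_iff _).mpr rfl).comp_lmul hU, h1.output.comp_lmul hU⟩

lemma IsNormalized.comp_lmul (hq : 1 ≤ q) {U : Matrix (Fin q) (Fin q) ℝ}
    (hU : U * U.transpose = 1) (h : IsNormalized L) : IsNormalized (L.comp (lmul U)) := by
  have hU' : U.transpose * U = 1 := mul_eq_one_comm.mp hU
  rw [isNormalized_iff hq] at h ⊢
  have e : component (L.comp (lmul U)) = fun i => U.transpose * component L i * 1 := by
    rw [component_comp_lmul]; simp
  rw [e, rowOp_sandwich, colOp_sandwich]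
  simp [h.1, h.2, hU, hU']

lemma isRankPreserver_lmul {U : Matrix (Fin q) (Fin q) ℝ} (hU : U * U.transpose = 1) :
    IsRankPreserver (lmul U) := by
  rw [lmul_eq_sandwich]
  exact isRankPreserver_sandwich (mul_eq_one_comm.mp hU) (one_mul 1)

lemma xi_comp_lmul_le_aux {U : Matrix (Fin q) (Fin q) ℝ} (hU : U * U.transpose = 1)
    (L : LMap q d) :
    {e : ℝ | ∃ E M : MatOp q, IsRankPreserver M ∧
      L = Ls.comp ((ContinuousLinearMap.id ℝ (Mat q) + E).comp M) ∧ e = euNorm E} ⊆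
    {e : ℝ | ∃ E M : MatOp q, IsRankPreserver M ∧ L.comp (lmul U) =
      Ls.comp ((ContinuousLinearMap.id ℝ (Mat q) + E).comp M) ∧ e = euNorm E} := by
  rintro e ⟨E, M, hM, hL, he⟩
  exact ⟨E, M.comp (lmul U), hM.comp (isRankPreserver_lmul hU), by rw [hL]; rfl, he⟩

/-- The rotation is a rank-preserver and is absorbed in `M`; applying this to the inverse rotation
gives the other inclusion. -/
lemma xi_comp_lmul {U : Matrix (Fin q) (Fin q) ℝ} (hU : U * U.transpose = 1) (L : LMap q d) :
    xi Ls (L.comp (lmul U)) = xi Ls L := by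
  have hU' : U.transpose * U.transpose.transpose = 1 := by
    rw [Matrix.transpose_transpose]; exact mul_eq_one_comm.mp hU
  refine congrArg sInf (Set.Subset.antisymm ?_ (xi_comp_lmul_le_aux hU L))
  have h := xi_comp_lmul_le_aux (Ls := Ls) hU' (L.comp (lmul U))
  have e : (L.comp (lmul U)).comp (lmul U.transpose) = L := by
    ext1 Z
    simp [lmul_lmul_of_mul_eq_one hU]
  rwa [e] at h

lemma IsAdmissibleGuess.comp_lmul (hq : 1 ≤ q) {U : Matrix (Fin q) (Fin q) ℝ}
    (hU : U * U.transpose = 1) (h : IsAdmissibleGuess Ls r L) :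
    IsAdmissibleGuess Ls r (L.comp (lmul U)) :=
  ⟨h.1.comp_lmul hq hU, by rw [xi_comp_lmul hU]; exact h.2⟩

/-- The rotation by the angle `θ` in the plane of two coordinates. -/
def rotation (i j : Fin q) (θ : ℝ) : Matrix (Fin q) (Fin q) ℝ :=
  1 + (Real.cos θ - 1) • (Matrix.single i i 1 + Matrix.single j j 1) +
    Real.sin θ • (Matrix.single i j 1 - Matrix.single j i 1)

lemma rotation_mul_transpose {i j : Fin q} (hij : i ≠ j) (θ : ℝ) :
    rotation i j θ * (rotation i j θ).transpose = 1 := by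
  set P : Matrix (Fin q) (Fin q) ℝ := Matrix.single i i 1 + Matrix.single j j 1 with hP
  set J : Matrix (Fin q) (Fin q) ℝ := Matrix.single i j 1 - Matrix.single j i 1 with hJ
  have hPt : P.transpose = P := by simp [hP]
  have hJt : J.transpose = -J := by simp [hJ]
  have hPP : P * P = P := by
    simp [hP, mul_add, add_mul, Matrix.single_mul_single_of_ne, hij, hij.symm]
  have hPJ : P * J = J := by
    simp [hP, hJ, mul_sub, add_mul, Matrix.single_mul_single_of_ne, hij, hij.symm]
  have hJP : J * P = J := by
    simp [hP, hJ, mul_add, sub_mul, Matrix.single_mul_single_of_ne, hij, hij.symm]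
    abel
  have hJJ : J * J = -P := by
    simp [hP, hJ, mul_sub, sub_mul, Matrix.single_mul_single_of_ne, hij, hij.symm]
    abel
  have hc := Real.cos_sq_add_sin_sq θ
  rw [rotation, ← hP, ← hJ]
  generalize Real.cos θ = c at hc
  generalize Real.sin θ = t at hc
  simp only [Matrix.transpose_add, Matrix.transpose_one, Matrix.transpose_smul, hPt, hJt,
    mul_add, add_mul, one_mul, mul_one, smul_mul_smul_comm, smul_neg, mul_neg, hPP, hPJ, hJP, hJJ]
  have : (c - 1) * (c - 1) + t * t + 2 * (c - 1) = 0 := by linarith [hc]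
  have h2 : ((c - 1) * (c - 1) + t * t + 2 * (c - 1)) • P = 0 := by rw [this, zero_smul]
  rw [← sub_eq_zero, ← h2]
  module

lemma rotation_ne_one {i j : Fin q} (hij : i ≠ j) {θ : ℝ} (hθ : Real.sin θ ≠ 0) :
    rotation i j θ ≠ 1 := by
  intro h
  have h1 := congrFun (congrFun h i) j
  rw [rotation] at h1
  simp [hij, hij.symm] at h1
  exact hθ h1

/-- `Ls` annihilates `U - 1` times each diagonal matrix unit; these have rank at most one, where
`Ls` is injective. -/
lemma eq_one_of_comp_lmul_eq (hr : 1 ≤ r) (hL : HasRIP r Ls) {U : Matrix (Fin q) (Fin q) ℝ}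
    (h : Ls.comp (lmul U) = Ls) : U = 1 := by
  refine Matrix.ext_of_mulVec_single fun i => ?_
  set Z := ofMat (Matrix.vecMulVec (Pi.single i (1 : ℝ)) (Pi.single i (1 : ℝ))) with hZ
  have h1 : Ls (lmul (U - 1) Z) = 0 := by
    have h2 : lmul (U - 1) Z = lmul U Z - Z := toMat_injective (by simp [sub_mul])
    rw [h2, map_sub, sub_eq_zero]
    exact congrArg (fun f : LMap q d => f Z) h
  have h2 := hL.ge (Z := lmul (U - 1) Z) ((rank_lmul_le _ _).trans
    ((rank_ofMat_vecMulVec_le _ _).trans (by omega)))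
  rw [h1, norm_zero] at h2
  have h3 : lmul (U - 1) Z = 0 := norm_le_zero_iff.mp (by linarith [norm_nonneg (lmul (U - 1) Z)])
  have h4 : (U - 1) * Matrix.vecMulVec (Pi.single i 1) (Pi.single i 1) = 0 := by
    have := congrArg toMat h3
    simpa [hZ] using this
  rw [Matrix.mul_vecMulVec] at h4
  have h5 : (U - 1).mulVec (Pi.single i 1) = 0 := by
    funext a
    have := congrFun (congrFun h4 a) i
    simpa [Matrix.vecMulVec_apply] using this
  rwa [Matrix.sub_mulVec, sub_eq_zero] at h5

/-- The initial guesses for which the iterates converge to `Ls` itself are nowhere dense. -/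
theorem isNowhereDense_converging (hn : 1 ≤ n) (h : IsEnsemble r s Λ Ls X Y)
    (hLs : IsNormalized Ls) (hq : 2 ≤ q)
    (hA : ∀ L, IsAdmissibleGuess Ls r L → IsPerturbation Ls e L) :
    IsNowhereDense {L₀ : {L₀ : LMap q d // IsAdmissibleGuess Ls r L₀} |
      ∃ L : ℕ → LMap q d, IsRun (fun j => Ls (X j)) r L₀ L ∧ Tendsto L atTop (𝓝 Ls)} := by
  have hex : ∀ L₀ : {L₀ : LMap q d // IsAdmissibleGuess Ls r L₀}, ∃ (L : ℕ → LMap q d)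
      (F : LMap q d), L 0 = L₀ ∧ IsTrace Ls r s X e L ∧ Tendsto L atTop (𝓝 F) := by
    intro L₀
    obtain ⟨L, h0, h1⟩ := (hA L₀ L₀.2).exists_trace hn h hLs
    obtain ⟨M, -, h2⟩ := h1.exists_limit h.one_le h.rip hLs
    exact ⟨L, _, h0, h1, h2⟩
  choose K F hK0 hK hF using hex
  have hcont : Continuous F := by
    rw [continuous_iff_continuousAt]
    intro L₀
    refine IsTrace.tendsto_limit (by omega) hK (hK L₀) ?_ hF (hF L₀)
    simp only [hK0]
    exact continuous_subtype_val.tendsto L₀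
  have hset : {L₀ : {L₀ : LMap q d // IsAdmissibleGuess Ls r L₀} |
      ∃ L : ℕ → LMap q d, IsRun (fun j => Ls (X j)) r L₀ L ∧ Tendsto L atTop (𝓝 Ls)} =
      F ⁻¹' {Ls} := by
    ext L₀
    constructor
    · rintro ⟨L, h1, h2⟩
      rw [← hK0] at h1
      rw [(hK L₀).eq_of_isRun h1] at h2
      exact tendsto_nhds_unique (hF L₀) h2
    · intro h1
      have h1' : F L₀ = Ls := h1
      refine ⟨K L₀, ?_, h1' ▸ hF L₀⟩
      rw [← hK0]; exact (hK L₀).isRun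
  rw [hset]
  -- The set is closed by continuity of the limit map, so only its interior has to be shown empty.
  refine ((isClosed_singleton.preimage hcont).isNowhereDense_iff).mpr ?_
  rw [Set.eq_empty_iff_forall_notMem]
  intro L₀ hL₀
  have h1q : 1 ≤ q := by omega
  let i : Fin q := ⟨0, by omega⟩
  let j : Fin q := ⟨1, by omega⟩
  have hij : i ≠ j := by simp [i, j]
  -- A path of admissible guesses through the supposed interior point, along which equivariance
  -- makes the limit rotate as well.
  let γ : ℝ → {L₀ : LMap q d // IsAdmissibleGuess Ls r L₀} := fun θ =>
    ⟨(L₀ : LMap q d).comp (lmul (rotation i j θ)), L₀.2.comp_lmul h1q (rotation_mul_transpose hij θ)⟩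
  have hγ : Continuous γ := by
    refine Continuous.subtype_mk ?_ _
    refine continuous_const.clm_comp ?_
    simp only [lmul_eq_sandwich]
    refine continuous_sandwich.comp (Continuous.prodMk ?_ continuous_const)
    fun_prop
  have hγ0 : γ 0 = L₀ := by
    refine Subtype.ext ?_
    show (L₀ : LMap q d).comp (lmul (rotation i j 0)) = L₀
    have : rotation i j 0 = 1 := by simp [rotation]
    rw [this]
    ext1 Z
    have : lmul 1 Z = Z := toMat_injective (by simp)
    rw [ContinuousLinearMap.comp_apply, this]
  have hFγ : ∀ θ, F (γ θ) = (F L₀).comp (lmul (rotation i j θ)) := by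
    intro θ
    have h1 := (hK L₀).isRun_comp_lmul (rotation_mul_transpose hij θ)
    have h2 : IsRun (fun j => Ls (X j)) r (K (γ θ) 0)
        fun t => (K L₀ t).comp (lmul (rotation i j θ)) := by
      rw [hK0] at h1 ⊢
      exact h1
    have h3 := (hK (γ θ)).eq_of_isRun h2
    have h4 : Tendsto (fun t => (K L₀ t).comp (lmul (rotation i j θ))) atTop
        (𝓝 ((F L₀).comp (lmul (rotation i j θ)))) := by
      have hc : Continuous fun p : LMap q d => p.comp (lmul (rotation i j θ)) :=
        continuous_id.clm_comp continuous_const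
      exact (hc.tendsto _).comp (hF L₀)
    rw [h3] at h4
    exact tendsto_nhds_unique (hF _) h4
  have hnear : ∀ᶠ θ in 𝓝 (0 : ℝ), F (γ θ) = Ls := by
    have h1 := hγ.tendsto 0
    rw [hγ0] at h1
    exact h1.eventually (mem_interior_iff_mem_nhds.mp hL₀)
  have hF0 : L₀ ∈ F ⁻¹' {Ls} := interior_subset hL₀
  replace hF0 : F L₀ = Ls := hF0
  obtain ⟨ε, hε, hball⟩ := Metric.eventually_nhds_iff.mp hnear
  set θ := min (ε / 2) 1 with hθ
  have hθ0 : 0 < θ := lt_min (by linarith) one_pos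
  have h1 := hball (y := θ) (by
    rw [dist_zero_right, Real.norm_eq_abs, abs_of_pos hθ0]
    exact (min_le_left _ _).trans_lt (by linarith))
  rw [hFγ, hF0] at h1
  refine rotation_ne_one hij (θ := θ) ?_ (eq_one_of_comp_lmul_eq h.one_le h.rip h1)
  refine (Real.sin_pos_of_pos_of_lt_pi hθ0 ?_).ne'
  exact (min_le_right _ _).trans_lt (by linarith [Real.pi_gt_three])

end

/-! ### The Hilbert-Schmidt coordinates -/

lemma hsEquiv_apply (A : MatOp q) (p : (Fin q × Fin q) × (Fin q × Fin q)) :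
    hsEquiv q A p = A (EuclideanSpace.single p.2 1) p.1 := by
  obtain ⟨i, j⟩ := p
  simp only [hsEquiv]
  trans LinearMap.toMatrix (EuclideanSpace.basisFun (Fin q × Fin q) ℝ).toBasis
    (EuclideanSpace.basisFun (Fin q × Fin q) ℝ).toBasis (A : Mat q →ₗ[ℝ] Mat q) i j
  · rfl
  · rw [LinearMap.toMatrix_apply]
    simp

lemma inner_hsEquiv (A B : MatOp q) : ⟪hsEquiv q A, hsEquiv q B⟫_ℝ = hsInner A B := by
  rw [hsInner_eq_sum, PiLp.inner_apply, Fintype.sum_prod_type, Finset.sum_comm]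
  refine Finset.sum_congr rfl fun p _ => ?_
  rw [PiLp.inner_apply]
  simp only [hsEquiv_apply]

lemma euNorm_eq (A : MatOp q) : euNorm A = hsNorm A := by
  rw [euNorm, ← sq_eq_sq₀ (norm_nonneg _) (hsNorm_nonneg _), ← real_inner_self_eq_norm_sq,
    inner_hsEquiv, hsInner_self]

/-! ### The restricted isometry constant -/

/-- The constant is an infimum over a closed, nonempty set bounded below, hence attained. A matrix
unit provides the lower bound, which requires `1 ≤ r`. -/
lemma hasRIP_of_ripConst {r : ℕ} {L : LMap q d} (hq : 1 ≤ q) (hr : 1 ≤ r)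
    (h : ripConst (4 * r) L ≤ 1 / 20) : HasRIP r L := by
  set D := {δ : ℝ | ∀ X : Mat q, rank X ≤ 4 * r →
    (1 - δ) * ‖X‖ ^ 2 ≤ ‖L X‖ ^ 2 ∧ ‖L X‖ ^ 2 ≤ (1 + δ) * ‖X‖ ^ 2} with hD
  have hne : D.Nonempty := by
    refine ⟨‖L‖ ^ 2 + 1, fun X _ => ?_⟩
    have h1 := pow_le_pow_left₀ (norm_nonneg _) (L.le_opNorm X) 2
    rw [mul_pow] at h1
    constructor <;> nlinarith [sq_nonneg ‖X‖, sq_nonneg ‖L X‖, mul_nonneg (sq_nonneg ‖L‖)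
      (sq_nonneg ‖X‖)]
  have hbd : BddBelow D := by
    refine ⟨0, fun δ hδ => ?_⟩
    let p : Fin q × Fin q := (⟨0, hq⟩, ⟨0, hq⟩)
    have h1 := hδ (EuclideanSpace.single p 1) ((rank_single_le p).trans (by omega))
    rw [PiLp.norm_single, norm_one] at h1
    linarith [h1.1, h1.2]
  have hcl : IsClosed D := by
    simp only [hD, Set.ofPred_forall, Set.ofPred_and]
    refine isClosed_iInter fun X => isClosed_iInter fun _ => IsClosed.inter ?_ ?_
    · exact isClosed_le (by fun_prop) (by fun_prop)
    · exact isClosed_le (by fun_prop) (by fun_prop)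
  intro Z hZ
  obtain ⟨h1, h2⟩ := hcl.csInf_mem hne hbd Z hZ
  have h' : sInf D ≤ 1 / 20 := h
  have h3 := mul_le_mul_of_nonneg_right h' (sq_nonneg ‖Z‖)
  constructor <;> linarith

lemma HasRIP.norm_ge {r : ℕ} {L : LMap q d} (h : HasRIP r L) (hq : 1 ≤ q) (hr : 1 ≤ r) :
    0.974 ≤ ‖L‖ := by
  let p : Fin q × Fin q := (⟨0, hq⟩, ⟨0, hq⟩)
  have h1 := h.ge (Z := EuclideanSpace.single p 1) ((rank_single_le p).trans (by omega))
  have h2 := L.le_opNorm (EuclideanSpace.single p 1)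
  rw [PiLp.norm_single, norm_one, mul_one] at h1 h2
  exact h1.trans h2

/-! ### The covariance operator -/

section
variable {X : Fin n → Mat q}

lemma inner_covariance (X : Fin n → Mat q) (Z W : Mat q) :
    ⟪covariance X Z, W⟫_ℝ = (n : ℝ)⁻¹ * ∑ j, ⟪X j, Z⟫_ℝ * ⟪X j, W⟫_ℝ := by
  simp [covariance, sum_apply, boxOp_apply, inner_smul_left, sum_inner]

lemma covariance_isSymmetric (X : Fin n → Mat q) :
    (covariance X : Mat q →ₗ[ℝ] Mat q).IsSymmetric := by
  intro Z W
  rw [ContinuousLinearMap.coe_coe, inner_covariance, real_inner_comm, inner_covariance]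
  congr 1
  exact Finset.sum_congr rfl fun j _ => mul_comm _ _

lemma finite_eigenvalues (T : MatOp q) :
    {μ : ℝ | Module.End.HasEigenvalue (T : Module.End ℝ (Mat q)) μ}.Finite :=
  Module.End.finite_hasEigenvalue _

/-- Diagonalize the symmetric covariance operator: its eigenvalues lie within the half-spread of the
midpoint. -/
lemma norm_covariance_sub_le (X : Fin n → Mat q) (Z : Mat q) :
    ‖covariance X Z - covLambda X • Z‖ ≤ |covDelta X| * ‖Z‖ := by
  have hT := covariance_isSymmetric X
  set b := hT.eigenvectorBasis rfl with hb
  have hbd : ∀ i, |hT.eigenvalues rfl i - covLambda X| ≤ |covDelta X| := by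
    intro i
    have hmem : hT.eigenvalues rfl i ∈ {μ : ℝ | Module.End.HasEigenvalue
        (covariance X : Module.End ℝ (Mat q)) μ} := hT.hasEigenvalue_eigenvalues rfl i
    have h1 : hT.eigenvalues rfl i ≤ lambdaMax (covariance X) :=
      le_csSup (finite_eigenvalues _).bddAbove hmem
    have h2 : lambdaMin (covariance X) ≤ hT.eigenvalues rfl i :=
      csInf_le (finite_eigenvalues _).bddBelow hmem
    refine le_trans ?_ (le_abs_self _)
    rw [covLambda, covDelta, abs_le]
    constructor <;> linarith
  refine le_of_sq_le_sq ?_ (by positivity)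
  rw [← b.sum_sq_norm_inner_right, mul_pow, ← b.sum_sq_norm_inner_right, Finset.mul_sum]
  refine Finset.sum_le_sum fun i _ => ?_
  have h1 : ⟪b i, covariance X Z - covLambda X • Z⟫_ℝ =
      (hT.eigenvalues rfl i - covLambda X) * ⟪b i, Z⟫_ℝ := by
    rw [inner_sub_right, inner_smul_right]
    have h2 : ⟪b i, covariance X Z⟫_ℝ = ⟪covariance X (b i), Z⟫_ℝ := (hT (b i) Z).symm
    have h3 : covariance X (b i) = hT.eigenvalues rfl i • b i := hT.apply_eigenvectorBasis rfl i
    rw [h2, h3, inner_smul_left]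
    simp; ring
  rw [h1, norm_mul, mul_pow]
  refine mul_le_mul_of_nonneg_right ?_ (sq_nonneg _)
  exact pow_le_pow_left₀ (norm_nonneg _) (hbd i) 2

lemma eigenvalue_covariance_nonneg {μ : ℝ} (h : Module.End.HasEigenvalue
    (covariance X : Module.End ℝ (Mat q)) μ) : 0 ≤ μ := by
  obtain ⟨v, hv⟩ := h.exists_hasEigenvector
  have h1 : covariance X v = μ • v := hv.apply_eq_smul
  have h2 := inner_covariance X v v
  rw [h1, inner_smul_left, real_inner_self_eq_norm_sq] at h2
  have h3 : 0 ≤ (n : ℝ)⁻¹ * ∑ j, ⟪X j, v⟫_ℝ * ⟪X j, v⟫_ℝ :=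
    mul_nonneg (by positivity) (Finset.sum_nonneg fun j _ => mul_self_nonneg _)
  rw [← h2] at h3
  have h4 : 0 < ‖v‖ ^ 2 := by have := norm_pos_iff.mpr hv.2; positivity
  exact nonneg_of_mul_nonneg_left h3 h4

lemma covDelta_abs_le : |covDelta X| ≤ covLambda X ∧ 0 ≤ covDelta X := by
  have h1 : 0 ≤ lambdaMin (covariance X) := Real.sInf_nonneg fun μ h =>
    eigenvalue_covariance_nonneg h
  have h2 : lambdaMin (covariance X) ≤ lambdaMax (covariance X) := by
    rcases Set.eq_empty_or_nonempty {μ : ℝ | Module.End.HasEigenvalue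
      (covariance X : Module.End ℝ (Mat q)) μ} with h0 | ⟨μ, hμ⟩
    · rw [lambdaMin, lambdaMax, h0]; simp
    · exact (csInf_le (finite_eigenvalues _).bddBelow hμ).trans
        (le_csSup (finite_eigenvalues _).bddAbove hμ)
  rw [covDelta, covLambda, abs_of_nonneg (by linarith)]
  constructor <;> linarith

/-- Eigenvalues are nonnegative, so a vanishing midpoint forces a vanishing spread and hence a zero
covariance. -/
lemma covLambda_pos (hn : 1 ≤ n) {j : Fin n} (hX : X j ≠ 0) : 0 < covLambda X := by
  have h0 : 0 ≤ covLambda X := (abs_nonneg _).trans covDelta_abs_le.1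
  refine h0.lt_of_ne fun h => ?_
  have h1 := norm_covariance_sub_le X (X j)
  have h2 : |covDelta X| = 0 := le_antisymm (h ▸ covDelta_abs_le.1) (abs_nonneg _)
  rw [← h, h2, zero_mul, zero_smul, sub_zero] at h1
  have h3 := inner_covariance X (X j) (X j)
  rw [norm_le_zero_iff.mp h1, inner_zero_left] at h3
  have hn0 : (n : ℝ)⁻¹ ≠ 0 := by positivity
  have h4 := (mul_eq_zero.mp h3.symm).resolve_left hn0
  rw [Finset.sum_eq_zero_iff_of_nonneg fun k _ => mul_self_nonneg _] at h4
  have h5 := mul_self_eq_zero.mp (h4 j (Finset.mem_univ j))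
  exact hX (inner_self_eq_zero.mp h5)

/-! ### The parameter `Ω` -/

lemma hsInner_adjoint_comp (L G : LMap q d) (T : MatOp q) :
    hsInner ((ContinuousLinearMap.adjoint L).comp G) T = hsInner G (L.comp T) := by
  rw [hsInner_eq_sum, hsInner_eq_sum]
  refine Finset.sum_congr rfl fun p _ => ?_
  exact ContinuousLinearMap.adjoint_inner_left L _ _

lemma hsEquiv_mem_orthogonal {F : MatOp q} (h : ∀ A B, hsInner F (tangentOp A B) = 0) :
    hsEquiv q F ∈ (rankPreserverTangent q)ᗮ := by
  rw [Submodule.mem_orthogonal]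
  intro u hu
  refine Submodule.span_induction ?_ ?_ ?_ ?_ hu
  · rintro u ⟨W₁, W₂, hW⟩
    have h1 : (hsEquiv q).symm u = tangentOp W₂ W₁ := by
      ext1 Z
      refine toMat_injective ?_
      rw [hW, tangentOp, add_apply, toMat_add, toMat_lmul, toMat_rmul]
    rw [← (hsEquiv q).apply_symm_apply u, h1, real_inner_comm, inner_hsEquiv]
    exact h _ _
  · exact inner_zero_left _
  · intro x y _ _ hx hy
    rw [inner_add_left, hx, hy, add_zero]
  · intro c x _ hx
    rw [inner_smul_left, hx, mul_zero]

/-- The average is the quadratic form of `tangentCovariance` at `F`. As `F` is orthogonal to the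
space `𝕎`, inserting the projection onto its complement changes nothing, and `covOmega` bounds the
result. -/
lemma avg_tangent_le {F : MatOp q} (h : ∀ A B, hsInner F (tangentOp A B) = 0) :
    (n : ℝ)⁻¹ * ∑ j, ‖(tangentSpace (X j)).starProjection (F (X j))‖ ^ 2 ≤
      covOmega X * hsNorm F ^ 2 := by
  have h1 : (n : ℝ)⁻¹ * ∑ j, ‖(tangentSpace (X j)).starProjection (F (X j))‖ ^ 2 =
      hsInner F (tangentCovariance X F) := by
    have e : tangentCovariance X F = (n : ℝ)⁻¹ • ∑ j,
        ((tangentSpace (X j)).starProjection.comp F).comp (boxOp (X j) (X j)) := rfl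
    rw [e, hsInner_smul_right, hsInner_sum_right]
    congr 1
    refine Finset.sum_congr rfl fun j _ => ?_
    rw [hsInner_comp_boxOp, ← real_inner_self_eq_norm_sq, ContinuousLinearMap.comp_apply,
      ← inner_starProjection_of_mem _ (Submodule.starProjection_apply_mem _ _), real_inner_comm]
  have h2 : hsInner F (tangentCovariance X F) =
      ⟪hsEquiv q F, tangentCovarianceHS X (hsEquiv q F)⟫_ℝ := by
    rw [← inner_hsEquiv]
    simp [tangentCovarianceHS]
  rw [h1, h2, inner_starProjection_of_mem _ (hsEquiv_mem_orthogonal h)]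
  have h3 : ‖hsEquiv q F‖ = hsNorm F := euNorm_eq F
  have h4 := (((rankPreserverTangent q)ᗮ.starProjection : HSOp q →L[ℝ] HSOp q).comp
    (tangentCovarianceHS X)).le_opNorm (hsEquiv q F)
  refine (real_inner_le_norm _ _).trans ?_
  rw [h3] at h4 ⊢
  refine (mul_le_mul_of_nonneg_left h4 (hsNorm_nonneg F)).trans_eq ?_
  rw [covOmega]; ring

end

/-! ### The hypotheses of the theorem -/

section
variable {r : ℕ} {s : ℝ} {X : Fin n → Mat q} {Ls : LMap q d}

lemma dim_le_of_surjective (h : Function.Surjective Ls) : √(d : ℝ) ≤ q := by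
  have h1 := LinearMap.finrank_le_finrank_of_surjective 
    (show Function.Surjective (Ls : Mat q →ₗ[ℝ] EuclideanSpace ℝ (Fin d)) from h)
  rw [finrank_euclideanSpace, finrank_euclideanSpace, Fintype.card_prod, Fintype.card_fin,
    Fintype.card_fin] at h1
  rw [Real.sqrt_le_left (Nat.cast_nonneg _), sq]
  exact_mod_cast h1

theorem exists_isEnsemble (hn : 1 ≤ n) (hr : 1 ≤ r) (hrq : r < q) (hs : 0 < s)
    (hrank : ∀ j, rank (X j) = r) (hsv : ∀ j, sigma 1 (X j) ≤ s ∧ s / 2 ≤ sigma r (X j))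
    (hOmega : covOmega X / covLambda X ≤ (d : ℝ) / (40 * (q : ℝ) ^ 2))
    (hDelta : covDelta X / covLambda X ≤ √(d : ℝ) / (150 * (q : ℝ) ^ 3))
    (hrip : HasRIP r Ls) (hsurj : Function.Surjective Ls)
    (hLnorm : ‖Ls‖ ^ 2 ≤ 5 * (q : ℝ) ^ 2 / d) :
    ∃ Y, IsEnsemble r s (covLambda X) Ls X Y := by
  choose Y h1 h2 h3 using fun j =>
    exists_generalized_inverse_of_sigma hs (hrank j) (hsv j).2
  have hX0 : X ⟨0, hn⟩ ≠ 0 := by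
    intro h
    have := hrank ⟨0, hn⟩
    rw [h, rank_zero] at this
    omega
  have hΛ := covLambda_pos hn hX0
  have hq2 : (2 : ℝ) ≤ q := by exact_mod_cast (by omega : 2 ≤ q)
  have hq0 : (0 : ℝ) < q := by linarith
  refine ⟨Y, hr, fun j => ⟨hs, hrank j, (norm_toMat_le_sigma _).trans (hsv j).1, h1 j, h2 j,
    h3 j⟩, hrip, hΛ, fun Z => ?_, fun G hG => ?_⟩
  · refine (norm_covariance_sub_le X Z).trans (mul_le_mul_of_nonneg_right ?_ (norm_nonneg Z))
    rw [abs_of_nonneg covDelta_abs_le.2]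
    rw [div_le_iff₀ hΛ] at hDelta
    refine hDelta.trans ?_
    rw [mul_comm]
    refine mul_le_mul_of_nonneg_left ?_ hΛ.le
    -- With `√d ≤ q` and `q ≥ 2` the bound on the spread becomes `1 / (150 q²) ≤ 1 / 600`.
    have hd := dim_le_of_surjective hsurj
    rw [div_le_div_iff₀ (by positivity) (by norm_num)]
    nlinarith [pow_pos hq0 2, pow_pos hq0 3]
  · have h4 := avg_tangent_le (X := X) (F := (ContinuousLinearMap.adjoint Ls).comp G)
      fun A B => by rw [hsInner_adjoint_comp]; exact hG A B
    simp only [ContinuousLinearMap.comp_apply] at h4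
    refine h4.trans ?_
    have h5 : hsNorm ((ContinuousLinearMap.adjoint Ls).comp G) ≤ ‖Ls‖ * hsNorm G := by
      refine (hsNorm_comp_le _ _).trans_eq ?_
      rw [LinearIsometryEquiv.norm_map]
    have h6 := pow_le_pow_left₀ (hsNorm_nonneg _) h5 2
    rw [mul_pow] at h6
    have hΩ : 0 ≤ covOmega X := norm_nonneg _
    rw [div_le_iff₀ hΛ] at hOmega
    calc _ ≤ covOmega X * (‖Ls‖ ^ 2 * hsNorm G ^ 2) := mul_le_mul_of_nonneg_left h6 hΩ
      _ = (covOmega X * ‖Ls‖ ^ 2) * hsNorm G ^ 2 := by ring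
      _ ≤ _ := mul_le_mul_of_nonneg_right ?_ (sq_nonneg _)
    -- The factors cancel: `d / (40 q²) * (5 q² / d) = 1 / 8`. The case `d = 0`, where division
    -- gives 0, is separate.
    refine (mul_le_mul hOmega hLnorm (sq_nonneg _) (by positivity)).trans ?_
    rcases Nat.eq_zero_or_pos d with h0 | h0
    · rw [h0]; simp; positivity
    · have hd : (0 : ℝ) < d := by exact_mod_cast h0
      refine le_of_eq ?_
      field_simp
      norm_num

/-- One factor `l` cancels and `q'^(7/2)` leaves `q'^(3/2) ≥ 2.8`; with `l ≥ 0.974` the product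
exceeds `2.5 = 90000 / 36000`. -/
lemma admissible_bound {q' l : ℝ} {r : ℕ} (hq : 2 ≤ q') (hr : 1 ≤ r) (hl : 0.974 ≤ l) :
    l * (1 / (36000 * q' ^ (7 / 2 : ℝ) * (r : ℝ) ^ 2 * l ^ 2)) * q' ^ 2 ≤ 1 / 90000 := by
  have hq0 : 0 < q' := by linarith
  have hr1 : (1 : ℝ) ≤ (r : ℝ) ^ 2 := one_le_pow₀ (by exact_mod_cast hr)
  have e1 : q' ^ (7 / 2 : ℝ) = q' ^ 2 * q' ^ (3 / 2 : ℝ) := by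
    rw [← Real.rpow_natCast q' 2, ← Real.rpow_add hq0]; norm_num
  have h1 : 2.8 ≤ q' ^ (3 / 2 : ℝ) := by
    have h2 : (2.8 : ℝ) ≤ 2 ^ (3 / 2 : ℝ) := by
      have h8 : ((2 : ℝ) ^ (3 / 2 : ℝ)) ^ 2 = 8 := by
        rw [← Real.rpow_natCast, ← Real.rpow_mul (by norm_num)]
        norm_num
      exact le_of_sq_le_sq (by rw [h8]; norm_num) (by positivity)
    exact h2.trans (Real.rpow_le_rpow (by norm_num) hq (by norm_num))
  set z := q' ^ (3 / 2 : ℝ)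
  have hz : 0 < z := by linarith
  have hr0 : 0 < (r : ℝ) ^ 2 := by linarith
  have hl0 : 0 < l := by linarith
  have e2 : l * (1 / (36000 * q' ^ (7 / 2 : ℝ) * (r : ℝ) ^ 2 * l ^ 2)) * q' ^ 2 =
      1 / (36000 * z * (r : ℝ) ^ 2 * l) := by
    rw [e1]; field_simp
  rw [e2, one_div_le_one_div (by positivity) (by norm_num)]
  have h3 : 2.5 ≤ z * l := by nlinarith
  have h4 : z * l ≤ (z * l) * (r : ℝ) ^ 2 := le_mul_of_one_le_right (by positivity) hr1
  nlinarith

theorem IsAdmissibleGuess.isPerturbation {L : LMap q d} (hq : 2 ≤ q) (hr : 1 ≤ r)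
    (hrip : HasRIP r Ls) (hsurj : Function.Surjective Ls) (h : IsAdmissibleGuess Ls r L) :
    IsPerturbation Ls
      (‖Ls‖ * (1 / (36000 * (q : ℝ) ^ (7 / 2 : ℝ) * (r : ℝ) ^ 2 * ‖Ls‖ ^ 2))) L := by
  obtain ⟨hn, hxi⟩ := h
  -- Nonemptiness matters because `sInf ∅ = 0` would make the distance vacuous. A right inverse of
  -- `Ls` realizes every `L` with `M` the identity.
  have hne : {e : ℝ | ∃ E M : MatOp q, IsRankPreserver M ∧
      L = Ls.comp ((ContinuousLinearMap.id ℝ (Mat q) + E).comp M) ∧ e = euNorm E}.Nonempty := by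
    obtain ⟨g, hg⟩ := (Ls : Mat q →ₗ[ℝ] EuclideanSpace ℝ (Fin d)).exists_rightInverse_of_surjective
      (LinearMap.range_eq_top.mpr hsurj)
    refine ⟨_, (LinearMap.toContinuousLinearMap g).comp (L - Ls), ContinuousLinearMap.id ℝ _,
      fun X => rfl, ?_, rfl⟩
    ext1 Z
    have h1 : ∀ y, Ls (g y) = y := fun y => LinearMap.congr_fun hg y
    simp [h1]
  obtain ⟨_, ⟨E, M, hM, hL, rfl⟩, hE⟩ := exists_lt_of_csInf_lt hne hxi
  rw [euNorm_eq] at hE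
  refine ⟨hn, Ls.comp E, M, hM, ⟨by positivity, by omega, ?_, hq, ?_⟩, ?_⟩
  · exact admissible_bound (by exact_mod_cast hq) hr (hrip.norm_ge (by omega) hr)
  · exact (hsNorm_comp_le _ _).trans (mul_le_mul_of_nonneg_left hE.le (norm_nonneg _))
  · rw [hL]
    ext1 Z
    simp

end

end SemidefReg

end

/-! ### The proposition -/

open SemidefReg in
theorem mainTheorem2 {q d n : ℕ} (r : ℕ) (s : ℝ) (Xstar : Fin n → Mat q) (Lstar : LMap q d)
    (hn : 1 ≤ n) (hr : 1 ≤ r) (hrq : r < q) (hs : 0 < s)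
    (hrank : ∀ j, rank (Xstar j) = r)
    (hsv : ∀ j, sigma 1 (Xstar j) ≤ s ∧ s / 2 ≤ sigma r (Xstar j))
    (hOmega : covOmega Xstar / covLambda Xstar ≤ (d : ℝ) / (40 * (q : ℝ) ^ 2))
    (hDelta : covDelta Xstar / covLambda Xstar ≤ √(d : ℝ) / (150 * (q : ℝ) ^ 3))
    (hrip : ripConst (4 * r) Lstar ≤ 1 / 20)
    (hnormalized : IsNormalized Lstar)
    (hsurj : Function.Surjective Lstar)
    (hLnorm : ‖Lstar‖ ^ 2 ≤ 5 * (q : ℝ) ^ 2 / d) :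
    (∀ L₀ : LMap q d, IsAdmissibleGuess Lstar r L₀ →
      (∃! L : ℕ → LMap q d, IsRun (fun j => Lstar (Xstar j)) r L₀ L) ∧
      ∀ L : ℕ → LMap q d, IsRun (fun j => Lstar (Xstar j)) r L₀ L →
        CauchySeq L ∧
        ∃ Lhat : LMap q d, Filter.Tendsto L Filter.atTop (nhds Lhat) ∧
          regularizerBall Lhat = regularizerBall Lstar) ∧
    IsNowhereDense {L₀ : {L₀ : LMap q d // IsAdmissibleGuess Lstar r L₀} |
      ∃ L : ℕ → LMap q d, IsRun (fun j => Lstar (Xstar j)) r L₀ L ∧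
        Filter.Tendsto L Filter.atTop (nhds Lstar)} := by
  have hq : 2 ≤ q := by omega
  have hRIP := hasRIP_of_ripConst (by omega) hr hrip
  obtain ⟨Y, hE⟩ := exists_isEnsemble hn hr hrq hs hrank hsv hOmega hDelta hRIP hsurj hLnorm
  have hA := fun L (hL : IsAdmissibleGuess Lstar r L) => hL.isPerturbation hq hr hRIP hsurj
  refine ⟨fun L₀ hL₀ => ?_, isNowhereDense_converging hn hE hnormalized hq hA⟩
  obtain ⟨L, rfl, hT⟩ := (hA L₀ hL₀).exists_trace hn hE hnormalized
  obtain ⟨M, hM, hlim⟩ := hT.exists_limit hr hRIP hnormalized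
  refine ⟨⟨L, hT.isRun, fun L' h' => hT.eq_of_isRun h'⟩, fun L' h' => ?_⟩
  rw [hT.eq_of_isRun h']
  exact ⟨hT.cauchySeq, _, hlim, hM.regularizerBall_comp Lstar⟩
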